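/- Let $n\in\mathbb N$ and let $(0,2\pi]^n$ be the cube of frequencies. On $\mathbb C^4\ni(\xi,\eta)=(\xi_1,\xi_2,\eta_1,\eta_2)$, the Hamiltonian equations of a (time-dependent) polynomial $h(t,\xi,\eta)$ are $\dot\xi_j=-i\,\partial h/\partial\eta_j$, $\dot\eta_j=i\,\partial h/\partial\xi_j$, $j=1,2$. A state $(\xi,\eta)$ is called real if $\eta_j=\bar\xi_j$ for $j=1,2$. Let $\mathrm{sp}(2)$ be the symplectic Lie algebra of two degrees of freedom written in these coordinates, i.e. the set of complex $4\times4$ matrices that are Hamiltonian ($A^{T}J+JA=0$ for the standard symplectic matrix $J$) and map real states to real states. Let $q(\theta,\xi,\eta)$ be a homogeneous polynomial of degree $2$ in $(\xi_1,\xi_2,\eta_1,\eta_2)$ whose coefficients are $2\pi$-periodic in each $\theta_i$ and analytic on the strip $\{\theta\in\mathbb C^n:|\operatorname{Im}\theta_i|\le\sigma,\ i=1,\dots,n\}$ for some $\sigma>0$, and which takes real values when $\theta\in\mathbb R^n$ and $(\xi,\eta)$ is real. For $|\varepsilon|<\varepsilon_0$ let $\nu_1,\nu_2:(0,2\pi]^n\to\mathbb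 R$ be $C^1$ functions of $\omega$ (which may depend on $\varepsilon$) such that, with constants $c,K>0$ independent of $\omega$ and $\varepsilon$, $$c\le|\nu_1(\omega)|\le K,\qquad c\,\varepsilon^2\le|\nu_2(\omega)|\le K\varepsilon^2,\qquad |\partial_\omega\nu_1(\omega)|,\ |\partial_\omega\nu_2(\omega)|\le K\varepsilon^2 .$$ Consider the quasi-periodic Hamiltonian $$h_\varepsilon(t,\xi,\eta)=\nu_1\xi_1\eta_1+\nu_2\xi_2\eta_2+\varepsilon^3q(\omega t,\xi,\eta).$$ Then there exist $\varepsilon_*>0$ and $C>0$ such that for every real $\varepsilon$ with $|\varepsilon|<\varepsilon_*$ there is a measurable set $\mathcal E_\varepsilon\subset(0,2\pi]^n$ with $$\operatorname{meas}\big((0,2\pi]^n\setminus\mathcal E_\varepsilon\big)\le C|\varepsilon|^{1/9}$$ and, for every $\omega\in\mathcal E_\varepsilon$, a real-analytic map $\theta\mapsto A_\omega(\theta)\in\mathrm{sp}(2)$ on $\mathbb R^n$, $2\pi$-periodic in each variable, all of whose matrix entries are bounded by $C|\varepsilon|$ for all $\theta\in\mathbb R^n$, and real numbers $\tilde\nu_1,\tilde\nu_2$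 (depending on $\varepsilon$ and $\omega$) with $$|\tilde\nu_j-\nu_j(\omega)|\le C|\varepsilon|^3,\qquad j=1,2,$$ such that the change of coordinates $(\xi',\eta')=e^{A_\omega(\omega t)}(\xi,\eta)$ conjugates the Hamiltonian equations of $h_\varepsilon$ to those of $h_\infty=\tilde\nu_1\xi_1\eta_1+\tilde\nu_2\xi_2\eta_2$: a curve $(\xi,\eta)(t)$, $t\in\mathbb R$, solves the former if and only if $e^{A_\omega(\omega t)}(\xi,\eta)(t)$ solves the latter. -/

import Mathlib

/-- The complex phase space `ℂ⁴` of two degrees of freedom: a state `z` has the coordinates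
`ξ_j = z (Sum.inl j)` and `η_j = z (Sum.inr j)`, `j = 0, 1`. -/
abbrev PhaseSpace : Type := Fin 2 ⊕ Fin 2 → ℂ

/-- Complex polynomials in `(ξ₁, ξ₂, η₁, η₂)`. -/
abbrev PhasePoly : Type := MvPolynomial (Fin 2 ⊕ Fin 2) ℂ

/-- The state `(ξ, η)` is real if `η` is the complex conjugate of `ξ`. -/
def IsRealState (z : PhaseSpace) : Prop :=
  ∀ j : Fin 2, z (Sum.inr j) = starRingEnd ℂ (z (Sum.inl j))

/-- `z` is a solution, on the whole time axis, of the Hamiltonian equations of the time-dependent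
polynomial Hamiltonian `h` for the symplectic form `i dξ ∧ dη`:
`ξ̇_j = -i ∂h/∂η_j`, `η̇_j = i ∂h/∂ξ_j`. -/
def SolvesHamilton (h : ℝ → PhasePoly) (z : ℝ → PhaseSpace) : Prop :=
  ∀ (t : ℝ) (j : Fin 2),
    HasDerivAt (fun s => z s (Sum.inl j))
      (-Complex.I * MvPolynomial.eval (z t) (MvPolynomial.pderiv (Sum.inr j) (h t))) t ∧
    HasDerivAt (fun s => z s (Sum.inr j))
      (Complex.I * MvPolynomial.eval (z t) (MvPolynomial.pderiv (Sum.inl j) (h t))) t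

/-- The quadratic normal form `a₁ ξ₁ η₁ + a₂ ξ₂ η₂`. -/
noncomputable def normalForm (a : Fin 2 → ℝ) : PhasePoly :=
  ∑ j : Fin 2, MvPolynomial.C ((a j : ℝ) : ℂ) *
    (MvPolynomial.X (Sum.inl j) * MvPolynomial.X (Sum.inr j))

/-- The closed complex strip `|Im θ_i| ≤ σ` around the torus; functions on it are functions on the
complexified torus when they are `2π`-periodic in each variable. -/
def complexStrip (n : ℕ) (σ : ℝ) : Set (Fin n → ℂ) :=
  {θ | ∀ i, |(θ i).im| ≤ σ}

/-- A real angle vector seen in `ℂⁿ`. -/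
def toComplexAngle {n : ℕ} (θ : Fin n → ℝ) : Fin n → ℂ := fun i => ((θ i : ℝ) : ℂ)

/-- `q` is a homogeneous polynomial of degree 2 in `(ξ, η)` whose coefficients are analytic
functions on the complexified torus of width `σ`, and which is real when the angle is real and the
state is real. -/
structure IsQuadraticPerturbation (n : ℕ) (σ : ℝ) (q : (Fin n → ℂ) → PhasePoly) : Prop where
  homogeneous : ∀ θ ∈ complexStrip n σ, (q θ).IsHomogeneous 2
  periodic : ∀ θ ∈ complexStrip n σ, ∀ i : Fin n,
    q (θ + Pi.single i (((2 * Real.pi : ℝ)) : ℂ)) = q θ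
  analytic : ∀ m : (Fin 2 ⊕ Fin 2) →₀ ℕ,
    AnalyticOnNhd ℂ (fun θ => MvPolynomial.coeff m (q θ)) (complexStrip n σ)
  real : ∀ (θ : Fin n → ℝ) (z : PhaseSpace), IsRealState z →
    (MvPolynomial.eval z (q (toComplexAngle θ))).im = 0

/-- The time-dependent Hamiltonian `a₁ ξ₁ η₁ + a₂ ξ₂ η₂ + ε³ q(ω t, ξ, η)`. -/
noncomputable def quasiPeriodicHam {n : ℕ} (a : Fin 2 → ℝ) (ε : ℝ)
    (q : (Fin n → ℂ) → PhasePoly) (ω : Fin n → ℝ) (t : ℝ) : PhasePoly :=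
  normalForm a + MvPolynomial.C (((ε ^ 3 : ℝ)) : ℂ) * q (toComplexAngle (t • ω))

/-- The cube `(0, 2π]ⁿ` of frequencies. -/
def freqCube (n : ℕ) : Set (Fin n → ℝ) :=
  Set.univ.pi fun _ => Set.Ioc 0 (2 * Real.pi)

/-- The frequencies `ν₁, ν₂`, at the parameter `ε`, are `C¹` in `ω` with
`c ≤ |ν₁| ≤ K`, `c ε² ≤ |ν₂| ≤ K ε²` and `|∂_ω ν₁|, |∂_ω ν₂| ≤ K ε²`. -/
structure FrequencyBounds (n : ℕ) (c K ε : ℝ) (ν : Fin 2 → (Fin n → ℝ) → ℝ) : Prop where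
  contDiff : ∀ j, ContDiffOn ℝ 1 (ν j) (freqCube n)
  first : ∀ ω ∈ freqCube n, c ≤ |ν 0 ω| ∧ |ν 0 ω| ≤ K
  second : ∀ ω ∈ freqCube n, c * ε ^ 2 ≤ |ν 1 ω| ∧ |ν 1 ω| ≤ K * ε ^ 2
  deriv : ∀ j, ∀ ω ∈ freqCube n, ‖fderivWithin ℝ (ν j) (freqCube n) ω‖ ≤ K * ε ^ 2

/-- The symplectic Lie algebra `sp(2)` of two degrees of freedom, written in the complex
coordinates `(ξ, η)`: Hamiltonian matrices (skew-adjoint for the symplectic form) that map real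
states to real states. -/
def sp2 : Set (Matrix (Fin 2 ⊕ Fin 2) (Fin 2 ⊕ Fin 2) ℂ) :=
  {A | A ∈ LieAlgebra.Symplectic.sp (Fin 2) ℂ ∧
    ∀ z : PhaseSpace, IsRealState z → IsRealState (A.mulVec z)}

/-- The time-dependent linear change of coordinates `(ξ', η') = e^{B(t)} (ξ, η)` conjugates the
Hamiltonian equations of `h` to those of `k`. -/
def ConjugatesHamilton (B : ℝ → Matrix (Fin 2 ⊕ Fin 2) (Fin 2 ⊕ Fin 2) ℂ)
    (h k : ℝ → PhasePoly) : Prop :=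
  ∀ z : ℝ → PhaseSpace,
    SolvesHamilton h z ↔ SolvesHamilton k (fun t => (NormedSpace.exp (B t)).mulVec (z t))

open MeasureTheory Filter Topology
open scoped Matrix.Norms.Operator BoundedContinuousFunction

/-- The open complex strip `|Im θ_i| < s`. -/
def openStrip (n : ℕ) (s : ℝ) : Set (Fin n → ℂ) := {θ | ∀ i, |(θ i).im| < s}

/-- The `ℓ¹` norm of an integer vector. -/
noncomputable def intNorm {n : ℕ} (m : Fin n → ℤ) : ℝ := ∑ i, |(m i : ℝ)|

/-- The exponential `e^{i m·θ}`. -/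
noncomputable def mode {n : ℕ} (m : Fin n → ℤ) (θ : Fin n → ℂ) : ℂ :=
  Complex.exp (Complex.I * ∑ i, (m i : ℂ) * θ i)

theorem openStrip_mono {n : ℕ} {s t : ℝ} (h : s ≤ t) : openStrip n s ⊆ openStrip n t :=
  fun _ hθ i => (hθ i).trans_le h

theorem isOpen_openStrip (n : ℕ) (s : ℝ) : IsOpen (openStrip n s) := by
  have : openStrip n s = ⋂ i, {θ : Fin n → ℂ | |(θ i).im| < s} := by
    ext θ; simp [openStrip]
  rw [this]
  refine isOpen_iInter_of_finite fun i => isOpen_lt ?_ continuous_const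
  exact (Complex.continuous_im.comp (continuous_apply i)).abs

theorem toComplexAngle_mem_openStrip {n : ℕ} {s : ℝ} (hs : 0 < s) (θ : Fin n → ℝ) :
    toComplexAngle θ ∈ openStrip n s := fun i => by simpa [toComplexAngle] using hs

theorem continuous_toComplexAngle (n : ℕ) : Continuous (toComplexAngle (n := n)) :=
  continuous_pi fun i => Complex.continuous_ofReal.comp (continuous_apply i)

theorem intNorm_nonneg {n : ℕ} (m : Fin n → ℤ) : 0 ≤ intNorm m :=
  Finset.sum_nonneg fun _ _ => abs_nonneg _

theorem intNorm_neg {n : ℕ} (m : Fin n → ℤ) : intNorm (-m) = intNorm m := by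
  simp [intNorm]

theorem intNorm_zero {n : ℕ} : intNorm (0 : Fin n → ℤ) = 0 := by
  simp [intNorm]

theorem abs_dot_le {n : ℕ} (m : Fin n → ℤ) {v : Fin n → ℝ} {b : ℝ} (hv : ∀ i, |v i| ≤ b) :
    |∑ i, (m i : ℝ) * v i| ≤ intNorm m * b := by
  rw [intNorm, Finset.sum_mul]
  refine (Finset.abs_sum_le_sum_abs _ _).trans (Finset.sum_le_sum fun i _ => ?_)
  rw [abs_mul]
  exact mul_le_mul_of_nonneg_left (hv i) (abs_nonneg _)

theorem norm_mode {n : ℕ} (m : Fin n → ℤ) (θ : Fin n → ℂ) :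
    ‖mode m θ‖ = Real.exp (-∑ i, (m i : ℝ) * (θ i).im) := by
  rw [mode, Complex.norm_exp]
  congr 1
  simp [Complex.mul_re]

theorem norm_mode_le {n : ℕ} (m : Fin n → ℤ) {θ : Fin n → ℂ} {s : ℝ}
    (hθ : ∀ i, |(θ i).im| ≤ s) : ‖mode m θ‖ ≤ Real.exp (s * intNorm m) := by
  rw [norm_mode, Real.exp_le_exp, mul_comm]
  exact (neg_le_abs _).trans (abs_dot_le m hθ)

theorem norm_mode_toComplexAngle {n : ℕ} (m : Fin n → ℤ) (θ : Fin n → ℝ) :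
    ‖mode m (toComplexAngle θ)‖ = 1 := by
  rw [norm_mode]; simp [toComplexAngle]

theorem mode_add {n : ℕ} (m : Fin n → ℤ) (θ η : Fin n → ℂ) :
    mode m (θ + η) = mode m θ * mode m η := by
  rw [mode, mode, mode, ← Complex.exp_add, ← mul_add, ← Finset.sum_add_distrib]
  congr 2
  exact Finset.sum_congr rfl fun i _ => by simp [mul_add]

theorem mode_add_period {n : ℕ} (m : Fin n → ℤ) (θ : Fin n → ℂ) (i : Fin n) :
    mode m (θ + Pi.single i ((2 * Real.pi : ℝ) : ℂ)) = mode m θ := by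
  rw [mode_add]
  have : mode m (Pi.single i ((2 * Real.pi : ℝ) : ℂ)) = 1 := by
    rw [mode, Complex.exp_eq_one_iff]
    refine ⟨m i, ?_⟩
    rw [Finset.sum_eq_single i]
    · simp; ring
    · intro j _ hj; simp [hj]
    · simp
  rw [this, mul_one]

theorem mode_zero {n : ℕ} (θ : Fin n → ℂ) : mode (0 : Fin n → ℤ) θ = 1 := by
  simp [mode]

theorem differentiable_mode {n : ℕ} (m : Fin n → ℤ) : Differentiable ℂ (mode m) := by
  unfold mode
  fun_prop

theorem conj_mode {n : ℕ} (m : Fin n → ℤ) (θ : Fin n → ℝ) :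
    starRingEnd ℂ (mode m (toComplexAngle θ)) = mode (-m) (toComplexAngle θ) := by
  rw [mode, mode, ← Complex.exp_conj]
  congr 1
  simp [toComplexAngle]

/-! ### Exponential sums over the lattice -/

theorem sum_exp_neg_abs_le {δ : ℝ} (hδ : 0 < δ) (hδ1 : δ ≤ 1) (N : ℕ) :
    ∑ k ∈ Finset.Icc (-(N : ℤ)) N, Real.exp (-δ * |(k : ℝ)|) ≤ 3 / δ := by
  have hq0 : 0 < Real.exp (-δ) := Real.exp_pos _
  have hq1 : Real.exp (-δ) < 1 := by rw [Real.exp_lt_one_iff]; linarith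
  have key : ∀ N : ℕ, ∑ k ∈ Finset.Icc (-(N : ℤ)) N, Real.exp (-δ * |(k : ℝ)|)
      = 1 + 2 * ∑ k ∈ Finset.range N, Real.exp (-δ) ^ (k + 1) := by
    intro N
    induction N with
    | zero => simp
    | succ N ih =>
      have h1 : Finset.Icc (-((N + 1 : ℕ) : ℤ)) ((N + 1 : ℕ) : ℤ)
          = insert (((N + 1 : ℕ) : ℤ)) (insert (-((N + 1 : ℕ) : ℤ)) (Finset.Icc (-(N : ℤ)) N)) := by
        ext k; simp only [Finset.mem_Icc, Finset.mem_insert]; push_cast; omega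
      rw [h1, Finset.sum_insert, Finset.sum_insert, ih, Finset.sum_range_succ, ← Real.exp_nat_mul]
      · have : |((N : ℝ) + 1)| = (N : ℝ) + 1 := abs_of_nonneg (by positivity)
        have h2 : |(-1 + -(N : ℝ))| = (N : ℝ) + 1 := by
          rw [show -1 + -(N : ℝ) = -((N : ℝ) + 1) by ring, abs_neg, this]
        simp [this, h2]
        rw [show δ * ((N : ℝ) + 1) = ((N : ℝ) + 1) * δ by ring]; ring
      · simp only [Finset.mem_Icc]; omega
      · simp only [Finset.mem_Icc, Finset.mem_insert]; push_cast; omega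
  rw [key N]
  have hgeo : ∑ k ∈ Finset.range N, Real.exp (-δ) ^ (k + 1) ≤ 1 / δ := by
    have h1 : ∑ k ∈ Finset.range N, Real.exp (-δ) ^ (k + 1)
        ≤ ∑' k : ℕ, Real.exp (-δ) ^ (k + 1) := by
      refine Summable.sum_le_tsum _ (fun _ _ => by positivity) ?_
      exact (summable_nat_add_iff 1).2 (summable_geometric_of_lt_one hq0.le hq1)
    have h2 : ∑' k : ℕ, Real.exp (-δ) ^ (k + 1) = Real.exp (-δ) * (1 - Real.exp (-δ))⁻¹ := by
      simp_rw [pow_succ']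
      rw [tsum_mul_left, tsum_geometric_of_lt_one hq0.le hq1]
    rw [h2] at h1
    refine h1.trans ?_
    rw [← div_eq_mul_inv, div_le_div_iff₀ (by linarith) hδ]
    have h3 : δ + 1 ≤ Real.exp δ := Real.add_one_le_exp δ
    have h4 : Real.exp (-δ) * Real.exp δ = 1 := by rw [← Real.exp_add]; simp
    nlinarith
  have : (1 : ℝ) ≤ 1 / δ := by rw [le_div_iff₀ hδ]; linarith
  have h3 : 3 / δ = 1 / δ + 2 * (1 / δ) := by ring
  linarith

theorem sum_exp_neg_intNorm_le {n : ℕ} {δ : ℝ} (hδ : 0 < δ) (hδ1 : δ ≤ 1)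
    (S : Finset (Fin n → ℤ)) : ∑ m ∈ S, Real.exp (-δ * intNorm m) ≤ (3 / δ) ^ n := by
  obtain ⟨N, hN⟩ : ∃ N : ℕ, ∀ m ∈ S, ∀ i, |m i| ≤ N := by
    refine ⟨∑ m ∈ S, ∑ i, (m i).natAbs, fun m hm i => ?_⟩
    have h1 : (m i).natAbs ≤ ∑ i, (m i).natAbs :=
      Finset.single_le_sum (f := fun i => (m i).natAbs) (fun _ _ => Nat.zero_le _)
        (Finset.mem_univ i)
    have h2 : ∑ i, (m i).natAbs ≤ ∑ m ∈ S, ∑ i, (m i).natAbs :=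
      Finset.single_le_sum (f := fun m : Fin n → ℤ => ∑ i, (m i).natAbs)
        (fun _ _ => Nat.zero_le _) hm
    rw [Int.abs_eq_natAbs]
    exact_mod_cast h1.trans h2
  have hS : S ⊆ Fintype.piFinset fun _ : Fin n => Finset.Icc (-(N : ℤ)) N := by
    intro m hm
    rw [Fintype.mem_piFinset]
    intro i
    rw [Finset.mem_Icc]
    exact abs_le.1 (hN m hm i)
  calc ∑ m ∈ S, Real.exp (-δ * intNorm m)
      ≤ ∑ m ∈ Fintype.piFinset fun _ : Fin n => Finset.Icc (-(N : ℤ)) N,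
          Real.exp (-δ * intNorm m) :=
        Finset.sum_le_sum_of_subset_of_nonneg hS fun _ _ _ => (Real.exp_pos _).le
    _ = ∑ m ∈ Fintype.piFinset fun _ : Fin n => Finset.Icc (-(N : ℤ)) N,
          ∏ i, Real.exp (-δ * |(m i : ℝ)|) := by
        refine Finset.sum_congr rfl fun m _ => ?_
        rw [intNorm, Finset.mul_sum, Real.exp_sum]
    _ = ∏ _i : Fin n, ∑ k ∈ Finset.Icc (-(N : ℤ)) N, Real.exp (-δ * |(k : ℝ)|) :=
        (Finset.prod_univ_sum (fun _ : Fin n => Finset.Icc (-(N : ℤ)) N)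
          (fun _ k => Real.exp (-δ * |(k : ℝ)|))).symm
    _ ≤ ∏ _i : Fin n, 3 / δ :=
        Finset.prod_le_prod (fun _ _ => Finset.sum_nonneg fun _ _ => (Real.exp_pos _).le)
          fun _ _ => sum_exp_neg_abs_le hδ hδ1 N
    _ = (3 / δ) ^ n := by rw [Finset.prod_const, Finset.card_univ, Fintype.card_fin]

theorem summable_exp_neg_intNorm {n : ℕ} {δ : ℝ} (hδ : 0 < δ) :
    Summable fun m : Fin n → ℤ => Real.exp (-δ * intNorm m) := by
  have h : Summable fun m : Fin n → ℤ => Real.exp (-(min δ 1) * intNorm m) :=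
    summable_of_sum_le (fun _ => (Real.exp_pos _).le)
      (sum_exp_neg_intNorm_le (lt_min hδ one_pos) (min_le_right _ _))
  refine h.of_nonneg_of_le (fun _ => (Real.exp_pos _).le) fun m => ?_
  rw [Real.exp_le_exp]
  have := mul_le_mul_of_nonneg_right (min_le_left δ 1) (intNorm_nonneg m)
  linarith

theorem tsum_exp_neg_intNorm_le {n : ℕ} {δ : ℝ} (hδ : 0 < δ) (hδ1 : δ ≤ 1) :
    ∑' m : Fin n → ℤ, Real.exp (-δ * intNorm m) ≤ (3 / δ) ^ n :=
  (summable_exp_neg_intNorm hδ).tsum_le_of_sum_le (sum_exp_neg_intNorm_le hδ hδ1)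

/-! ### Averages and Fourier coefficients over the torus -/

/-- The representative in `[0, 2π)ⁿ` of a point of the torus. -/
noncomputable def torusRep {n : ℕ} (x : UnitAddTorus (Fin n)) : Fin n → ℝ :=
  fun i => 2 * Real.pi * ((AddCircle.equivIco (1 : ℝ) 0 (x i)) : ℝ)

/-- The point of the torus `(ℝ/ℤ)ⁿ` with angle vector `θ`. -/
noncomputable def torusMk {n : ℕ} (θ : Fin n → ℝ) : UnitAddTorus (Fin n) :=
  fun i => ((θ i / (2 * Real.pi) : ℝ) : UnitAddCircle)

/-- The invariant probability measure on the torus. -/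
noncomputable def torusMeasure (n : ℕ) : Measure (UnitAddTorus (Fin n)) :=
  Measure.pi fun _ => AddCircle.haarAddCircle

instance (n : ℕ) : IsProbabilityMeasure (torusMeasure n) := by
  unfold torusMeasure; infer_instance

instance (n : ℕ) : (torusMeasure n).IsAddHaarMeasure := by
  unfold torusMeasure; infer_instance

theorem torusMk_torusRep {n : ℕ} (x : UnitAddTorus (Fin n)) : torusMk (torusRep x) = x := by
  funext i
  have h : (2 * Real.pi) ≠ 0 := by positivity
  simp only [torusMk, torusRep]
  rw [mul_div_cancel_left₀ _ h]
  exact (AddCircle.equivIco (1 : ℝ) 0).symm_apply_apply (x i)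

theorem torusMk_add {n : ℕ} (θ η : Fin n → ℝ) : torusMk (θ + η) = torusMk θ + torusMk η := by
  funext i
  simp [torusMk, add_div]

/-- A function on `ℝⁿ` that is `2π`-periodic in each variable. -/
def IsTorusPeriodic {n : ℕ} {X : Type*} (f : (Fin n → ℝ) → X) : Prop :=
  ∀ θ i, f (θ + Pi.single i (2 * Real.pi)) = f θ

theorem IsTorusPeriodic.add_int {n : ℕ} {X : Type*} {f : (Fin n → ℝ) → X}
    (hf : IsTorusPeriodic f) (θ : Fin n → ℝ) (k : Fin n → ℤ) :
    f (θ + fun i => 2 * Real.pi * (k i : ℝ)) = f θ := by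
  have h1 : ∀ (i : Fin n) (j : ℤ) (θ : Fin n → ℝ),
      f (θ + Pi.single i (2 * Real.pi * (j : ℝ))) = f θ := by
    intro i j
    induction j with
    | zero => intro θ; simp
    | succ j ih =>
      intro θ
      have := hf (θ + Pi.single i (2 * Real.pi * ((j : ℤ) : ℝ))) i
      rw [ih, add_assoc, ← Pi.single_add] at this
      rw [← this]; congr 3; push_cast; ring
    | pred j ih =>
      intro θ
      rw [← ih θ, ← hf _ i, add_assoc, ← Pi.single_add]
      congr 3; push_cast; ring
  have h2 : ∀ S : Finset (Fin n),
      f (θ + ∑ i ∈ S, Pi.single i (2 * Real.pi * (k i : ℝ))) = f θ := by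
    intro S
    induction S using Finset.induction_on with
    | empty => simp
    | insert i S hi ih =>
      rw [Finset.sum_insert hi, add_comm (Pi.single i _), ← add_assoc, h1, ih]
  have := h2 Finset.univ
  rwa [Finset.univ_sum_single (fun i => 2 * Real.pi * (k i : ℝ))] at this

theorem IsTorusPeriodic.eq_of_torusMk_eq {n : ℕ} {X : Type*} {f : (Fin n → ℝ) → X}
    (hf : IsTorusPeriodic f) {θ η : Fin n → ℝ} (h : torusMk θ = torusMk η) : f θ = f η := by
  have h1 : ∀ i, ∃ k : ℤ, θ i = η i + 2 * Real.pi * (k : ℝ) := by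
    intro i
    have h2 := congrFun h i
    simp only [torusMk] at h2
    rw [← sub_eq_zero, ← AddCircle.coe_sub, AddCircle.coe_eq_zero_iff] at h2
    obtain ⟨k, hk⟩ := h2
    refine ⟨k, ?_⟩
    have h0 : (2 * Real.pi) ≠ 0 := by positivity
    rw [zsmul_eq_mul, mul_one, ← sub_div, eq_div_iff h0] at hk
    linarith
  choose k hk using h1
  have : θ = η + fun i => 2 * Real.pi * (k i : ℝ) := funext hk
  rw [this, hf.add_int]

theorem IsTorusPeriodic.comp_torusRep_torusMk {n : ℕ} {X : Type*} {f : (Fin n → ℝ) → X}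
    (hf : IsTorusPeriodic f) (θ : Fin n → ℝ) : f (torusRep (torusMk θ)) = f θ :=
  hf.eq_of_torusMk_eq (torusMk_torusRep _)

theorem isOpenQuotientMap_torusMk (n : ℕ) : IsOpenQuotientMap (torusMk (n := n)) := by
  have h0 : (2 * Real.pi) ≠ 0 := by positivity
  have h1 : IsOpenQuotientMap (fun t : ℝ => ((t / (2 * Real.pi) : ℝ) : UnitAddCircle)) := by
    have h2 : IsOpenQuotientMap (fun t : ℝ => (t : UnitAddCircle)) :=
      QuotientAddGroup.isOpenQuotientMap_mk
    exact h2.comp (Homeomorph.mulRight₀ _ (inv_ne_zero h0)).isOpenQuotientMap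
  exact IsOpenQuotientMap.piMap fun _ => h1

theorem IsTorusPeriodic.continuous_comp_torusRep {n : ℕ} {X : Type*} [TopologicalSpace X]
    {f : (Fin n → ℝ) → X} (hf : IsTorusPeriodic f) (hc : Continuous f) :
    Continuous fun x : UnitAddTorus (Fin n) => f (torusRep x) := by
  rw [(isOpenQuotientMap_torusMk n).isQuotientMap.continuous_iff]
  exact hc.congr fun θ => (hf.comp_torusRep_torusMk θ).symm

/-- The average of a function over the torus. -/
noncomputable def torusAvg {n : ℕ} (f : (Fin n → ℝ) → ℂ) : ℂ :=
  ∫ x, f (torusRep x) ∂(torusMeasure n)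

theorem IsTorusPeriodic.integrable {n : ℕ} {f : (Fin n → ℝ) → ℂ} (hf : IsTorusPeriodic f)
    (hc : Continuous f) : Integrable (fun x => f (torusRep x)) (torusMeasure n) :=
  (hf.continuous_comp_torusRep hc).integrable_of_hasCompactSupport
    (HasCompactSupport.of_compactSpace _)

theorem torusAvg_shift {n : ℕ} {f : (Fin n → ℝ) → ℂ} (hf : IsTorusPeriodic f) (v : Fin n → ℝ) :
    torusAvg (fun θ => f (θ + v)) = torusAvg f := by
  unfold torusAvg
  rw [← integral_add_right_eq_self (fun x => f (torusRep x)) (torusMk v)]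
  refine integral_congr_ae (Eventually.of_forall fun x => ?_)
  refine hf.eq_of_torusMk_eq ?_
  rw [torusMk_add, torusMk_torusRep, torusMk_torusRep]

theorem norm_torusAvg_le {n : ℕ} {f : (Fin n → ℝ) → ℂ} {M : ℝ} (h : ∀ θ, ‖f θ‖ ≤ M) :
    ‖torusAvg f‖ ≤ M := by
  refine (norm_integral_le_of_norm_le_const (Eventually.of_forall fun x => h _)).trans ?_
  simp

/-- The Fourier coefficient of index `m` of a function on the (complexified) torus. -/
noncomputable def fourierCoef {n : ℕ} (f : (Fin n → ℂ) → ℂ) (m : Fin n → ℤ) : ℂ :=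
  torusAvg fun θ => mode (-m) (toComplexAngle θ) * f (toComplexAngle θ)

theorem mFourier_eq_mode {n : ℕ} (m : Fin n → ℤ) (θ : Fin n → ℝ) :
    UnitAddTorus.mFourier m (torusMk θ) = mode m (toComplexAngle θ) := by
  rw [mode, Finset.mul_sum, Complex.exp_sum]
  simp only [UnitAddTorus.mFourier, ContinuousMap.coe_mk, torusMk, fourier_coe_apply]
  refine Finset.prod_congr rfl fun i _ => ?_
  congr 1
  have h0 : (Real.pi : ℂ) ≠ 0 := by exact_mod_cast Real.pi_ne_zero
  simp only [toComplexAngle]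
  push_cast
  field_simp

theorem fourierCoef_eq_mFourierCoeff {n : ℕ} (f : (Fin n → ℂ) → ℂ) (m : Fin n → ℤ) :
    fourierCoef f m
      = UnitAddTorus.mFourierCoeff (fun x => f (toComplexAngle (torusRep x))) m := by
  have : UnitAddTorus.mFourierCoeff (fun x => f (toComplexAngle (torusRep x))) m
    = ∫ x, UnitAddTorus.mFourier (-m) x • f (toComplexAngle (torusRep x)) ∂(torusMeasure n) := rfl
  rw [this, fourierCoef, torusAvg]
  congr 1
  funext x
  rw [← mFourier_eq_mode, torusMk_torusRep, smul_eq_mul]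

theorem toComplexAngle_add_single {n : ℕ} (θ : Fin n → ℝ) (i : Fin n) (r : ℝ) :
    toComplexAngle (θ + Pi.single i r) = toComplexAngle θ + Pi.single i (r : ℂ) := by
  funext j
  by_cases h : j = i
  · subst h; simp [toComplexAngle]
  · simp [toComplexAngle, h]

theorem isTorusPeriodic_mode {n : ℕ} (m : Fin n → ℤ) :
    IsTorusPeriodic fun θ : Fin n → ℝ => mode m (toComplexAngle θ) := fun θ i => by
  simp only [toComplexAngle_add_single, mode_add_period]

theorem hasSum_fourierCoef {n : ℕ} {f : (Fin n → ℂ) → ℂ}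
    (hp : IsTorusPeriodic fun θ : Fin n → ℝ => f (toComplexAngle θ))
    (hc : Continuous fun θ : Fin n → ℝ => f (toComplexAngle θ))
    (hs : Summable (fourierCoef f)) (θ : Fin n → ℝ) :
    HasSum (fun m => fourierCoef f m * mode m (toComplexAngle θ)) (f (toComplexAngle θ)) := by
  let F : C(UnitAddTorus (Fin n), ℂ) :=
    ⟨fun x => f (toComplexAngle (torusRep x)), hp.continuous_comp_torusRep hc⟩
  have hF : fourierCoef f = UnitAddTorus.mFourierCoeff ⇑F :=
    funext fun m => fourierCoef_eq_mFourierCoeff f m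
  have h := UnitAddTorus.hasSum_mFourier_series_apply_of_summable (f := F) (hF ▸ hs) (torusMk θ)
  rw [← hF] at h
  simp only [mFourier_eq_mode, smul_eq_mul] at h
  have h2 : F (torusMk θ) = f (toComplexAngle θ) := hp.comp_torusRep_torusMk θ
  rwa [h2] at h

/-- `f` is holomorphic on the open strip of width `s`, `2π`-periodic in each variable and bounded
by `M` there. -/
structure TorusHolo {n : ℕ} {X : Type*} [NormedAddCommGroup X] [NormedSpace ℂ X]
    (s M : ℝ) (f : (Fin n → ℂ) → X) : Prop where
  diff : DifferentiableOn ℂ f (openStrip n s)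
  periodic : ∀ θ ∈ openStrip n s, ∀ i, f (θ + Pi.single i ((2 * Real.pi : ℝ) : ℂ)) = f θ
  bound : ∀ θ ∈ openStrip n s, ‖f θ‖ ≤ M

theorem TorusHolo.isTorusPeriodic_shift {n : ℕ} {X : Type*} [NormedAddCommGroup X]
    [NormedSpace ℂ X] {s M : ℝ} {f : (Fin n → ℂ) → X} (hf : TorusHolo s M f) {w : Fin n → ℂ}
    (hw : w ∈ openStrip n s) : IsTorusPeriodic fun θ => f (toComplexAngle θ + w) := by
  intro θ i
  simp only
  rw [toComplexAngle_add_single, add_right_comm]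
  refine hf.periodic _ (fun j => ?_) i
  simpa [toComplexAngle] using hw j

theorem TorusHolo.continuous_shift {n : ℕ} {X : Type*} [NormedAddCommGroup X]
    [NormedSpace ℂ X] {s M : ℝ} {f : (Fin n → ℂ) → X} (hf : TorusHolo s M f) {w : Fin n → ℂ}
    (hw : w ∈ openStrip n s) : Continuous fun θ => f (toComplexAngle θ + w) := by
  refine hf.diff.continuousOn.comp_continuous
    ((continuous_toComplexAngle n).add continuous_const) fun θ j => ?_
  simpa [toComplexAngle] using hw j

theorem zero_mem_openStrip {n : ℕ} {s : ℝ} (hs : 0 < s) : (0 : Fin n → ℂ) ∈ openStrip n s :=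
  fun i => by simpa using hs

theorem TorusHolo.isTorusPeriodic {n : ℕ} {X : Type*} [NormedAddCommGroup X]
    [NormedSpace ℂ X] {s M : ℝ} {f : (Fin n → ℂ) → X} (hf : TorusHolo s M f) (hs : 0 < s) :
    IsTorusPeriodic fun θ => f (toComplexAngle θ) := by
  simpa using hf.isTorusPeriodic_shift (zero_mem_openStrip hs)

theorem TorusHolo.continuous {n : ℕ} {X : Type*} [NormedAddCommGroup X]
    [NormedSpace ℂ X] {s M : ℝ} {f : (Fin n → ℂ) → X} (hf : TorusHolo s M f) (hs : 0 < s) :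
    Continuous fun θ => f (toComplexAngle θ) := by
  simpa using hf.continuous_shift (zero_mem_openStrip hs)

/-- Averaging a holomorphic function over a complex translate of the torus gives a function of the
translation that is complex differentiable with vanishing derivative. -/
theorem TorusHolo.hasDerivAt_avg {n : ℕ} {s M : ℝ} {g : (Fin n → ℂ) → ℂ} (hg : TorusHolo s M g)
    (v : Fin n → ℝ) {z₀ : ℂ} {U : Set ℂ} (hU : IsOpen U) (hz₀ : z₀ ∈ U)
    (hUs : ∀ z ∈ U, (fun i => z * (v i : ℂ)) ∈ openStrip n s) :
    HasDerivAt (fun z : ℂ => torusAvg fun θ => g (toComplexAngle θ + fun i => z * (v i : ℂ)))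
      0 z₀ := by
  obtain ⟨r, hr, hrU⟩ := Metric.isOpen_iff.1 hU z₀ hz₀
  set φ : ℂ → UnitAddTorus (Fin n) → ℂ := fun z x =>
    g (toComplexAngle (torusRep x) + fun i => z * (v i : ℂ)) with hφ
  have hmem : ∀ (x : UnitAddTorus (Fin n)), ∀ z ∈ U,
      (toComplexAngle (torusRep x) + fun i => z * (v i : ℂ)) ∈ openStrip n s := by
    intro x z hz i
    simpa [toComplexAngle] using hUs z hz i
  have hdiff : ∀ x, DifferentiableOn ℂ (fun z => φ z x) U := by
    intro x
    refine hg.diff.comp (t := openStrip n s) ?_ (hmem x)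
    fun_prop
  have hcont : ∀ z ∈ U, Continuous (φ z) := fun z hz =>
    (hg.isTorusPeriodic_shift (hUs z hz)).continuous_comp_torusRep (hg.continuous_shift (hUs z hz))
  have hdz : ∀ x, ∀ z ∈ U, HasDerivAt (fun z => φ z x) (deriv (fun z => φ z x) z) z :=
    fun x z hz => ((hdiff x).differentiableAt (hU.mem_nhds hz)).hasDerivAt
  have hball : ∀ z ∈ Metric.ball z₀ (r / 2), Metric.closedBall z (r / 4) ⊆ U := by
    intro z hz w hw
    refine hrU ?_
    rw [Metric.mem_ball] at hz ⊢
    rw [Metric.mem_closedBall] at hw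
    linarith [dist_triangle w z z₀]
  have hmain : HasDerivAt (fun z => ∫ x, φ z x ∂(torusMeasure n))
      (∫ x, deriv (fun z => φ z x) z₀ ∂(torusMeasure n)) z₀ := by
    refine (hasDerivAt_integral_of_dominated_loc_of_deriv_le (μ := torusMeasure n)
      (bound := fun _ => M / (r / 4)) (F := φ) (F' := fun z x => deriv (fun z => φ z x) z)
      (Metric.ball_mem_nhds z₀ (half_pos hr)) ?_ ?_ ?_ ?_ (integrable_const _) ?_).2
    · filter_upwards [hU.mem_nhds hz₀] with z hz
      exact (hcont z hz).aestronglyMeasurable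
    · exact (hcont z₀ hz₀).integrable_of_hasCompactSupport (HasCompactSupport.of_compactSpace _)
    · let u : ℕ → ℂ := fun k => z₀ + ((r / 2 / (k + 1) : ℝ) : ℂ)
      have hu : Tendsto u atTop (𝓝[≠] z₀) := by
        refine tendsto_nhdsWithin_iff.2 ⟨?_, Eventually.of_forall fun k => ?_⟩
        · have h1 : Tendsto (fun k : ℕ => r / 2 / ((k : ℝ) + 1)) atTop (𝓝 0) := by
            have := tendsto_one_div_add_atTop_nhds_zero_nat (𝕜 := ℝ)
            have := this.const_mul (r / 2)
            simpa [div_eq_mul_inv] using this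
          have h2 := ((Complex.continuous_ofReal.tendsto 0).comp h1).const_add z₀
          simpa [u, Function.comp_def] using h2
        · have : (r / 2 / ((k : ℝ) + 1)) ≠ 0 := by positivity
          simp only [u, Set.mem_compl_iff, Set.mem_singleton_iff]
          intro h
          have h2 := add_eq_left.1 h
          exact this (by exact_mod_cast h2)
      have huU : ∀ k, u k ∈ U := by
        intro k
        refine hrU ?_
        rw [Metric.mem_ball, dist_eq_norm]
        simp only [u, add_sub_cancel_left]
        rw [Complex.norm_real, Real.norm_of_nonneg (by positivity), div_lt_iff₀ (by positivity)]
        have : (0 : ℝ) ≤ k := Nat.cast_nonneg k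
        nlinarith
      refine aestronglyMeasurable_of_tendsto_ae atTop
        (f := fun k x => slope (fun z => φ z x) z₀ (u k)) (fun k => ?_)
        (Eventually.of_forall fun x => ?_)
      · have e : (fun x => slope (fun z => φ z x) z₀ (u k))
            = fun x => (u k - z₀)⁻¹ * (φ (u k) x - φ z₀ x) := by
          funext x; simp [slope]
        rw [e]
        exact (continuous_const.mul ((hcont _ (huU k)).sub (hcont _ hz₀))).aestronglyMeasurable
      · exact (hasDerivAt_iff_tendsto_slope.1 (hdz x z₀ hz₀)).comp hu
    · refine Eventually.of_forall fun x z hz => ?_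
      refine Complex.norm_deriv_le_of_forall_mem_sphere_norm_le (by positivity) ?_ ?_
      · refine DifferentiableOn.diffContOnCl ((hdiff x).mono ?_)
        rw [closure_ball _ (by positivity)]
        exact hball z hz
      · intro w hw
        exact hg.bound _ (hmem x w (hball z hz (Metric.sphere_subset_closedBall hw)))
    · refine Eventually.of_forall fun x z hz => hdz x z ?_
      exact hball z hz (Metric.mem_closedBall_self (by positivity))
  have hzero : (∫ x, deriv (fun z => φ z x) z₀ ∂(torusMeasure n)) = 0 := by
    have hshift : ∀ᶠ t : ℝ in 𝓝 0, (∫ x, φ (z₀ + t) x ∂(torusMeasure n))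
        = ∫ x, φ z₀ x ∂(torusMeasure n) := by
      refine Eventually.of_forall fun t => ?_
      have h := torusAvg_shift (hg.isTorusPeriodic_shift (hUs z₀ hz₀)) (fun i => t * v i)
      have e : ∀ θ : Fin n → ℝ, (toComplexAngle (θ + fun i => t * v i) + fun i => z₀ * (v i : ℂ))
          = toComplexAngle θ + fun i => (z₀ + t) * (v i : ℂ) := by
        intro θ; funext i; simp [toComplexAngle]; ring
      simp only [e] at h
      exact h
    have h1 : HasDerivAt (fun t : ℝ => ∫ x, φ (z₀ + t) x ∂(torusMeasure n))
        (∫ x, deriv (fun z => φ z x) z₀ ∂(torusMeasure n)) 0 := by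
      have h2 : HasDerivAt (fun t : ℂ => ∫ x, φ (z₀ + t) x ∂(torusMeasure n))
          (∫ x, deriv (fun z => φ z x) z₀ ∂(torusMeasure n)) ((0 : ℝ) : ℂ) := by
        refine HasDerivAt.comp_const_add (f := fun z => ∫ x, φ z x ∂(torusMeasure n))
          z₀ ((0 : ℝ) : ℂ) ?_
        simpa using hmain
      exact h2.comp_ofReal
    exact (h1.congr_of_eventuallyEq (hshift.mono fun t ht => ht.symm)).unique
      (hasDerivAt_const _ _)
  rw [hzero] at hmain
  exact hmain

theorem norm_fourierCoef_le {n : ℕ} {s s' M : ℝ} {f : (Fin n → ℂ) → ℂ} (hf : TorusHolo s M f)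
    (hs' : 0 ≤ s') (hss : s' < s) (m : Fin n → ℤ) :
    ‖fourierCoef f m‖ ≤ M * Real.exp (-s' * intNorm m) := by
  have hs : 0 < s := hs'.trans_lt hss
  have hM : 0 ≤ M := (norm_nonneg _).trans (hf.bound 0 (zero_mem_openStrip hs))
  set v : Fin n → ℝ := fun i => if 0 ≤ m i then -s' else s' with hv
  have hvabs : ∀ i, |v i| = s' := by
    intro i
    simp only [hv]
    split_ifs <;> simp [abs_of_nonneg hs']
  have hvm : ∑ i, (m i : ℝ) * v i = -s' * intNorm m := by
    rw [intNorm, Finset.mul_sum]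
    refine Finset.sum_congr rfl fun i _ => ?_
    simp only [hv]
    split_ifs with h
    · rw [abs_of_nonneg (by exact_mod_cast h)]; ring
    · rw [abs_of_neg (by exact_mod_cast not_le.1 h)]; ring
  set g : (Fin n → ℂ) → ℂ := fun θ => mode (-m) θ * f θ with hgdef
  have hg : TorusHolo s (Real.exp (s * intNorm m) * M) g := by
    refine ⟨(differentiable_mode _).differentiableOn.mul hf.diff, fun θ hθ i => ?_, fun θ hθ => ?_⟩
    · simp only [hgdef]
      rw [mode_add_period, hf.periodic θ hθ]
    · simp only [hgdef, norm_mul]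
      refine mul_le_mul ?_ (hf.bound θ hθ) (norm_nonneg _) (Real.exp_pos _).le
      rw [← intNorm_neg m]
      exact norm_mode_le _ fun i => (hθ i).le
  set U : Set ℂ := {z | |z.im| * s' < s} with hUdef
  have hU : IsOpen U :=
    isOpen_lt ((Complex.continuous_im.abs).mul continuous_const) continuous_const
  have hUc : Convex ℝ U := by
    rcases hs'.eq_or_lt with h | h
    · have : U = Set.univ := by ext z; simp [hUdef, ← h, hs]
      rw [this]; exact convex_univ
    · have : U = Complex.imLm ⁻¹' (Set.Ioo (-(s / s')) (s / s')) := by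
        ext z
        simp only [hUdef, Set.mem_ofPred_eq, Set.mem_preimage, Complex.imLm_coe, Set.mem_Ioo]
        rw [← abs_lt, lt_div_iff₀ h]
      rw [this]
      exact (convex_Ioo _ _).linear_preimage _
  have hUs : ∀ z ∈ U, (fun i => z * (v i : ℂ)) ∈ openStrip n s := by
    intro z hz i
    simp only [Complex.im_mul_ofReal, abs_mul, hvabs]
    exact hz
  have h0 : (0 : ℂ) ∈ U := by simp [hUdef, hs]
  have hI : Complex.I ∈ U := by simp [hUdef, hss]
  have hder := fun z hz => hg.hasDerivAt_avg v (z₀ := z) hU hz hUs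
  have hconst := hU.is_const_of_deriv_eq_zero hUc.isPreconnected
    (fun z hz => (hder z hz).differentiableAt.differentiableWithinAt)
    (fun z hz => (hder z hz).deriv) h0 hI
  have e0 : fourierCoef f m
      = torusAvg fun θ : Fin n → ℝ => g (toComplexAngle θ + fun i => 0 * (v i : ℂ)) := by
    simp only [zero_mul]
    have : (fun _ : Fin n => (0 : ℂ)) = 0 := rfl
    simp only [this, add_zero]
    rfl
  rw [e0, hconst]
  refine norm_torusAvg_le fun θ => ?_
  have hmem : (toComplexAngle θ + fun i => Complex.I * (v i : ℂ)) ∈ openStrip n s := by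
    intro i
    simpa [toComplexAngle] using hUs _ hI i
  simp only [hgdef, norm_mul]
  rw [mul_comm]
  refine mul_le_mul (hf.bound _ hmem) ?_ (norm_nonneg _) hM
  rw [norm_mode, ← hvm]
  simp [toComplexAngle]

theorem summable_fourierCoef {n : ℕ} {s M : ℝ} {f : (Fin n → ℂ) → ℂ} (hf : TorusHolo s M f)
    (hs : 0 < s) : Summable (fourierCoef f) := by
  refine Summable.of_norm_bounded
    ((summable_exp_neg_intNorm (half_pos hs)).mul_left M) fun m => ?_
  exact norm_fourierCoef_le hf (half_pos hs).le (half_lt_self hs) m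

theorem TorusHolo.hasSum {n : ℕ} {s M : ℝ} {f : (Fin n → ℂ) → ℂ} (hf : TorusHolo s M f)
    (hs : 0 < s) (θ : Fin n → ℝ) :
    HasSum (fun m => fourierCoef f m * mode m (toComplexAngle θ)) (f (toComplexAngle θ)) :=
  hasSum_fourierCoef (hf.isTorusPeriodic hs) (hf.continuous hs) (summable_fourierCoef hf hs) θ

theorem TorusHolo.integrable_mul_mode {n : ℕ} {s M : ℝ} {f : (Fin n → ℂ) → ℂ}
    (hf : TorusHolo s M f) (hs : 0 < s) (m : Fin n → ℤ) :
    Integrable (fun x => mode m (toComplexAngle (torusRep x)) * f (toComplexAngle (torusRep x)))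
      (torusMeasure n) := by
  refine IsTorusPeriodic.integrable
    (f := fun θ => mode m (toComplexAngle θ) * f (toComplexAngle θ)) (fun θ i => ?_)
    (((differentiable_mode m).continuous.comp (continuous_toComplexAngle n)).mul (hf.continuous hs))
  have h1 := isTorusPeriodic_mode m θ i
  have h2 := hf.isTorusPeriodic hs θ i
  simp only at h1 h2 ⊢
  rw [h1, h2]

theorem fourierCoef_sub {n : ℕ} {s M s' M' : ℝ} {f g : (Fin n → ℂ) → ℂ} (hf : TorusHolo s M f)
    (hg : TorusHolo s' M' g) (hs : 0 < s) (hs' : 0 < s') (m : Fin n → ℤ) :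
    fourierCoef (fun θ => f θ - g θ) m = fourierCoef f m - fourierCoef g m := by
  unfold fourierCoef torusAvg
  rw [← integral_sub (hf.integrable_mul_mode hs _) (hg.integrable_mul_mode hs' _)]
  simp only [mul_sub]

theorem fourierCoef_neg {n : ℕ} {f g : (Fin n → ℂ) → ℂ}
    (h : ∀ θ : Fin n → ℝ, g (toComplexAngle θ) = -f (toComplexAngle θ)) (m : Fin n → ℤ) :
    fourierCoef g m = -fourierCoef f m := by
  unfold fourierCoef torusAvg
  rw [← integral_neg]
  simp only [h, mul_neg]

theorem fourierCoef_conj {n : ℕ} {f g : (Fin n → ℂ) → ℂ}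
    (h : ∀ θ : Fin n → ℝ, g (toComplexAngle θ) = starRingEnd ℂ (f (toComplexAngle θ)))
    (m : Fin n → ℤ) : fourierCoef g (-m) = starRingEnd ℂ (fourierCoef f m) := by
  unfold fourierCoef torusAvg
  rw [← integral_conj]
  simp only [h, map_mul, conj_mode]

/-! ### Analyticity of Fourier series with exponentially decaying coefficients -/

theorem summable_exp_neg_abs_int {δ : ℝ} (hδ : 0 < δ) :
    Summable fun k : ℤ => Real.exp (-δ * |(k : ℝ)|) := by
  have h := summable_exp_neg_intNorm (n := 1) hδ
  rw [← (Equiv.funUnique (Fin 1) ℤ).symm.summable_iff] at h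
  refine h.congr fun k => ?_
  simp [intNorm]

/-- The indicator of the lattice hyperplane `m i = k`, as a bounded function of `m`. -/
noncomputable def hyperplaneIndicator {n : ℕ} (i : Fin n) (k : ℤ) : (Fin n → ℤ) →ᵇ ℂ :=
  BoundedContinuousFunction.ofNormedAddCommGroupDiscrete
    (fun m => if m i = k then (1 : ℂ) else 0) 1 (fun m => by split_ifs <;> simp)

theorem hyperplaneIndicator_apply {n : ℕ} (i : Fin n) (k : ℤ) (m : Fin n → ℤ) :
    hyperplaneIndicator i k m = if m i = k then (1 : ℂ) else 0 := rfl

theorem norm_hyperplaneIndicator_le {n : ℕ} (i : Fin n) (k : ℤ) :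
    ‖hyperplaneIndicator i k‖ ≤ 1 := by
  rw [BoundedContinuousFunction.norm_le zero_le_one]
  intro m
  rw [hyperplaneIndicator_apply]
  split_ifs <;> simp

/-- The bounded function `m ↦ e^{i mᵢ z - s|mᵢ|}`, as a series of bounded functions. -/
noncomputable def weightedMode {n : ℕ} (s : ℝ) (i : Fin n) (z : ℂ) : (Fin n → ℤ) →ᵇ ℂ :=
  ∑' k : ℤ, (Complex.exp (Complex.I * ((k : ℂ) * z)) * Real.exp (-s * |(k : ℝ)|)) •
    hyperplaneIndicator i k

theorem norm_weightedMode_term_le {n : ℕ} {s t : ℝ} (i : Fin n) (k : ℤ) {z : ℂ}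
    (hz : |z.im| ≤ t) :
    ‖(Complex.exp (Complex.I * ((k : ℂ) * z)) * Real.exp (-s * |(k : ℝ)|)) •
      hyperplaneIndicator i k‖ ≤ Real.exp (-(s - t) * |(k : ℝ)|) := by
  rw [norm_smul, norm_mul, Complex.norm_exp, Complex.norm_real, Real.norm_of_nonneg
    (Real.exp_pos _).le, ← Real.exp_add]
  refine (mul_le_of_le_one_right (Real.exp_pos _).le (norm_hyperplaneIndicator_le i k)).trans ?_
  rw [Real.exp_le_exp]
  have h1 : -((k : ℝ) * z.im) ≤ |(k : ℝ)| * t := by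
    refine (neg_le_abs _).trans ?_
    rw [abs_mul]
    exact mul_le_mul_of_nonneg_left hz (abs_nonneg _)
  have h2 : (Complex.I * ((k : ℂ) * z)).re = -((k : ℝ) * z.im) := by simp [Complex.mul_re]
  rw [h2]
  nlinarith

theorem analyticAt_weightedMode {n : ℕ} {s : ℝ} (i : Fin n) {z : ℂ} (hz : |z.im| < s) :
    AnalyticAt ℂ (weightedMode s i) z := by
  obtain ⟨t, ht, hts⟩ := exists_between hz
  have hopen : IsOpen {w : ℂ | |w.im| < t} :=
    isOpen_lt Complex.continuous_im.abs continuous_const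
  refine DifferentiableOn.analyticAt (s := {w : ℂ | |w.im| < t}) ?_ (hopen.mem_nhds ht)
  refine Complex.differentiableOn_tsum_of_summable_norm
    (summable_exp_neg_abs_int (sub_pos.2 hts)) (fun k => ?_) hopen fun k w hw => ?_
  · fun_prop
  · exact norm_weightedMode_term_le i k (le_of_lt hw)

theorem weightedMode_apply {n : ℕ} {s : ℝ} (i : Fin n) {z : ℂ} (hz : |z.im| < s)
    (m : Fin n → ℤ) : weightedMode s i z m
      = Complex.exp (Complex.I * ((m i : ℂ) * z)) * Real.exp (-s * |(m i : ℝ)|) := by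
  have hsum : Summable fun k : ℤ =>
      (Complex.exp (Complex.I * ((k : ℂ) * z)) * Real.exp (-s * |(k : ℝ)|)) •
        hyperplaneIndicator i k :=
    Summable.of_norm_bounded (summable_exp_neg_abs_int (sub_pos.2 hz))
      fun k => norm_weightedMode_term_le i k le_rfl
  have h := (BoundedContinuousFunction.evalCLM ℂ m).map_tsum hsum
  rw [weightedMode]
  refine h.trans ?_
  rw [tsum_eq_single (m i)]
  · simp [hyperplaneIndicator_apply]
  · intro k hk
    simp [hyperplaneIndicator_apply, hk.symm]

/-- Summation against an absolutely summable family, on bounded functions. -/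
noncomputable def sumFunctional {n : ℕ} (c : (Fin n → ℤ) → ℂ) (hc : Summable fun m => ‖c m‖) :
    ((Fin n → ℤ) →ᵇ ℂ) →L[ℂ] ℂ :=
  have hs : ∀ x : (Fin n → ℤ) →ᵇ ℂ, Summable fun m => ‖c m * x m‖ := fun x => by
    refine (hc.mul_right ‖x‖).of_nonneg_of_le (fun _ => norm_nonneg _) fun m => ?_
    rw [norm_mul]
    exact mul_le_mul_of_nonneg_left (x.norm_coe_le_norm m) (norm_nonneg _)
  LinearMap.mkContinuous
    { toFun := fun x => ∑' m, c m * x m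
      map_add' := fun x y => by
        rw [← (hs x).of_norm.tsum_add (hs y).of_norm]
        simp [mul_add]
      map_smul' := fun a x => by
        simp only [BoundedContinuousFunction.coe_smul, smul_eq_mul, RingHom.id_apply]
        rw [← tsum_mul_left]
        exact tsum_congr fun m => by ring }
    (∑' m, ‖c m‖) (fun x => by
      refine (norm_tsum_le_tsum_norm (hs x)).trans ?_
      rw [← tsum_mul_right]
      refine (hs x).tsum_le_tsum (fun m => ?_) (hc.mul_right _)
      rw [norm_mul]
      exact mul_le_mul_of_nonneg_left (x.norm_coe_le_norm m) (norm_nonneg _))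

theorem sumFunctional_apply {n : ℕ} (c : (Fin n → ℤ) → ℂ) (hc : Summable fun m => ‖c m‖)
    (x : (Fin n → ℤ) →ᵇ ℂ) : sumFunctional c hc x = ∑' m, c m * x m := rfl

theorem analyticOnNhd_fourierSeries {n : ℕ} {c : (Fin n → ℤ) → ℂ} {s : ℝ}
    (hc : Summable fun m => ‖c m‖ * Real.exp (s * intNorm m)) :
    AnalyticOnNhd ℂ (fun θ => ∑' m, c m * mode m θ) (openStrip n s) := by
  set d : (Fin n → ℤ) → ℂ := fun m => c m * Real.exp (s * intNorm m) with hd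
  have hds : Summable fun m => ‖d m‖ := by
    refine hc.congr fun m => ?_
    rw [hd, norm_mul, Complex.norm_real, Real.norm_of_nonneg (Real.exp_pos _).le]
  have key : ∀ θ ∈ openStrip n s,
      sumFunctional d hds (∏ i, weightedMode s i (θ i)) = ∑' m, c m * mode m θ := by
    intro θ hθ
    rw [sumFunctional_apply]
    refine tsum_congr fun m => ?_
    have h1 : (∏ i, weightedMode s i (θ i)) m = ∏ i, weightedMode s i (θ i) m := by
      rw [BoundedContinuousFunction.coe_prod, Finset.prod_apply]
    rw [h1, Finset.prod_congr rfl fun i _ => weightedMode_apply i (hθ i) m,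
      Finset.prod_mul_distrib, ← Complex.exp_sum, ← Finset.mul_sum, ← Complex.ofReal_prod,
      ← Real.exp_sum, ← Finset.mul_sum]
    simp only [hd]
    rw [mode, intNorm, mul_assoc, mul_comm (Complex.exp _), ← mul_assoc (Complex.ofReal _),
      ← Complex.ofReal_mul, ← Real.exp_add]
    simp
  intro θ hθ
  have h1 : AnalyticAt ℂ (fun θ : Fin n → ℂ => ∏ i, weightedMode s i (θ i)) θ := by
    refine Finset.analyticAt_fun_prod _ fun i _ => ?_
    exact (analyticAt_weightedMode i (hθ i)).comp_of_eq
      ((ContinuousLinearMap.proj (R := ℂ) (φ := fun _ : Fin n => ℂ) i).analyticAt θ) rfl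
  have h2 : AnalyticAt ℂ (fun θ : Fin n → ℂ =>
      sumFunctional d hds (∏ i, weightedMode s i (θ i))) θ :=
    ((sumFunctional d hds).analyticAt _).comp h1
  refine h2.congr ?_
  filter_upwards [(isOpen_openStrip n s).mem_nhds hθ] with η hη using key η hη

/-! ### The Cayley transform -/

/-- The perturbation left over after one step of the normal form procedure. -/
noncomputable def cayleyRemainder {R : Type*} [Ring R] (B P Q : R) : R :=
  Ring.inverse (1 - B) * ((B * (P + Q) - (P + Q) * B) - B * (P - Q) * B) * Ring.inverse (1 + B)

/-- The Cayley transform `(1 - B)⁻¹ (1 + B)`. -/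
noncomputable def cayley {R : Type*} [Ring R] (B : R) : R := Ring.inverse (1 - B) * (1 + B)

theorem cayley_conjugates {𝔸 : Type*} [Ring 𝔸] {B D P Q dB : 𝔸} (h1 : IsUnit (1 - B))
    (h2 : IsUnit (1 + B))
    (h : dB + dB + (B * D - D * B) + (B * D - D * B) = -(P - Q)) :
    Ring.inverse (1 - B) * (dB + dB) * Ring.inverse (1 - B) + cayley B * (D + P)
      = (D + Q + cayleyRemainder B P Q) * cayley B := by
  have c1 := Ring.inverse_mul_cancel _ h1
  have c1' := Ring.mul_inverse_cancel _ h1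
  have c2 := Ring.inverse_mul_cancel _ h2
  set R := Ring.inverse (1 - B) with hR
  set S := Ring.inverse (1 + B) with hS
  have comm : R * (1 + B) = (1 + B) * R := by
    have : (1 - B) * (1 + B) = (1 + B) * (1 - B) := by noncomm_ring
    calc R * (1 + B) = R * (1 + B) * ((1 - B) * R) := by rw [c1', mul_one]
      _ = R * ((1 + B) * (1 - B)) * R := by noncomm_ring
      _ = (R * (1 - B)) * ((1 + B) * R) := by rw [← this]; noncomm_ring
      _ = (1 + B) * R := by rw [c1, one_mul]
  have key : (dB + dB) + (1 + B) * (D + P) * (1 - B)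
      = (1 - B) * (D + Q) * (1 + B) + ((B * (P + Q) - (P + Q) * B) - B * (P - Q) * B) := by
    have e : dB + dB = -(P - Q) - (B * D - D * B) - (B * D - D * B) := by rw [← h]; abel
    rw [e]; noncomm_ring
  unfold cayley cayleyRemainder
  rw [← hR, ← hS]
  set W := (B * (P + Q) - (P + Q) * B) - B * (P - Q) * B
  calc R * (dB + dB) * R + R * (1 + B) * (D + P)
      = R * (dB + dB) * R + R * (1 + B) * (D + P) * ((1 - B) * R) := by rw [c1', mul_one]
    _ = R * ((dB + dB) + (1 + B) * (D + P) * (1 - B)) * R := by noncomm_ring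
    _ = R * ((1 - B) * (D + Q) * (1 + B) + W) * R := by rw [key]
    _ = (R * (1 - B)) * (D + Q) * ((1 + B) * R) + R * W * R := by noncomm_ring
    _ = (D + Q) * (R * (1 + B)) + R * W * (1 * R) := by rw [c1, one_mul, one_mul, comm]
    _ = (D + Q) * (R * (1 + B)) + R * W * ((S * (1 + B)) * R) := by rw [c2]
    _ = (D + Q) * (R * (1 + B)) + R * W * S * ((1 + B) * R) := by noncomm_ring
    _ = (D + Q + R * W * S) * (R * (1 + B)) := by rw [← comm]; noncomm_ring

theorem isUnit_one_sub_of_norm_le {R : Type*} [NormedRing R] [CompleteSpace R] {b : R}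
    (hb : ‖b‖ ≤ 1 / 4) : IsUnit (1 - b) :=
  (Units.oneSub b (hb.trans_lt (by norm_num))).isUnit

theorem isUnit_one_add_of_norm_le {R : Type*} [NormedRing R] [CompleteSpace R] {b : R}
    (hb : ‖b‖ ≤ 1 / 4) : IsUnit (1 + b) := by
  have := isUnit_one_sub_of_norm_le (b := -b) (by rwa [norm_neg])
  rwa [sub_neg_eq_add] at this

theorem norm_inverse_one_sub_le {R : Type*} [NormedRing R] [CompleteSpace R]
    [NormOneClass R] {b : R} (hb : ‖b‖ ≤ 1 / 4) :
    ‖Ring.inverse (1 - b)‖ ≤ 4 / 3 := by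
  have h := Ring.mul_inverse_cancel _ (isUnit_one_sub_of_norm_le hb)
  have h1 : Ring.inverse (1 - b) = 1 + b * Ring.inverse (1 - b) := by
    rw [sub_mul, one_mul, sub_eq_iff_eq_add] at h
    exact h
  have h2 : ‖Ring.inverse (1 - b)‖ ≤ 1 + 1 / 4 * ‖Ring.inverse (1 - b)‖ := by
    conv_lhs => rw [h1]
    refine norm_add_le_of_le norm_one.le ?_
    exact (norm_mul_le _ _).trans (mul_le_mul_of_nonneg_right hb (norm_nonneg _))
  linarith

theorem norm_cayley_sub_one_le {R : Type*} [NormedRing R] [CompleteSpace R]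
    [NormOneClass R] {B : R} (hB : ‖B‖ ≤ 1 / 4) : ‖cayley B - 1‖ ≤ 3 * ‖B‖ := by
  have c1 := Ring.inverse_mul_cancel _ (isUnit_one_sub_of_norm_le hB)
  have e : cayley B - 1 = Ring.inverse (1 - B) * (B + B) := by
    unfold cayley
    calc _ = Ring.inverse (1 - B) * (1 + B) - Ring.inverse (1 - B) * (1 - B) := by rw [c1]
      _ = _ := by noncomm_ring
  rw [e]
  refine (norm_mul_le_of_le (norm_inverse_one_sub_le hB) (norm_add_le B B)).trans ?_
  linarith [norm_nonneg B]

/-! ### Families of holomorphic functions depending Lipschitz continuously on the frequency -/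

/-- A family of functions on the complexified torus, bounded by `M` together with its Lipschitz
constant with respect to the parameter `ω ∈ E`. -/
structure LipFamily {n : ℕ} {X : Type*} [NormedAddCommGroup X] [NormedSpace ℂ X]
    (E : Set (Fin n → ℝ)) (s M : ℝ) (f : (Fin n → ℝ) → (Fin n → ℂ) → X) : Prop where
  nonneg : 0 ≤ M
  holo : ∀ ω ∈ E, TorusHolo s M (f ω)
  lip : ∀ ω ∈ E, ∀ ω' ∈ E, ∀ θ ∈ openStrip n s, ‖f ω θ - f ω' θ‖ ≤ M * ‖ω - ω'‖

section

variable {n : ℕ} {X : Type*} [NormedAddCommGroup X] [NormedSpace ℂ X] {E : Set (Fin n → ℝ)}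
  {s M M' : ℝ}

theorem TorusHolo.mono {t : ℝ} {f : (Fin n → ℂ) → X} (hf : TorusHolo s M f) (ht : t ≤ s)
    (hM : M ≤ M') : TorusHolo t M' f :=
  ⟨hf.diff.mono (openStrip_mono ht), fun θ hθ => hf.periodic θ (openStrip_mono ht hθ),
    fun θ hθ => (hf.bound θ (openStrip_mono ht hθ)).trans hM⟩

theorem LipFamily.mono {F : Set (Fin n → ℝ)} {t : ℝ} {f : (Fin n → ℝ) → (Fin n → ℂ) → X}
    (hf : LipFamily E s M f) (hF : F ⊆ E) (ht : t ≤ s) (hM : M ≤ M') : LipFamily F t M' f :=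
  ⟨hf.nonneg.trans hM, fun ω hω => (hf.holo ω (hF hω)).mono ht hM,
    fun ω hω ω' hω' θ hθ =>
      (hf.lip ω (hF hω) ω' (hF hω') θ (openStrip_mono ht hθ)).trans
        (mul_le_mul_of_nonneg_right hM (norm_nonneg _))⟩

theorem LipFamily.add {f g : (Fin n → ℝ) → (Fin n → ℂ) → X} (hf : LipFamily E s M f)
    (hg : LipFamily E s M' g) : LipFamily E s (M + M') fun ω θ => f ω θ + g ω θ := by
  refine ⟨add_nonneg hf.nonneg hg.nonneg, fun ω hω => ⟨(hf.holo ω hω).diff.add (hg.holo ω hω).diff,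
    fun θ hθ i => ?_, fun θ hθ => ?_⟩, fun ω hω ω' hω' θ hθ => ?_⟩
  · rw [(hf.holo ω hω).periodic θ hθ i, (hg.holo ω hω).periodic θ hθ i]
  · exact norm_add_le_of_le ((hf.holo ω hω).bound θ hθ) ((hg.holo ω hω).bound θ hθ)
  · rw [add_sub_add_comm, add_mul]
    exact norm_add_le_of_le (hf.lip ω hω ω' hω' θ hθ) (hg.lip ω hω ω' hω' θ hθ)

theorem LipFamily.neg {f : (Fin n → ℝ) → (Fin n → ℂ) → X} (hf : LipFamily E s M f) :
    LipFamily E s M fun ω θ => -f ω θ := by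
  refine ⟨hf.nonneg, fun ω hω => ⟨(hf.holo ω hω).diff.neg, fun θ hθ i => ?_, fun θ hθ => ?_⟩,
    fun ω hω ω' hω' θ hθ => ?_⟩
  · rw [(hf.holo ω hω).periodic θ hθ i]
  · rw [norm_neg]; exact (hf.holo ω hω).bound θ hθ
  · rw [neg_sub_neg, norm_sub_rev]
    exact hf.lip ω hω ω' hω' θ hθ

theorem LipFamily.sub {f g : (Fin n → ℝ) → (Fin n → ℂ) → X} (hf : LipFamily E s M f)
    (hg : LipFamily E s M' g) : LipFamily E s (M + M') fun ω θ => f ω θ - g ω θ := by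
  simpa only [sub_eq_add_neg] using hf.add hg.neg

theorem LipFamily.const {x : (Fin n → ℝ) → X} (hM : 0 ≤ M) (hx : ∀ ω ∈ E, ‖x ω‖ ≤ M)
    (hl : ∀ ω ∈ E, ∀ ω' ∈ E, ‖x ω - x ω'‖ ≤ M * ‖ω - ω'‖) :
    LipFamily E s M fun ω _ => x ω :=
  ⟨hM, fun ω hω => ⟨differentiableOn_const _, fun _ _ _ => rfl, fun _ _ => hx ω hω⟩,
    fun ω hω ω' hω' _ _ => hl ω hω ω' hω'⟩

theorem LipFamily.clm {Y : Type*} [NormedAddCommGroup Y] [NormedSpace ℂ Y]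
    {f : (Fin n → ℝ) → (Fin n → ℂ) → X} (hf : LipFamily E s M f) (L : X →L[ℂ] Y)
    (hL : ∀ x, ‖L x‖ ≤ ‖x‖) : LipFamily E s M fun ω θ => L (f ω θ) := by
  refine ⟨hf.nonneg, fun ω hω => ⟨L.differentiable.comp_differentiableOn (hf.holo ω hω).diff,
    fun θ hθ i => ?_, fun θ hθ => (hL _).trans ((hf.holo ω hω).bound θ hθ)⟩,
    fun ω hω ω' hω' θ hθ => ?_⟩
  · rw [(hf.holo ω hω).periodic θ hθ i]
  · rw [← map_sub]
    exact (hL _).trans (hf.lip ω hω ω' hω' θ hθ)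

end

section

variable {n : ℕ} {𝔸 : Type*} [NormedRing 𝔸] [NormedAlgebra ℂ 𝔸] {E : Set (Fin n → ℝ)}
  {s M M' : ℝ}

theorem LipFamily.mul {f g : (Fin n → ℝ) → (Fin n → ℂ) → 𝔸} (hf : LipFamily E s M f)
    (hg : LipFamily E s M' g) : LipFamily E s (2 * M * M') fun ω θ => f ω θ * g ω θ := by
  have h0 : 0 ≤ M * M' := mul_nonneg hf.nonneg hg.nonneg
  refine ⟨by linarith, fun ω hω => ⟨(hf.holo ω hω).diff.mul (hg.holo ω hω).diff,
    fun θ hθ i => ?_, fun θ hθ => ?_⟩, fun ω hω ω' hω' θ hθ => ?_⟩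
  · rw [(hf.holo ω hω).periodic θ hθ i, (hg.holo ω hω).periodic θ hθ i]
  · refine (norm_mul_le_of_le ((hf.holo ω hω).bound θ hθ) ((hg.holo ω hω).bound θ hθ)).trans ?_
    linarith
  · have e : f ω θ * g ω θ - f ω' θ * g ω' θ
        = (f ω θ - f ω' θ) * g ω θ + f ω' θ * (g ω θ - g ω' θ) := by noncomm_ring
    rw [e]
    refine (norm_add_le_of_le
      (norm_mul_le_of_le (hf.lip ω hω ω' hω' θ hθ) ((hg.holo ω hω).bound θ hθ))
      (norm_mul_le_of_le ((hf.holo ω' hω').bound θ hθ) (hg.lip ω hω ω' hω' θ hθ))).trans ?_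
    apply le_of_eq
    ring

variable [CompleteSpace 𝔸] [NormOneClass 𝔸]

theorem LipFamily.inverse_one_sub {b : (Fin n → ℝ) → (Fin n → ℂ) → 𝔸} (hb : LipFamily E s M b)
    (hM : M ≤ 1 / 4) : LipFamily E s 2 fun ω θ => Ring.inverse (1 - b ω θ) := by
  have hbd : ∀ ω ∈ E, ∀ θ ∈ openStrip n s, ‖b ω θ‖ ≤ 1 / 4 := fun ω hω θ hθ =>
    ((hb.holo ω hω).bound θ hθ).trans hM
  refine ⟨by norm_num, fun ω hω => ⟨fun θ hθ => ?_, fun θ hθ i => ?_, fun θ hθ => ?_⟩,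
    fun ω hω ω' hω' θ hθ => ?_⟩
  · obtain ⟨u, hu⟩ := isUnit_one_sub_of_norm_le (hbd ω hω θ hθ)
    have h1 : DifferentiableAt ℂ (Ring.inverse : 𝔸 → 𝔸) (1 - b ω θ) := by
      rw [← hu]
      exact (hasFDerivAt_ringInverse u).differentiableAt
    exact h1.comp_differentiableWithinAt θ (((hb.holo ω hω).diff θ hθ).const_sub 1)
  · rw [(hb.holo ω hω).periodic θ hθ i]
  · exact (norm_inverse_one_sub_le (hbd ω hω θ hθ)).trans (by norm_num)
  · have u1 := isUnit_one_sub_of_norm_le (hbd ω hω θ hθ)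
    have u2 := isUnit_one_sub_of_norm_le (hbd ω' hω' θ hθ)
    have e : Ring.inverse (1 - b ω θ) - Ring.inverse (1 - b ω' θ)
        = Ring.inverse (1 - b ω θ) * (b ω θ - b ω' θ) * Ring.inverse (1 - b ω' θ) := by
      have e1 : b ω θ - b ω' θ = (1 - b ω' θ) - (1 - b ω θ) := by abel
      rw [e1, mul_sub, sub_mul, mul_assoc, Ring.mul_inverse_cancel _ u2,
        Ring.inverse_mul_cancel _ u1, mul_one, one_mul]
    rw [e]
    refine (norm_mul_le_of_le (norm_mul_le_of_le (norm_inverse_one_sub_le (hbd ω hω θ hθ))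
      (hb.lip ω hω ω' hω' θ hθ)) (norm_inverse_one_sub_le (hbd ω' hω' θ hθ))).trans ?_
    have : M * ‖ω - ω'‖ ≤ 1 / 4 * ‖ω - ω'‖ := mul_le_mul_of_nonneg_right hM (norm_nonneg _)
    nlinarith [norm_nonneg (ω - ω')]

theorem LipFamily.inverse_one_add {b : (Fin n → ℝ) → (Fin n → ℂ) → 𝔸} (hb : LipFamily E s M b)
    (hM : M ≤ 1 / 4) : LipFamily E s 2 fun ω θ => Ring.inverse (1 + b ω θ) := by
  simpa only [sub_neg_eq_add] using hb.neg.inverse_one_sub hM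

theorem LipFamily.cayleyRemainder {B P Q : (Fin n → ℝ) → (Fin n → ℂ) → 𝔸} {b p : ℝ}
    (hB : LipFamily E s b B) (hP : LipFamily E s p P) (hQ : LipFamily E s p Q) (hb : b ≤ 1 / 4) :
    LipFamily E s (160 * b * p) fun ω θ => cayleyRemainder (B ω θ) (P ω θ) (Q ω θ) := by
  have h := ((hB.inverse_one_sub hb).mul
    (((hB.mul (hP.add hQ)).sub ((hP.add hQ).mul hB)).sub ((hB.mul (hP.sub hQ)).mul hB))).mul
    (hB.inverse_one_add hb)
  refine h.mono subset_rfl le_rfl ?_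
  have := mul_nonneg hB.nonneg hP.nonneg
  have h2 : b * (b * p) ≤ 1 / 4 * (b * p) := mul_le_mul_of_nonneg_right hb this
  nlinarith

end

/-! ### Fourier series with controlled coefficients -/

theorem isTorusPeriodic_tsum {n : ℕ} (c : (Fin n → ℤ) → ℂ) (θ : Fin n → ℂ) (i : Fin n) :
    ∑' m, c m * mode m (θ + Pi.single i ((2 * Real.pi : ℝ) : ℂ)) = ∑' m, c m * mode m θ := by
  simp only [mode_add_period]

theorem norm_mul_mode_le {n : ℕ} {c : ℂ} {N s δ : ℝ} {m : Fin n → ℤ} {θ : Fin n → ℂ}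
    (hc : ‖c‖ ≤ N * Real.exp (-(s + δ) * intNorm m)) (hθ : θ ∈ openStrip n s) :
    ‖c * mode m θ‖ ≤ N * Real.exp (-δ * intNorm m) := by
  rw [norm_mul]
  refine (mul_le_mul hc (norm_mode_le m fun i => (hθ i).le) (norm_nonneg _)
    ((norm_nonneg _).trans hc)).trans (le_of_eq ?_)
  rw [mul_assoc, ← Real.exp_add]
  congr 2; ring

theorem norm_tsum_mul_mode_le {n : ℕ} {c : (Fin n → ℤ) → ℂ} {N s δ : ℝ} (hδ : 0 < δ)
    (hδ1 : δ ≤ 1) (hN : 0 ≤ N) (hc : ∀ m, ‖c m‖ ≤ N * Real.exp (-(s + δ) * intNorm m))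
    {θ : Fin n → ℂ} (hθ : θ ∈ openStrip n s) : ‖∑' m, c m * mode m θ‖ ≤ N * (3 / δ) ^ n := by
  refine (tsum_of_norm_bounded ((summable_exp_neg_intNorm hδ).mul_left N).hasSum
    fun m => norm_mul_mode_le (hc m) hθ).trans ?_
  rw [tsum_mul_left]
  exact mul_le_mul_of_nonneg_left (tsum_exp_neg_intNorm_le hδ hδ1) hN

theorem torusHolo_series {n : ℕ} {c : (Fin n → ℤ) → ℂ} {N s δ : ℝ} (hδ : 0 < δ)
    (hδ1 : δ ≤ 1) (hN : 0 ≤ N) (hc : ∀ m, ‖c m‖ ≤ N * Real.exp (-(s + δ) * intNorm m)) :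
    TorusHolo s (N * (3 / δ) ^ n) fun θ => ∑' m, c m * mode m θ := by
  refine ⟨(analyticOnNhd_fourierSeries ?_).differentiableOn, fun θ _ i =>
    isTorusPeriodic_tsum c θ i, fun θ hθ => norm_tsum_mul_mode_le hδ hδ1 hN hc hθ⟩
  refine ((summable_exp_neg_intNorm hδ).mul_left N).of_nonneg_of_le (fun m => by positivity)
    fun m => ?_
  refine (mul_le_mul_of_nonneg_right (hc m) (Real.exp_pos _).le).trans (le_of_eq ?_)
  rw [mul_assoc, ← Real.exp_add]
  congr 2; ring

theorem lipFamily_series {n : ℕ} {E : Set (Fin n → ℝ)} {c : (Fin n → ℝ) → (Fin n → ℤ) → ℂ}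
    {N s δ : ℝ} (hδ : 0 < δ) (hδ1 : δ ≤ 1) (hN : 0 ≤ N)
    (hc : ∀ ω ∈ E, ∀ m, ‖c ω m‖ ≤ N * Real.exp (-(s + δ) * intNorm m))
    (hl : ∀ ω ∈ E, ∀ ω' ∈ E, ∀ m,
      ‖c ω m - c ω' m‖ ≤ N * ‖ω - ω'‖ * Real.exp (-(s + δ) * intNorm m)) :
    LipFamily E s (N * (3 / δ) ^ n) fun ω θ => ∑' m, c ω m * mode m θ := by
  have hs : ∀ ω ∈ E, ∀ θ ∈ openStrip n s, Summable fun m => c ω m * mode m θ :=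
    fun ω hω θ hθ => Summable.of_norm_bounded ((summable_exp_neg_intNorm hδ).mul_left N)
      fun m => norm_mul_mode_le (hc ω hω m) hθ
  refine ⟨by positivity, fun ω hω => torusHolo_series hδ hδ1 hN (hc ω hω),
    fun ω hω ω' hω' θ hθ => ?_⟩
  rw [← (hs ω hω θ hθ).tsum_sub (hs ω' hω' θ hθ)]
  simp only [← sub_mul]
  refine (norm_tsum_mul_mode_le hδ hδ1 (by positivity) (hl ω hω ω' hω') hθ).trans (le_of_eq ?_)
  ring

theorem intNorm_le_exp {n : ℕ} {δ : ℝ} (hδ : 0 < δ) (m : Fin n → ℤ) :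
    intNorm m ≤ δ⁻¹ * Real.exp (δ * intNorm m) := by
  have h := Real.add_one_le_exp (δ * intNorm m)
  rw [inv_mul_eq_div, le_div_iff₀ hδ]
  linarith [mul_comm δ (intNorm m)]

theorem mode_toComplexAngle_smul {n : ℕ} (m : Fin n → ℤ) (ω : Fin n → ℝ) (t : ℝ) :
    mode m (toComplexAngle (t • ω))
      = Complex.exp (Complex.I * ((∑ i, (m i : ℝ) * ω i : ℝ) : ℂ) * t) := by
  rw [mode]
  congr 1
  simp only [toComplexAngle, Pi.smul_apply, smul_eq_mul]
  push_cast
  rw [mul_assoc, Finset.sum_mul]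
  congr 1
  exact Finset.sum_congr rfl fun i _ => by ring

theorem hasDerivAt_series_line {n : ℕ} {c : (Fin n → ℤ) → ℂ} {N δ : ℝ} (hδ : 0 < δ)
    (hN : 0 ≤ N) (hc : ∀ m, ‖c m‖ ≤ N * Real.exp (-δ * intNorm m)) (ω : Fin n → ℝ) (t : ℝ) :
    HasDerivAt (fun t : ℝ => ∑' m, c m * mode m (toComplexAngle (t • ω)))
      (∑' m, c m * (Complex.I * ((∑ i, (m i : ℝ) * ω i : ℝ) : ℂ)) *
        mode m (toComplexAngle (t • ω))) t := by
  have hω : ∀ i, |ω i| ≤ ‖ω‖ := fun i => norm_le_pi_norm ω i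
  refine hasDerivAt_tsum (u := fun m => N * (‖ω‖ * (δ / 2)⁻¹) * Real.exp (-(δ / 2) * intNorm m))
    (g := fun m (t : ℝ) => c m * mode m (toComplexAngle (t • ω)))
    (g' := fun m (t : ℝ) => c m * (Complex.I * ((∑ i, (m i : ℝ) * ω i : ℝ) : ℂ)) *
        mode m (toComplexAngle (t • ω))) (y₀ := 0)
    ((summable_exp_neg_intNorm (half_pos hδ)).mul_left _) (fun m y => ?_) (fun m y => ?_) ?_ t
  · simp only [mode_toComplexAngle_smul]
    have h1 : HasDerivAt (fun y : ℝ => Complex.I * ((∑ i, (m i : ℝ) * ω i : ℝ) : ℂ) * (y : ℂ))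
        (Complex.I * ((∑ i, (m i : ℝ) * ω i : ℝ) : ℂ) * 1) y :=
      (Complex.ofRealCLM.hasDerivAt).const_mul _
    have h2 := (h1.cexp).const_mul (c m)
    exact h2.congr_deriv (by ring)
  · rw [norm_mul, norm_mode_toComplexAngle, mul_one, norm_mul, norm_mul, Complex.norm_I, one_mul,
      Complex.norm_real, Real.norm_eq_abs]
    refine (mul_le_mul (hc m) ((abs_dot_le m hω).trans (mul_le_mul_of_nonneg_right
      (intNorm_le_exp (half_pos hδ) m) (norm_nonneg _))) (abs_nonneg _) (by positivity)).trans
      (le_of_eq ?_)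
    have : Real.exp (-(δ / 2) * intNorm m)
        = Real.exp (-δ * intNorm m) * Real.exp (δ / 2 * intNorm m) := by
      rw [← Real.exp_add]; congr 1; ring
    rw [this]; ring
  · refine Summable.of_norm_bounded ((summable_exp_neg_intNorm hδ).mul_left N) fun m => ?_
    rw [norm_mul, norm_mode_toComplexAngle, mul_one]
    exact hc m

/-! ### The scalar homological equation -/

/-- The coefficients of the solution of `∂_ω g + i λ g = -(f - ⟨f⟩)/2`, where `d m = m·ω + λ`
and the resonant modes `m ∈ Z` are dropped. -/
noncomputable def homologicalCoef {n : ℕ} (Z : Set (Fin n → ℤ)) (d : (Fin n → ℤ) → ℝ)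
    (f : (Fin n → ℂ) → ℂ) (m : Fin n → ℤ) : ℂ :=
  open scoped Classical in
  if m ∈ Z then 0 else -fourierCoef f m * ((d m)⁻¹ : ℝ) * (2 * Complex.I)⁻¹

theorem norm_inv_two_I : ‖(2 * Complex.I)⁻¹‖ = 1 / 2 := by simp

theorem norm_homologicalCoef_le {n : ℕ} {Z : Set (Fin n → ℤ)} {d : (Fin n → ℤ) → ℝ}
    {f : (Fin n → ℂ) → ℂ} {s δ p G : ℝ} (hf : TorusHolo s p f) (hp : 0 ≤ p) (hδ : 0 < δ)
    (hs : 5 * δ < s)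
    (hG : 0 ≤ G) (hd : ∀ m ∉ Z, |(d m)⁻¹| ≤ G * Real.exp (3 * δ * intNorm m)) (m : Fin n → ℤ) :
    ‖homologicalCoef Z d f m‖ ≤ p * G * Real.exp (-(s - 5 * δ + δ) * intNorm m) := by
  unfold homologicalCoef
  split_ifs with h
  · rw [norm_zero]; positivity
  · rw [norm_mul, norm_mul, norm_neg, norm_inv_two_I, Complex.norm_real, Real.norm_eq_abs]
    have h1 := norm_fourierCoef_le hf (s' := s - δ) (by linarith) (by linarith) m
    have h2 := mul_le_mul h1 (hd m h) (abs_nonneg _) (by positivity)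
    have h3 : p * Real.exp (-(s - δ) * intNorm m) * (G * Real.exp (3 * δ * intNorm m))
        = p * G * Real.exp (-(s - 5 * δ + δ) * intNorm m) := by
      have : Real.exp (-(s - 5 * δ + δ) * intNorm m)
          = Real.exp (-(s - δ) * intNorm m) * Real.exp (3 * δ * intNorm m) := by
        rw [← Real.exp_add]; congr 1; ring
      rw [this]; ring
    rw [h3] at h2
    have h4 : 0 ≤ ‖fourierCoef f m‖ * |(d m)⁻¹| := by positivity
    linarith

theorem lipFamily_homological {n : ℕ} {E : Set (Fin n → ℝ)} {Z : Set (Fin n → ℤ)}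
    {d : (Fin n → ℝ) → (Fin n → ℤ) → ℝ} {f : (Fin n → ℝ) → (Fin n → ℂ) → ℂ} {s δ p G : ℝ}
    (hf : LipFamily E s p f) (hδ : 0 < δ) (hδ1 : δ ≤ 1) (hs : 5 * δ < s) (hG : 0 ≤ G)
    (hd : ∀ ω ∈ E, ∀ m ∉ Z, |(d ω m)⁻¹| ≤ G * Real.exp (3 * δ * intNorm m))
    (hl : ∀ ω ∈ E, ∀ ω' ∈ E, ∀ m ∉ Z,
      |(d ω m)⁻¹ - (d ω' m)⁻¹| ≤ G * ‖ω - ω'‖ * Real.exp (3 * δ * intNorm m)) :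
    LipFamily E (s - 5 * δ) (p * G * (3 / δ) ^ n)
      fun ω θ => ∑' m, homologicalCoef Z (d ω) (f ω) m * mode m θ := by
  have hp := hf.nonneg
  refine lipFamily_series hδ hδ1 (by positivity)
    (fun ω hω m => norm_homologicalCoef_le (hf.holo ω hω) hp hδ hs hG (hd ω hω) m)
    fun ω hω ω' hω' m => ?_
  unfold homologicalCoef
  split_ifs with h
  · rw [sub_zero, norm_zero]; positivity
  · have e : -fourierCoef (f ω) m * ((d ω m)⁻¹ : ℝ) * (2 * Complex.I)⁻¹
        - -fourierCoef (f ω') m * ((d ω' m)⁻¹ : ℝ) * (2 * Complex.I)⁻¹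
        = -((fourierCoef (f ω) m - fourierCoef (f ω') m) * ((d ω m)⁻¹ : ℝ)
          + fourierCoef (f ω') m * (((d ω m)⁻¹ - (d ω' m)⁻¹ : ℝ) : ℂ)) * (2 * Complex.I)⁻¹ := by
      push_cast; ring
    have hs0 : 0 < s := by linarith
    have h1 := norm_fourierCoef_le (hf.holo ω' hω') (s' := s - δ) (by linarith) (by linarith) m
    have h2 : ‖fourierCoef (f ω) m - fourierCoef (f ω') m‖
        ≤ p * ‖ω - ω'‖ * Real.exp (-(s - δ) * intNorm m) := by
      rw [← fourierCoef_sub (hf.holo ω hω) (hf.holo ω' hω') hs0 hs0]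
      refine norm_fourierCoef_le (s := s) ⟨(hf.holo ω hω).diff.sub (hf.holo ω' hω').diff,
        fun θ hθ i => ?_, fun θ hθ => hf.lip ω hω ω' hω' θ hθ⟩ (by linarith) (by linarith) m
      simp only [Pi.sub_apply]
      rw [(hf.holo ω hω).periodic θ hθ i, (hf.holo ω' hω').periodic θ hθ i]
    have hA : ‖(((d ω m)⁻¹ : ℝ) : ℂ)‖ ≤ G * Real.exp (3 * δ * intNorm m) := by
      rw [Complex.norm_real]; exact hd ω hω m h
    have hB : ‖(((d ω m)⁻¹ - (d ω' m)⁻¹ : ℝ) : ℂ)‖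
        ≤ G * ‖ω - ω'‖ * Real.exp (3 * δ * intNorm m) := by
      rw [Complex.norm_real]; exact hl ω hω ω' hω' m h
    rw [e, norm_mul, norm_neg, norm_inv_two_I]
    have h3 := norm_add_le_of_le (norm_mul_le_of_le h2 hA) (norm_mul_le_of_le h1 hB)
    have h4 : Real.exp (-(s - 5 * δ + δ) * intNorm m)
        = Real.exp (-(s - δ) * intNorm m) * Real.exp (3 * δ * intNorm m) := by
      rw [← Real.exp_add]; congr 1; ring
    rw [h4]
    linarith

/-- The solution of the homological equation, differentiated along the flow of frequency `ω`. -/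
theorem hasDerivAt_homological {n : ℕ} {Z : Set (Fin n → ℤ)} {ω : Fin n → ℝ} {lam : ℝ}
    {f : (Fin n → ℂ) → ℂ} {s δ p G : ℝ} (hf : TorusHolo s p f) (hp : 0 ≤ p) (hδ : 0 < δ)
    (hs : 5 * δ < s) (hG : 0 ≤ G) (hZ : Z ⊆ {0})
    (hd : ∀ m ∉ Z, |(∑ i, (m i : ℝ) * ω i + lam)⁻¹| ≤ G * Real.exp (3 * δ * intNorm m))
    (hd0 : ∀ m ∉ Z, ∑ i, (m i : ℝ) * ω i + lam ≠ 0) {κ : ℂ} (hκ : 0 ∈ Z → κ = fourierCoef f 0)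
    (hκ0 : 0 ∉ Z → κ = 0) (t : ℝ) :
    ∃ D : ℂ, HasDerivAt (fun t : ℝ => ∑' m, homologicalCoef Z
        (fun m => ∑ i, (m i : ℝ) * ω i + lam) f m * mode m (toComplexAngle (t • ω))) D t ∧
      2 * (D + Complex.I * lam * ∑' m, homologicalCoef Z
        (fun m => ∑ i, (m i : ℝ) * ω i + lam) f m * mode m (toComplexAngle (t • ω)))
      = -(f (toComplexAngle (t • ω)) - κ) := by
  classical
  set c := homologicalCoef Z (fun m => ∑ i, (m i : ℝ) * ω i + lam) f with hcdef
  have hc : ∀ m, ‖c m‖ ≤ p * G * Real.exp (-(s - 5 * δ + δ) * intNorm m) := fun m =>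
    norm_homologicalCoef_le hf hp hδ hs hG hd m
  have hs1 : 0 < s - 5 * δ + δ := by linarith
  have hder := hasDerivAt_series_line hs1 (by positivity) hc ω t
  refine ⟨_, hder, ?_⟩
  have hterm : ∀ m, 2 * (c m * (Complex.I * ((∑ i, (m i : ℝ) * ω i : ℝ) : ℂ)) +
      Complex.I * lam * c m) = if m ∈ Z then 0 else -fourierCoef f m := by
    intro m
    simp only [hcdef, homologicalCoef]
    split_ifs with h
    · simp
    · have h0 : ((∑ i, (m i : ℝ) * ω i : ℝ) : ℂ) + (lam : ℂ) ≠ 0 := by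
        exact_mod_cast hd0 m h
      rw [show ∀ x a b c : ℂ, 2 * (x * (a * b) + a * c * x) = 2 * a * (b + c) * x from
        fun x a b c => by ring, Complex.ofReal_inv, Complex.ofReal_add]
      field_simp
  have hS1 : Summable fun m => c m * mode m (toComplexAngle (t • ω)) :=
    Summable.of_norm_bounded ((summable_exp_neg_intNorm hs1).mul_left (p * G)) fun m => by
      rw [norm_mul, norm_mode_toComplexAngle, mul_one]; exact hc m
  have hf1 := hf.hasSum (by linarith) (t • ω)
  have hR : HasSum (fun m => (if m ∈ Z then 0 else -fourierCoef f m) *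
      mode m (toComplexAngle (t • ω)))
      (-(f (toComplexAngle (t • ω)) - κ)) := by
    have h1 : HasSum (fun m : Fin n → ℤ => if m = 0 then κ else 0) κ := hasSum_ite_eq 0 _
    convert! (hf1.sub h1).neg using 2 with m
    by_cases hm : m = 0
    · subst hm
      by_cases h : (0 : Fin n → ℤ) ∈ Z
      · simp [h, mode_zero, hκ h]
      · simp [h, mode_zero, hκ0 h]
    · have : m ∉ Z := fun h => hm (hZ h)
      simp [this, hm]
  rw [← tsum_mul_left (a := Complex.I * (lam : ℂ))]
  have hS3 := hS1.mul_left (Complex.I * (lam : ℂ))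
  have hS2 : Summable fun m => c m * (Complex.I * ((∑ i, (m i : ℝ) * ω i : ℝ) : ℂ)) *
      mode m (toComplexAngle (t • ω)) := by
    refine ((hR.summable.mul_left (1 / 2 : ℂ)).sub hS3).congr fun m => ?_
    rw [← hterm m]; ring
  rw [← hS2.tsum_add hS3, ← tsum_mul_left]
  rw [← hR.tsum_eq]
  refine tsum_congr fun m => ?_
  rw [← hterm m]; ring

/-! ### Matrices on the phase space -/

/-- Complex `4 × 4` matrices acting on the phase space. -/
abbrev PhaseMatrix : Type := Matrix (Fin 2 ⊕ Fin 2) (Fin 2 ⊕ Fin 2) ℂ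

theorem norm_entry_le (A : PhaseMatrix) (k l : Fin 2 ⊕ Fin 2) : ‖A k l‖ ≤ ‖A‖ := by
  have h : ‖A k l‖₊ ≤ ‖A‖₊ := by
    rw [Matrix.linfty_opNNNorm_def]
    refine le_trans ?_ (Finset.le_sup (f := fun i => ∑ j, ‖A i j‖₊) (Finset.mem_univ k))
    exact Finset.single_le_sum (f := fun j => ‖A k j‖₊) (fun _ _ => zero_le) (Finset.mem_univ l)
  exact h

theorem norm_le_of_entries {A : PhaseMatrix} {r : ℝ} (hr : 0 ≤ r) (h : ∀ k l, ‖A k l‖ ≤ r) :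
    ‖A‖ ≤ 4 * r := by
  lift r to NNReal using hr
  have h1 : ‖A‖₊ ≤ 4 * r := by
    rw [Matrix.linfty_opNNNorm_def]
    refine Finset.sup_le fun i _ => ?_
    refine (Finset.sum_le_sum fun j _ => (show ‖A i j‖₊ ≤ r from h i j)).trans ?_
    simp
  exact h1

theorem norm_diagonal_le {v : Fin 2 ⊕ Fin 2 → ℂ} {r : ℝ} (h : ∀ k, ‖v k‖ ≤ r) :
    ‖(Matrix.diagonal v : PhaseMatrix)‖ ≤ r := by
  rw [Matrix.linfty_opNorm_diagonal]
  exact (pi_norm_le_iff_of_nonneg ((norm_nonneg _).trans (h (Sum.inl 0)))).2 h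

/-- A matrix entry as a continuous linear functional. -/
noncomputable def entryCLM (k l : Fin 2 ⊕ Fin 2) : PhaseMatrix →L[ℂ] ℂ :=
  LinearMap.toContinuousLinearMap (Matrix.entryLinearMap ℂ ℂ k l)

theorem phaseMatrix_eq_sum (A : PhaseMatrix) :
    A = ∑ k, ∑ l, A k l • Matrix.single k l (1 : ℂ) := by
  conv_lhs => rw [Matrix.matrix_eq_sum_single A]
  simp [Matrix.smul_single]

theorem LipFamily.entry {n : ℕ} {E : Set (Fin n → ℝ)} {s M : ℝ}
    {f : (Fin n → ℝ) → (Fin n → ℂ) → PhaseMatrix} (hf : LipFamily E s M f)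
    (k l : Fin 2 ⊕ Fin 2) : LipFamily E s M fun ω θ => f ω θ k l :=
  hf.clm (entryCLM k l) fun A => norm_entry_le A k l

theorem TorusHolo.entry {n : ℕ} {s M : ℝ} {f : (Fin n → ℂ) → PhaseMatrix} (hf : TorusHolo s M f)
    (k l : Fin 2 ⊕ Fin 2) : TorusHolo s M fun θ => f θ k l :=
  ⟨(entryCLM k l).differentiable.comp_differentiableOn hf.diff,
    fun θ hθ i => by rw [hf.periodic θ hθ i],
    fun θ hθ => (norm_entry_le _ k l).trans (hf.bound θ hθ)⟩

theorem torusHolo_of_entries {n : ℕ} {s M : ℝ} {f : (Fin n → ℂ) → PhaseMatrix} (hM : 0 ≤ M)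
    (hf : ∀ k l, TorusHolo s M fun θ => f θ k l) : TorusHolo s (4 * M) f := by
  refine ⟨?_, fun θ hθ i => ?_, fun θ hθ => ?_⟩
  · have e : f = fun θ => ∑ k, ∑ l, f θ k l • Matrix.single k l (1 : ℂ) :=
      funext fun θ => phaseMatrix_eq_sum (f θ)
    rw [e]
    exact DifferentiableOn.fun_sum fun k _ => DifferentiableOn.fun_sum fun l _ =>
      ((hf k l).diff).smul_const _
  · ext k l; exact (hf k l).periodic θ hθ i
  · exact norm_le_of_entries hM fun k l => (hf k l).bound θ hθ

theorem lipFamily_of_entries {n : ℕ} {E : Set (Fin n → ℝ)} {s M : ℝ}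
    {f : (Fin n → ℝ) → (Fin n → ℂ) → PhaseMatrix}
    (hf : ∀ k l, LipFamily E s M fun ω θ => f ω θ k l) : LipFamily E s (4 * M) f := by
  have hM := (hf (Sum.inl 0) (Sum.inl 0)).nonneg
  refine ⟨by positivity, fun ω hω => torusHolo_of_entries hM fun k l => (hf k l).holo ω hω,
    fun ω hω ω' hω' θ hθ => ?_⟩
  refine (norm_le_of_entries (mul_nonneg hM (norm_nonneg _)) fun k l =>
    (hf k l).lip ω hω ω' hω' θ hθ).trans (le_of_eq ?_)
  ring

theorem hasDerivAt_of_entries {f : ℝ → PhaseMatrix} {f' : PhaseMatrix} {t : ℝ}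
    (h : ∀ k l, HasDerivAt (fun t => f t k l) (f' k l) t) : HasDerivAt f f' t := by
  have e : f = fun t => ∑ k, ∑ l, f t k l • Matrix.single k l (1 : ℂ) :=
    funext fun t => phaseMatrix_eq_sum (f t)
  rw [e, phaseMatrix_eq_sum f']
  exact HasDerivAt.fun_sum fun k _ => HasDerivAt.fun_sum fun l _ => (h k l).smul_const _

/-! ### The symplectic and the real structure -/

/-- The sign `+1` on the `ξ`-coordinates, `-1` on the `η`-coordinates. -/
def phaseSign : Fin 2 ⊕ Fin 2 → ℝ := Sum.elim 1 (-1)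

theorem phaseSign_mul_self (k : Fin 2 ⊕ Fin 2) : phaseSign k * phaseSign k = 1 := by
  rcases k with k | k <;> simp [phaseSign]

theorem phaseSign_swap (k : Fin 2 ⊕ Fin 2) : phaseSign k.swap = -phaseSign k := by
  rcases k with k | k <;> simp [phaseSign]

/-- The symplectic adjoint `J⁻¹ Aᵀ J`. -/
noncomputable def sympAdj : PhaseMatrix →ₗ[ℝ] PhaseMatrix where
  toFun A := Matrix.of fun k l => (phaseSign k * phaseSign l : ℝ) * A l.swap k.swap
  map_add' A B := by ext k l; simp [mul_add]
  map_smul' c A := by ext k l; simp [mul_left_comm]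

/-- The conjugation of matrices induced by `(ξ, η) ↦ (η̄, ξ̄)`. -/
noncomputable def realConj : PhaseMatrix →ₗ[ℝ] PhaseMatrix where
  toFun A := Matrix.of fun k l => starRingEnd ℂ (A k.swap l.swap)
  map_add' A B := by ext k l; simp
  map_smul' c A := by ext k l; simp

theorem sympAdj_apply (A : PhaseMatrix) (k l : Fin 2 ⊕ Fin 2) :
    sympAdj A k l = (phaseSign k * phaseSign l : ℝ) * A l.swap k.swap := rfl

theorem realConj_apply (A : PhaseMatrix) (k l : Fin 2 ⊕ Fin 2) :
    realConj A k l = starRingEnd ℂ (A k.swap l.swap) := rfl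

theorem sympAdj_mul (A B : PhaseMatrix) : sympAdj (A * B) = sympAdj B * sympAdj A := by
  ext k l
  rw [sympAdj_apply, Matrix.mul_apply, Matrix.mul_apply, Finset.mul_sum,
    ← Equiv.sum_comp (Equiv.sumComm (Fin 2) (Fin 2))]
  refine Finset.sum_congr rfl fun j _ => ?_
  rw [sympAdj_apply, sympAdj_apply, Equiv.sumComm_apply]
  have h : (phaseSign j : ℂ) * phaseSign j = 1 := by exact_mod_cast phaseSign_mul_self j
  push_cast
  linear_combination (-(phaseSign k * phaseSign l * A l.swap j.swap * B j.swap k.swap : ℂ)) * h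

theorem sympAdj_one : sympAdj 1 = 1 := by
  ext k l
  rw [sympAdj_apply]
  by_cases h : k = l
  · subst h; simp [phaseSign_mul_self]
  · have : l.swap ≠ k.swap := fun e => h (by simpa using (congrArg Sum.swap e).symm)
    simp [h, this]

theorem realConj_mul (A B : PhaseMatrix) : realConj (A * B) = realConj A * realConj B := by
  ext k l
  rw [realConj_apply, Matrix.mul_apply, Matrix.mul_apply, map_sum,
    ← Equiv.sum_comp (Equiv.sumComm (Fin 2) (Fin 2))]
  refine Finset.sum_congr rfl fun j _ => ?_
  rw [realConj_apply, realConj_apply, map_mul]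
  rfl

theorem realConj_one : realConj 1 = 1 := by
  ext k l
  rw [realConj_apply]
  by_cases h : k = l
  · subst h; simp
  · have : k.swap ≠ l.swap := fun e => h (by simpa using congrArg Sum.swap e)
    simp [h, this]

theorem continuous_sympAdj : Continuous sympAdj := LinearMap.continuous_of_finiteDimensional _

theorem continuous_realConj : Continuous realConj := LinearMap.continuous_of_finiteDimensional _

theorem realConj_mulVec (A : PhaseMatrix) (z : PhaseSpace) (k : Fin 2 ⊕ Fin 2) :
    (realConj A).mulVec z k
      = starRingEnd ℂ (A.mulVec (fun l => starRingEnd ℂ (z l.swap)) k.swap) := by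
  simp only [Matrix.mulVec, dotProduct, map_sum, map_mul, Complex.conj_conj, realConj_apply]
  rw [← Equiv.sum_comp (Equiv.sumComm (Fin 2) (Fin 2))]
  refine Finset.sum_congr rfl fun j _ => ?_
  simp

theorem isRealState_iff (z : PhaseSpace) :
    IsRealState z ↔ (fun l => starRingEnd ℂ (z l.swap)) = z := by
  constructor
  · intro h
    funext l
    rcases l with j | j
    · simp [h j]
    · simp [h j]
  · intro h j
    exact (congrFun h (Sum.inr j)).symm

theorem mem_sp2_iff (A : PhaseMatrix) : A ∈ sp2 ↔ sympAdj A = -A ∧ realConj A = A := by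
  have h1 : A ∈ LieAlgebra.Symplectic.sp (Fin 2) ℂ ↔ sympAdj A = -A := by
    have e : A ∈ LieAlgebra.Symplectic.sp (Fin 2) ℂ ↔
        A.transpose * Matrix.J (Fin 2) ℂ = Matrix.J (Fin 2) ℂ * -A := by
      rw [LieAlgebra.Symplectic.sp, mem_skewAdjointMatricesLieSubalgebra,
        mem_skewAdjointMatricesSubmodule]
      rfl
    have e2 : Matrix.J (Fin 2) ℂ * sympAdj A = A.transpose * Matrix.J (Fin 2) ℂ := by
      ext k l
      rcases k with k | k <;> rcases l with l | l <;>
        simp [Matrix.mul_apply, Matrix.J, sympAdj_apply, phaseSign, Fintype.sum_sum_type,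
          Matrix.one_apply]
    rw [e, ← e2]
    constructor
    · intro h
      have := congrArg (fun X => -(Matrix.J (Fin 2) ℂ * X)) h
      simpa only [← mul_assoc, Matrix.J_squared, neg_mul, one_mul, neg_neg] using this
    · intro h; rw [h]
  have h2 : (∀ z : PhaseSpace, IsRealState z → IsRealState (A.mulVec z)) ↔ realConj A = A := by
    constructor
    · intro h
      have hreal : ∀ z : PhaseSpace, (fun l => starRingEnd ℂ (z l.swap)) = z →
          (realConj A).mulVec z = A.mulVec z := by
        intro z hz
        funext k
        rw [realConj_mulVec, hz]
        exact congrFun ((isRealState_iff _).1 (h z ((isRealState_iff z).2 hz))) k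
      have hall : ∀ z : PhaseSpace, (realConj A).mulVec z = A.mulVec z := by
        intro z
        set c : PhaseSpace → PhaseSpace := fun z l => starRingEnd ℂ (z l.swap) with hc
        have hcc : ∀ z, c (c z) = z := fun z => by funext l; simp [hc]
        have hcadd : ∀ z w, c (z + w) = c z + c w := fun z w => by funext l; simp [hc]
        have hcs : ∀ (a : ℂ) z, c (a • z) = starRingEnd ℂ a • c z := fun a z => by
          funext l; simp [hc]
        have r1 := hreal (z + c z) (by
          change c (z + c z) = _
          rw [hcadd, hcc, add_comm])
        have r2 := hreal (Complex.I • (z + (-1 : ℂ) • c z)) (by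
          change c _ = _
          rw [hcs, hcadd, hcs, hcc, Complex.conj_I]
          simp only [map_neg, map_one]
          module)
        have e : z = (1 / 2 : ℂ) • (z + c z)
            + (-Complex.I / 2) • (Complex.I • (z + (-1 : ℂ) • c z)) := by
          rw [smul_smul, show -Complex.I / 2 * Complex.I = 1 / 2 by
            rw [div_mul_eq_mul_div, neg_mul, Complex.I_mul_I, neg_neg]]
          module
        rw [e]
        simp only [Matrix.mulVec_add, Matrix.mulVec_smul] at r1 r2 ⊢
        rw [r1, r2]
      ext k l
      have := congrFun (hall (Pi.single l 1)) k
      simpa using this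
    · intro h z hz
      rw [isRealState_iff] at hz ⊢
      funext k
      have := realConj_mulVec A z k
      rw [hz, h] at this
      exact this.symm
  exact and_congr h1 h2

theorem ringInverse_eq {R : Type*} [Ring R] {a b : R} (h1 : a * b = 1) (h2 : b * a = 1) :
    Ring.inverse a = b := Ring.inverse_unit ⟨a, b, h1, h2⟩

theorem sympAdj_inverse {A : PhaseMatrix} (h : IsUnit A) :
    sympAdj (Ring.inverse A) = Ring.inverse (sympAdj A) := by
  refine (ringInverse_eq ?_ ?_).symm
  · rw [← sympAdj_mul, Ring.inverse_mul_cancel _ h, sympAdj_one]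
  · rw [← sympAdj_mul, Ring.mul_inverse_cancel _ h, sympAdj_one]

theorem realConj_inverse {A : PhaseMatrix} (h : IsUnit A) :
    realConj (Ring.inverse A) = Ring.inverse (realConj A) := by
  refine (ringInverse_eq ?_ ?_).symm
  · rw [← realConj_mul, Ring.mul_inverse_cancel _ h, realConj_one]
  · rw [← realConj_mul, Ring.inverse_mul_cancel _ h, realConj_one]

theorem add_mem_sp2 {A B : PhaseMatrix} (hA : A ∈ sp2) (hB : B ∈ sp2) : A + B ∈ sp2 := by
  rw [mem_sp2_iff] at *
  rw [map_add, map_add, hA.1, hA.2, hB.1, hB.2]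
  exact ⟨by abel, rfl⟩

theorem smul_mem_sp2 {A : PhaseMatrix} (c : ℝ) (hA : A ∈ sp2) : c • A ∈ sp2 := by
  rw [mem_sp2_iff] at *
  rw [map_smul, map_smul, hA.1, hA.2, smul_neg]
  exact ⟨rfl, rfl⟩

theorem sub_mem_sp2 {A B : PhaseMatrix} (hA : A ∈ sp2) (hB : B ∈ sp2) : A - B ∈ sp2 := by
  have := add_mem_sp2 hA (smul_mem_sp2 (-1) hB)
  rwa [neg_one_smul, ← sub_eq_add_neg] at this

theorem zero_mem_sp2 : (0 : PhaseMatrix) ∈ sp2 := by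
  rw [mem_sp2_iff]; simp

theorem commutator_mem_sp2 {A B : PhaseMatrix} (hA : A ∈ sp2) (hB : B ∈ sp2) :
    A * B - B * A ∈ sp2 := by
  rw [mem_sp2_iff] at *
  rw [map_sub, map_sub, sympAdj_mul, sympAdj_mul, realConj_mul, realConj_mul, hA.1, hA.2, hB.1,
    hB.2]
  exact ⟨by noncomm_ring, rfl⟩

theorem sandwich_mem_sp2 {A B : PhaseMatrix} (hA : A ∈ sp2) (hB : B ∈ sp2) :
    A * B * A ∈ sp2 := by
  rw [mem_sp2_iff] at *
  rw [sympAdj_mul, sympAdj_mul, realConj_mul, realConj_mul, hA.1, hA.2, hB.1, hB.2]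
  exact ⟨by noncomm_ring, rfl⟩

theorem sympAdj_inverse_one_sub {B : PhaseMatrix} (hB : B ∈ sp2) (h1 : IsUnit (1 - B)) :
    sympAdj (Ring.inverse (1 - B)) = Ring.inverse (1 + B) := by
  rw [mem_sp2_iff] at hB
  rw [sympAdj_inverse h1, map_sub, sympAdj_one, hB.1, sub_neg_eq_add]

theorem sympAdj_inverse_one_add {B : PhaseMatrix} (hB : B ∈ sp2) (h1 : IsUnit (1 + B)) :
    sympAdj (Ring.inverse (1 + B)) = Ring.inverse (1 - B) := by
  rw [mem_sp2_iff] at hB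
  rw [sympAdj_inverse h1, map_add, sympAdj_one, hB.1, ← sub_eq_add_neg]

theorem realConj_inverse_one_sub {B : PhaseMatrix} (hB : B ∈ sp2) (h1 : IsUnit (1 - B)) :
    realConj (Ring.inverse (1 - B)) = Ring.inverse (1 - B) := by
  rw [mem_sp2_iff] at hB
  rw [realConj_inverse h1, map_sub, realConj_one, hB.2]

theorem realConj_inverse_one_add {B : PhaseMatrix} (hB : B ∈ sp2) (h1 : IsUnit (1 + B)) :
    realConj (Ring.inverse (1 + B)) = Ring.inverse (1 + B) := by
  rw [mem_sp2_iff] at hB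
  rw [realConj_inverse h1, map_add, realConj_one, hB.2]

theorem cayleyRemainder_mem_sp2 {B P Q : PhaseMatrix} (hB : B ∈ sp2) (hP : P ∈ sp2)
    (hQ : Q ∈ sp2) (h1 : IsUnit (1 - B)) (h2 : IsUnit (1 + B)) :
    cayleyRemainder B P Q ∈ sp2 := by
  have hW := sub_mem_sp2 (commutator_mem_sp2 hB (add_mem_sp2 hP hQ))
    (sandwich_mem_sp2 hB (sub_mem_sp2 hP hQ))
  unfold cayleyRemainder
  set W := (B * (P + Q) - (P + Q) * B) - B * (P - Q) * B
  rw [mem_sp2_iff] at hW ⊢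
  rw [sympAdj_mul, sympAdj_mul, realConj_mul, realConj_mul, sympAdj_inverse_one_sub hB h1,
    sympAdj_inverse_one_add hB h2, realConj_inverse_one_sub hB h1, realConj_inverse_one_add hB h2,
    hW.1, hW.2]
  exact ⟨by noncomm_ring, rfl⟩

/-- A symplectic matrix preserving the real states. -/
structure IsRealSymplectic (Φ : PhaseMatrix) : Prop where
  left_inv : sympAdj Φ * Φ = 1
  right_inv : Φ * sympAdj Φ = 1
  real : realConj Φ = Φ

theorem IsRealSymplectic.one : IsRealSymplectic 1 :=
  ⟨by rw [sympAdj_one, one_mul], by rw [sympAdj_one, one_mul], realConj_one⟩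

theorem IsRealSymplectic.mul {Φ Ψ : PhaseMatrix} (hΦ : IsRealSymplectic Φ)
    (hΨ : IsRealSymplectic Ψ) : IsRealSymplectic (Φ * Ψ) := by
  refine ⟨?_, ?_, by rw [realConj_mul, hΦ.real, hΨ.real]⟩
  · rw [sympAdj_mul, mul_assoc, ← mul_assoc _ Φ, hΦ.left_inv, one_mul, hΨ.left_inv]
  · rw [sympAdj_mul, mul_assoc, ← mul_assoc Ψ, hΨ.right_inv, one_mul, hΦ.right_inv]

theorem isRealSymplectic_cayley {B : PhaseMatrix} (hB : B ∈ sp2) (h1 : IsUnit (1 - B))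
    (h2 : IsUnit (1 + B)) : IsRealSymplectic (cayley B) := by
  have c1 := Ring.inverse_mul_cancel _ h1
  have c1' := Ring.mul_inverse_cancel _ h1
  have c2 := Ring.inverse_mul_cancel _ h2
  have c2' := Ring.mul_inverse_cancel _ h2
  have comm : (1 - B) * (1 + B) = (1 + B) * (1 - B) := by noncomm_ring
  have hB' := (mem_sp2_iff B).1 hB
  have e : sympAdj (cayley B) = (1 - B) * Ring.inverse (1 + B) := by
    rw [cayley, sympAdj_mul, sympAdj_inverse_one_sub hB h1, map_add, sympAdj_one, hB'.1,
      ← sub_eq_add_neg]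
  have e2 : (1 - B) * Ring.inverse (1 + B) = Ring.inverse (1 + B) * (1 - B) := by
    calc _ = Ring.inverse (1 + B) * (1 + B) * ((1 - B) * Ring.inverse (1 + B)) := by
          rw [c2, one_mul]
      _ = Ring.inverse (1 + B) * ((1 + B) * (1 - B)) * Ring.inverse (1 + B) := by noncomm_ring
      _ = Ring.inverse (1 + B) * (1 - B) * ((1 + B) * Ring.inverse (1 + B)) := by
          rw [← comm]; noncomm_ring
      _ = _ := by rw [c2', mul_one]
  refine ⟨?_, ?_, ?_⟩
  · rw [e, e2, cayley, mul_assoc, ← mul_assoc (1 - B), c1', one_mul, c2]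
  · rw [e, cayley, e2, mul_assoc, ← mul_assoc (1 + B), c2', one_mul, c1]
  · rw [cayley, realConj_mul, realConj_inverse_one_sub hB h1, map_add, realConj_one, hB'.2]

theorem isRealSymplectic_of_tendsto {Φ : ℕ → PhaseMatrix} {Ψ : PhaseMatrix}
    (h : Tendsto Φ atTop (𝓝 Ψ)) (hΦ : ∀ j, IsRealSymplectic (Φ j)) : IsRealSymplectic Ψ := by
  have hs : Tendsto (fun j => sympAdj (Φ j)) atTop (𝓝 (sympAdj Ψ)) :=
    (continuous_sympAdj.tendsto Ψ).comp h
  have hr : Tendsto (fun j => realConj (Φ j)) atTop (𝓝 (realConj Ψ)) :=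
    (continuous_realConj.tendsto Ψ).comp h
  refine ⟨?_, ?_, ?_⟩
  · refine tendsto_nhds_unique (hs.mul h) ?_
    simp only [(hΦ _).left_inv]
    exact tendsto_const_nhds
  · refine tendsto_nhds_unique (h.mul hs) ?_
    simp only [(hΦ _).right_inv]
    exact tendsto_const_nhds
  · refine tendsto_nhds_unique hr ?_
    simp only [(hΦ _).real]
    exact h

/-! ### The normal form and its homological equation -/

/-- The eigenfrequencies `(a, -a)` of the normal form with frequencies `a`. -/
def eigenFreq (a : Fin 2 → ℝ) : Fin 2 ⊕ Fin 2 → ℝ := Sum.elim a (-a)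

/-- The matrix of the Hamiltonian equations of the normal form. -/
noncomputable def normalMatrix (a : Fin 2 → ℝ) : PhaseMatrix :=
  Matrix.diagonal fun k => -Complex.I * eigenFreq a k

theorem eigenFreq_swap (a : Fin 2 → ℝ) (k : Fin 2 ⊕ Fin 2) :
    eigenFreq a k.swap = -eigenFreq a k := by
  rcases k with k | k <;> simp [eigenFreq]

theorem eigenFreq_add (a b : Fin 2 → ℝ) (k : Fin 2 ⊕ Fin 2) :
    eigenFreq (a + b) k = eigenFreq a k + eigenFreq b k := by
  rcases k with k | k <;> simp [eigenFreq]; ring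

theorem eigenFreq_sub (a b : Fin 2 → ℝ) (k : Fin 2 ⊕ Fin 2) :
    eigenFreq (a - b) k = eigenFreq a k - eigenFreq b k := by
  rcases k with k | k <;> simp [eigenFreq]; ring

theorem abs_eigenFreq_le {a : Fin 2 → ℝ} {r : ℝ} (h : ∀ j, |a j| ≤ r) (k : Fin 2 ⊕ Fin 2) :
    |eigenFreq a k| ≤ r := by
  rcases k with k | k <;> simpa [eigenFreq] using h k

theorem normalMatrix_add (a b : Fin 2 → ℝ) :
    normalMatrix (a + b) = normalMatrix a + normalMatrix b := by
  rw [normalMatrix, normalMatrix, normalMatrix, Matrix.diagonal_add]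
  congr 1
  funext k
  rw [eigenFreq_add]; push_cast; ring

theorem normalMatrix_sub (a b : Fin 2 → ℝ) :
    normalMatrix (a - b) = normalMatrix a - normalMatrix b := by
  rw [normalMatrix, normalMatrix, normalMatrix, Matrix.diagonal_sub]
  congr 1
  funext k
  rw [eigenFreq_sub]; push_cast; ring

theorem norm_normalMatrix_le {a : Fin 2 → ℝ} {r : ℝ} (h : ∀ j, |a j| ≤ r) :
    ‖normalMatrix a‖ ≤ r := by
  refine norm_diagonal_le fun k => ?_
  rw [norm_mul, norm_neg, Complex.norm_I, one_mul, Complex.norm_real]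
  exact abs_eigenFreq_le h k

theorem normalMatrix_mem_sp2 (a : Fin 2 → ℝ) : normalMatrix a ∈ sp2 := by
  rw [mem_sp2_iff]
  constructor
  · ext k l
    rw [sympAdj_apply]
    by_cases h : k = l
    · subst h; simp [normalMatrix, phaseSign_mul_self, eigenFreq_swap]
    · have : l.swap ≠ k.swap := fun e => h (by simpa using (congrArg Sum.swap e).symm)
      simp [normalMatrix, h, this]
  · ext k l
    rw [realConj_apply]
    by_cases h : k = l
    · subst h; simp [normalMatrix, eigenFreq_swap]
    · have : k.swap ≠ l.swap := fun e => h (by simpa using congrArg Sum.swap e)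
      simp [normalMatrix, h, this]

/-- The frequency shift produced by the average of a perturbation. -/
noncomputable def meanFreq {n : ℕ} (P : (Fin n → ℂ) → PhaseMatrix) (j : Fin 2) : ℝ :=
  (Complex.I * fourierCoef (fun θ => P θ (Sum.inl j) (Sum.inl j)) 0).re

theorem normalMatrix_meanFreq_apply {n : ℕ} {P : (Fin n → ℂ) → PhaseMatrix}
    (hP : ∀ θ : Fin n → ℝ, P (toComplexAngle θ) ∈ sp2) (k : Fin 2 ⊕ Fin 2) :
    normalMatrix (meanFreq P) k k = fourierCoef (fun θ => P θ k k) 0 := by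
  have hsym : ∀ (θ : Fin n → ℝ) (j : Fin 2), P (toComplexAngle θ) (Sum.inr j) (Sum.inr j)
      = -P (toComplexAngle θ) (Sum.inl j) (Sum.inl j) := by
    intro θ j
    have h := congrFun (congrFun ((mem_sp2_iff _).1 (hP θ)).1 (Sum.inl j)) (Sum.inl j)
    rw [sympAdj_apply] at h
    simpa [phaseSign] using h
  have hre : ∀ (θ : Fin n → ℝ) (j : Fin 2), P (toComplexAngle θ) (Sum.inr j) (Sum.inr j)
      = starRingEnd ℂ (P (toComplexAngle θ) (Sum.inl j) (Sum.inl j)) := by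
    intro θ j
    have h := congrFun (congrFun ((mem_sp2_iff _).1 (hP θ)).2 (Sum.inr j)) (Sum.inr j)
    rw [realConj_apply] at h
    exact h.symm
  have hneg : ∀ j, fourierCoef (fun θ => P θ (Sum.inr j) (Sum.inr j)) 0
      = -fourierCoef (fun θ => P θ (Sum.inl j) (Sum.inl j)) 0 := fun j =>
    fourierCoef_neg (fun θ => hsym θ j) 0
  have hconj : ∀ j, fourierCoef (fun θ => P θ (Sum.inr j) (Sum.inr j)) 0
      = starRingEnd ℂ (fourierCoef (fun θ => P θ (Sum.inl j) (Sum.inl j)) 0) := fun j => by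
    have := fourierCoef_conj (f := fun θ => P θ (Sum.inl j) (Sum.inl j))
      (g := fun θ => P θ (Sum.inr j) (Sum.inr j)) (fun θ => hre θ j) 0
    rwa [neg_zero] at this
  have hmean : ∀ j, -Complex.I * (meanFreq P j : ℂ)
      = fourierCoef (fun θ => P θ (Sum.inl j) (Sum.inl j)) 0 := by
    intro j
    have h := (hconj j).symm.trans (hneg j)
    unfold meanFreq
    set c := fourierCoef (fun θ => P θ (Sum.inl j) (Sum.inl j)) 0
    have hre0 : c.re = 0 := by
      have := congrArg Complex.re h
      rw [Complex.conj_re, Complex.neg_re] at this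
      linarith
    apply Complex.ext <;> simp [hre0]
  rcases k with j | j
  · simpa [normalMatrix, eigenFreq] using hmean j
  · rw [hneg, ← hmean]
    simp [normalMatrix, eigenFreq]

theorem abs_meanFreq_le {n : ℕ} {s M : ℝ} {P : (Fin n → ℂ) → PhaseMatrix} (hP : TorusHolo s M P)
    (hs : 0 < s) (j : Fin 2) : |meanFreq P j| ≤ M := by
  have h := norm_fourierCoef_le (hP.entry (Sum.inl j) (Sum.inl j)) le_rfl hs 0
  rw [neg_zero, zero_mul, Real.exp_zero, mul_one] at h
  refine (Complex.abs_re_le_norm _).trans ?_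
  rwa [norm_mul, Complex.norm_I, one_mul]

theorem meanFreq_sub {n : ℕ} {s M s' M' : ℝ} {P Q : (Fin n → ℂ) → PhaseMatrix}
    (hP : TorusHolo s M P) (hQ : TorusHolo s' M' Q) (hs : 0 < s) (hs' : 0 < s') (j : Fin 2) :
    meanFreq (fun θ => P θ - Q θ) j = meanFreq P j - meanFreq Q j := by
  unfold meanFreq
  rw [← Complex.sub_re, ← mul_sub, ← fourierCoef_sub (hP.entry _ _) (hQ.entry _ _) hs hs']
  rfl

theorem LipFamily.abs_meanFreq_sub_le {n : ℕ} {E : Set (Fin n → ℝ)} {s M : ℝ}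
    {P : (Fin n → ℝ) → (Fin n → ℂ) → PhaseMatrix} (hP : LipFamily E s M P) (hs : 0 < s)
    {ω ω' : Fin n → ℝ} (hω : ω ∈ E) (hω' : ω' ∈ E) (j : Fin 2) :
    |meanFreq (P ω) j - meanFreq (P ω') j| ≤ M * ‖ω - ω'‖ := by
  rw [← meanFreq_sub (hP.holo ω hω) (hP.holo ω' hω') hs hs]
  refine abs_meanFreq_le (s := s) ⟨(hP.holo ω hω).diff.sub (hP.holo ω' hω').diff,
        fun θ hθ i => ?_, fun θ hθ => hP.lip ω hω ω' hω' θ hθ⟩ hs j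
  simp only [Pi.sub_apply]
  rw [(hP.holo ω hω).periodic θ hθ i, (hP.holo ω' hω').periodic θ hθ i]

/-- The small divisor `m·ω + λ_k - λ_l`. -/
noncomputable def smallDivisor {n : ℕ} (a : Fin 2 → ℝ) (ω : Fin n → ℝ) (k l : Fin 2 ⊕ Fin 2)
    (m : Fin n → ℤ) : ℝ := ∑ i, (m i : ℝ) * ω i + (eigenFreq a k - eigenFreq a l)

/-- The modes removed by the normal form. -/
def resonantModes (n : ℕ) (k l : Fin 2 ⊕ Fin 2) : Set (Fin n → ℤ) := {m | m = 0 ∧ k = l}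

/-- The solution of the homological equation `2(∂_ω B + [B, D]) = -(P - ⟨P⟩)`. -/
noncomputable def homologicalMatrix {n : ℕ} (a : Fin 2 → ℝ) (ω : Fin n → ℝ)
    (P : (Fin n → ℂ) → PhaseMatrix) (θ : Fin n → ℂ) : PhaseMatrix :=
  Matrix.of fun k l => ∑' m, homologicalCoef (resonantModes n k l) (smallDivisor a ω k l)
    (fun θ => P θ k l) m * mode m θ

theorem homologicalMatrix_mem_sp2 {n : ℕ} (a : Fin 2 → ℝ) (ω : Fin n → ℝ)
    {P : (Fin n → ℂ) → PhaseMatrix} (hP : ∀ θ : Fin n → ℝ, P (toComplexAngle θ) ∈ sp2)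
    (θ : Fin n → ℝ) : homologicalMatrix a ω P (toComplexAngle θ) ∈ sp2 := by
  have hswap : ∀ k l : Fin 2 ⊕ Fin 2, k.swap = l.swap ↔ k = l := fun k l =>
    ⟨fun e => by simpa using congrArg Sum.swap e, fun e => by rw [e]⟩
  rw [mem_sp2_iff]
  constructor
  · ext k l
    rw [sympAdj_apply]
    simp only [homologicalMatrix, Matrix.of_apply, Matrix.neg_apply]
    rw [← tsum_mul_left, ← tsum_neg]
    refine tsum_congr fun m => ?_
    have hd : smallDivisor a ω l.swap k.swap m = smallDivisor a ω k l m := by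
      simp only [smallDivisor, eigenFreq_swap]; ring
    have hc : (phaseSign k * phaseSign l : ℝ) * fourierCoef (fun θ => P θ l.swap k.swap) m
        = -fourierCoef (fun θ => P θ k l) m := by
      have h : ∀ θ : Fin n → ℝ, P (toComplexAngle θ) l.swap k.swap
          = ((phaseSign k * phaseSign l : ℝ) : ℂ) * -P (toComplexAngle θ) k l := by
        intro θ
        have h := congrFun (congrFun ((mem_sp2_iff _).1 (hP θ)).1 k) l
        rw [sympAdj_apply, Matrix.neg_apply] at h
        rw [← h, ← mul_assoc, ← Complex.ofReal_mul, mul_mul_mul_comm, phaseSign_mul_self,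
          phaseSign_mul_self, mul_one, Complex.ofReal_one, one_mul]
      have h2 : fourierCoef (fun θ => P θ l.swap k.swap) m
          = ((phaseSign k * phaseSign l : ℝ) : ℂ) * -fourierCoef (fun θ => P θ k l) m := by
        unfold fourierCoef torusAvg
        rw [← integral_neg, ← integral_const_mul]
        simp only [h]
        exact integral_congr_ae (Eventually.of_forall fun x => by simp only; ring)
      rw [h2, ← mul_assoc, ← Complex.ofReal_mul, mul_mul_mul_comm, phaseSign_mul_self,
        phaseSign_mul_self, mul_one, Complex.ofReal_one, one_mul]
    have hmem : m ∈ resonantModes n l.swap k.swap ↔ m ∈ resonantModes n k l := by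
      simp only [resonantModes, Set.mem_ofPred_eq, hswap, eq_comm]
    unfold homologicalCoef
    rw [hd]
    by_cases h : m ∈ resonantModes n k l
    · simp [h, hmem]
    · simp only [h, hmem, if_false]
      linear_combination (-((smallDivisor a ω k l m)⁻¹ : ℝ) * (2 * Complex.I)⁻¹ *
        mode m (toComplexAngle θ)) * hc
  · ext k l
    rw [realConj_apply]
    simp only [homologicalMatrix, Matrix.of_apply]
    rw [Complex.conj_tsum, ← (Equiv.neg (Fin n → ℤ)).tsum_eq]
    refine tsum_congr fun m => ?_
    simp only [Equiv.neg_apply]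
    have hd : smallDivisor a ω k.swap l.swap (-m) = -smallDivisor a ω k l m := by
      simp only [smallDivisor, eigenFreq_swap, Pi.neg_apply, Int.cast_neg, neg_mul,
        Finset.sum_neg_distrib]; ring
    have hc : starRingEnd ℂ (fourierCoef (fun θ => P θ k.swap l.swap) (-m))
        = fourierCoef (fun θ => P θ k l) m := by
      have h := fourierCoef_conj (f := fun θ => P θ k.swap l.swap) (g := fun θ => P θ k l)
        (fun θ => ?_) (-m)
      · rw [← h, neg_neg]
      · have h := congrFun (congrFun ((mem_sp2_iff _).1 (hP θ)).2 k) l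
        rw [realConj_apply] at h
        exact h.symm
    have hmem : -m ∈ resonantModes n k.swap l.swap ↔ m ∈ resonantModes n k l := by
      simp only [resonantModes, Set.mem_ofPred_eq, hswap, neg_eq_zero]
    unfold homologicalCoef
    rw [hd, map_mul, conj_mode, neg_neg]
    congr 1
    by_cases h : m ∈ resonantModes n k l
    · simp [h, hmem]
    · simp only [h, hmem, if_false]
      rw [map_mul, map_mul, map_neg, hc, Complex.conj_ofReal]
      simp only [map_inv₀, map_mul, Complex.conj_I, map_ofNat, inv_neg, Complex.ofReal_neg,
        mul_neg, neg_mul, neg_neg]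

/-! ### One step of the normal form procedure -/

theorem hasDerivAt_cayley {B : ℝ → PhaseMatrix} {dB : PhaseMatrix} {t : ℝ}
    (hB : HasDerivAt B dB t) (h1 : IsUnit (1 - B t)) :
    HasDerivAt (fun t => cayley (B t))
      (Ring.inverse (1 - B t) * (dB + dB) * Ring.inverse (1 - B t)) t := by
  have c1 := Ring.inverse_mul_cancel _ h1
  have c1' := Ring.mul_inverse_cancel _ h1
  have hinv : HasDerivAt (fun t => Ring.inverse (1 - B t))
      (Ring.inverse (1 - B t) * dB * Ring.inverse (1 - B t)) t := by
    obtain ⟨u, hu⟩ := h1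
    have h2 : HasFDerivAt (Ring.inverse : PhaseMatrix → PhaseMatrix)
        (-(ContinuousLinearMap.mulLeftRight ℝ PhaseMatrix) ↑u⁻¹ ↑u⁻¹) (1 - B t) := by
      rw [← hu]; exact hasFDerivAt_ringInverse u
    have h3 := h2.comp_hasDerivAt t (hB.const_sub 1)
    refine h3.congr_deriv ?_
    rw [← hu, Ring.inverse_unit]
    simp
  have h := hinv.mul (hB.const_add 1)
  refine h.congr_deriv ?_
  set R := Ring.inverse (1 - B t)
  have e : R * dB = R * dB * ((1 - B t) * R) := by rw [c1', mul_one]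
  have comm : R * (1 + B t) = (1 + B t) * R := by
    have : (1 - B t) * (1 + B t) = (1 + B t) * (1 - B t) := by noncomm_ring
    calc R * (1 + B t) = R * (1 + B t) * ((1 - B t) * R) := by rw [c1', mul_one]
      _ = R * ((1 + B t) * (1 - B t)) * R := by noncomm_ring
      _ = (R * (1 - B t)) * ((1 + B t) * R) := by rw [← this]; noncomm_ring
      _ = (1 + B t) * R := by rw [c1, one_mul]
  rw [mul_assoc _ R, comm]
  nth_rewrite 2 [e]
  noncomm_ring

/-- Bounds on the small divisors and on their dependence on the frequency. -/
structure DivisorBounds {n : ℕ} (E : Set (Fin n → ℝ)) (a : (Fin n → ℝ) → Fin 2 → ℝ)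
    (δ G : ℝ) : Prop where
  ne_zero : ∀ ω ∈ E, ∀ k l, ∀ m ∉ resonantModes n k l, smallDivisor (a ω) ω k l m ≠ 0
  bound : ∀ ω ∈ E, ∀ k l, ∀ m ∉ resonantModes n k l,
    |(smallDivisor (a ω) ω k l m)⁻¹| ≤ G * Real.exp (3 * δ * intNorm m)
  lip : ∀ ω ∈ E, ∀ ω' ∈ E, ∀ k l, ∀ m ∉ resonantModes n k l,
    |(smallDivisor (a ω) ω k l m)⁻¹ - (smallDivisor (a ω') ω' k l m)⁻¹|
      ≤ G * ‖ω - ω'‖ * Real.exp (3 * δ * intNorm m)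

section

variable {n : ℕ} {E : Set (Fin n → ℝ)} {a : (Fin n → ℝ) → Fin 2 → ℝ}
  {P : (Fin n → ℝ) → (Fin n → ℂ) → PhaseMatrix} {s δ p G : ℝ}

theorem lipFamily_homologicalMatrix (hP : LipFamily E s p P) (hd : DivisorBounds E a δ G)
    (hδ : 0 < δ) (hδ1 : δ ≤ 1) (hs : 5 * δ < s) (hG : 0 ≤ G) :
    LipFamily E (s - 5 * δ) (4 * (p * G * (3 / δ) ^ n))
      fun ω => homologicalMatrix (a ω) ω (P ω) := by
  refine lipFamily_of_entries fun k l => ?_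
  exact lipFamily_homological (Z := resonantModes n k l)
    (d := fun ω => smallDivisor (a ω) ω k l) (hP.entry k l) hδ hδ1 hs hG
    (fun ω hω m hm => hd.bound ω hω k l m hm)
    (fun ω hω ω' hω' m hm => hd.lip ω hω ω' hω' k l m hm)

theorem hasDerivAt_homologicalMatrix (hP : LipFamily E s p P) (hd : DivisorBounds E a δ G)
    (hδ : 0 < δ) (hs : 5 * δ < s) (hG : 0 ≤ G) {ω : Fin n → ℝ} (hω : ω ∈ E)
    (hsp : ∀ θ : Fin n → ℝ, P ω (toComplexAngle θ) ∈ sp2) (t : ℝ) :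
    ∃ dB : PhaseMatrix,
      HasDerivAt (fun t : ℝ => homologicalMatrix (a ω) ω (P ω) (toComplexAngle (t • ω))) dB t ∧
      dB + dB
        + (homologicalMatrix (a ω) ω (P ω) (toComplexAngle (t • ω)) * normalMatrix (a ω)
          - normalMatrix (a ω) * homologicalMatrix (a ω) ω (P ω) (toComplexAngle (t • ω)))
        + (homologicalMatrix (a ω) ω (P ω) (toComplexAngle (t • ω)) * normalMatrix (a ω)
          - normalMatrix (a ω) * homologicalMatrix (a ω) ω (P ω) (toComplexAngle (t • ω)))
        = -(P ω (toComplexAngle (t • ω)) - normalMatrix (meanFreq (P ω))) := by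
  have key : ∀ k l, ∃ D : ℂ, HasDerivAt (fun t : ℝ =>
      homologicalMatrix (a ω) ω (P ω) (toComplexAngle (t • ω)) k l) D t ∧
      2 * (D + Complex.I * ((eigenFreq (a ω) k - eigenFreq (a ω) l : ℝ) : ℂ) *
        homologicalMatrix (a ω) ω (P ω) (toComplexAngle (t • ω)) k l)
      = -(P ω (toComplexAngle (t • ω)) k l - normalMatrix (meanFreq (P ω)) k l) := by
    intro k l
    refine hasDerivAt_homological (Z := resonantModes n k l) ((hP.holo ω hω).entry k l) hP.nonneg
      hδ hs hG (fun m hm => hm.1) (fun m hm => hd.bound ω hω k l m hm)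
      (fun m hm => hd.ne_zero ω hω k l m hm) (κ := normalMatrix (meanFreq (P ω)) k l)
      (fun h => ?_) (fun h => ?_) t
    · obtain ⟨-, rfl⟩ := h
      exact normalMatrix_meanFreq_apply hsp k
    · have : k ≠ l := fun e => h ⟨rfl, e⟩
      exact Matrix.diagonal_apply_ne _ this
  choose D hD1 hD2 using key
  refine ⟨Matrix.of D, hasDerivAt_of_entries hD1, ?_⟩
  ext k l
  have h := hD2 k l
  simp only [Matrix.add_apply, Matrix.sub_apply, Matrix.neg_apply, Matrix.of_apply]
  rw [← h]
  simp only [normalMatrix, Matrix.mul_diagonal, Matrix.diagonal_mul]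
  push_cast
  ring

/-- The perturbation after one step. -/
noncomputable def stepPert (a : (Fin n → ℝ) → Fin 2 → ℝ)
    (P : (Fin n → ℝ) → (Fin n → ℂ) → PhaseMatrix) (ω : Fin n → ℝ) (θ : Fin n → ℂ) : PhaseMatrix :=
  cayleyRemainder (homologicalMatrix (a ω) ω (P ω) θ) (P ω θ) (normalMatrix (meanFreq (P ω)))

/-- The frequencies after one step. -/
noncomputable def stepFreq (a : (Fin n → ℝ) → Fin 2 → ℝ)
    (P : (Fin n → ℝ) → (Fin n → ℂ) → PhaseMatrix) (ω : Fin n → ℝ) : Fin 2 → ℝ :=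
  a ω + meanFreq (P ω)

theorem lipFamily_mean (hP : LipFamily E s p P) (hs : 0 < s) (t : ℝ) :
    LipFamily E t p fun ω _ => normalMatrix (meanFreq (P ω)) := by
  refine LipFamily.const hP.nonneg
    (fun ω hω => norm_normalMatrix_le (abs_meanFreq_le (hP.holo ω hω) hs))
    (fun ω hω ω' hω' => ?_)
  rw [← normalMatrix_sub]
  exact norm_normalMatrix_le fun j => hP.abs_meanFreq_sub_le hs hω hω' j

theorem lipFamily_stepPert {b : ℝ} (hP : LipFamily E s p P)
    (hB : LipFamily E (s - 5 * δ) b fun ω => homologicalMatrix (a ω) ω (P ω))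
    (hδ : 0 < δ) (hs : 5 * δ < s) (hb : b ≤ 1 / 4) :
    LipFamily E (s - 5 * δ) (160 * b * p) (stepPert a P) :=
  hB.cayleyRemainder (hP.mono subset_rfl (by linarith) le_rfl)
    (lipFamily_mean hP (by linarith) _) hb

theorem stepPert_mem_sp2 {b : ℝ} {ω : Fin n → ℝ} {t : ℝ} (ht : 0 < t)
    (hB : TorusHolo t b (homologicalMatrix (a ω) ω (P ω))) (hb : b ≤ 1 / 4)
    (hsp : ∀ θ : Fin n → ℝ, P ω (toComplexAngle θ) ∈ sp2) (θ : Fin n → ℝ) :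
    stepPert a P ω (toComplexAngle θ) ∈ sp2 := by
  have h := (hB.bound _ (toComplexAngle_mem_openStrip ht θ)).trans hb
  exact cayleyRemainder_mem_sp2 (homologicalMatrix_mem_sp2 _ _ hsp θ) (hsp θ)
    (normalMatrix_mem_sp2 _) (isUnit_one_sub_of_norm_le h) (isUnit_one_add_of_norm_le h)

theorem hasDerivAt_stepCayley {b : ℝ} (hP : LipFamily E s p P) (hd : DivisorBounds E a δ G)
    (hB : LipFamily E (s - 5 * δ) b fun ω => homologicalMatrix (a ω) ω (P ω))
    (hδ : 0 < δ) (hs : 5 * δ < s) (hG : 0 ≤ G) (hb : b ≤ 1 / 4) {ω : Fin n → ℝ} (hω : ω ∈ E)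
    (hsp : ∀ θ : Fin n → ℝ, P ω (toComplexAngle θ) ∈ sp2) (t : ℝ) :
    HasDerivAt (fun t : ℝ => cayley (homologicalMatrix (a ω) ω (P ω) (toComplexAngle (t • ω))))
      ((normalMatrix (stepFreq a P ω) + stepPert a P ω (toComplexAngle (t • ω)))
          * cayley (homologicalMatrix (a ω) ω (P ω) (toComplexAngle (t • ω)))
        - cayley (homologicalMatrix (a ω) ω (P ω) (toComplexAngle (t • ω)))
          * (normalMatrix (a ω) + P ω (toComplexAngle (t • ω)))) t := by
  obtain ⟨dB, h1, h2⟩ := hasDerivAt_homologicalMatrix hP hd hδ hs hG hω hsp t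
  have h := ((hB.holo ω hω).bound _
    (toComplexAngle_mem_openStrip (by linarith) (t • ω))).trans hb
  have u1 := isUnit_one_sub_of_norm_le h
  have u2 := isUnit_one_add_of_norm_le h
  refine (hasDerivAt_cayley h1 u1).congr_deriv ?_
  rw [eq_sub_iff_add_eq, cayley_conjugates u1 u2 h2, stepFreq, normalMatrix_add]
  rfl

end

/-! ### Small divisors -/

theorem abs_inv_le_of_le {d r : ℝ} (hr : 0 < r) (h : r ≤ |d|) : |d⁻¹| ≤ r⁻¹ := by
  rw [abs_inv]; exact inv_anti₀ hr h

theorem abs_inv_sub_inv_le {d d' r x : ℝ} (hr : 0 < r) (h : r ≤ |d|) (h' : r ≤ |d'|)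
    (hx : |d - d'| ≤ x) : |d⁻¹ - d'⁻¹| ≤ x * (r⁻¹ * r⁻¹) := by
  have h0 : d ≠ 0 := abs_pos.1 (hr.trans_le h)
  have h0' : d' ≠ 0 := abs_pos.1 (hr.trans_le h')
  have e : d⁻¹ - d'⁻¹ = (d' - d) * (d⁻¹ * d'⁻¹) := by field_simp
  rw [e, abs_mul, abs_mul, abs_sub_comm]
  exact mul_le_mul hx (mul_le_mul (abs_inv_le_of_le hr h) (abs_inv_le_of_le hr h') (abs_nonneg _)
    (inv_pos.2 hr).le) (by positivity) ((abs_nonneg _).trans hx)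

theorem abs_smallDivisor_sub_le {n : ℕ} {a a' : Fin 2 → ℝ} {ω ω' : Fin n → ℝ} {L : ℝ}
    (h : ∀ j, |a j - a' j| ≤ L) (k l : Fin 2 ⊕ Fin 2) (m : Fin n → ℤ) :
    |smallDivisor a ω k l m - smallDivisor a' ω' k l m| ≤ intNorm m * ‖ω - ω'‖ + 2 * L := by
  have e : smallDivisor a ω k l m - smallDivisor a' ω' k l m
      = ∑ i, (m i : ℝ) * (ω - ω') i + (eigenFreq (a - a') k + -eigenFreq (a - a') l) := by
    simp only [smallDivisor, eigenFreq_sub, Pi.sub_apply, mul_sub, Finset.sum_sub_distrib]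
    ring
  have h1 := abs_dot_le m (v := ω - ω') fun i => norm_le_pi_norm (ω - ω') i
  have h2 := abs_eigenFreq_le (a := a - a') h k
  have h3 := abs_eigenFreq_le (a := a - a') h l
  rw [e]
  refine (abs_add_le _ _).trans ?_
  have h4 := abs_add_le (eigenFreq (a - a') k) (-eigenFreq (a - a') l)
  rw [abs_neg] at h4
  linarith

theorem divisorBounds_of_nonresonant {n : ℕ} {E : Set (Fin n → ℝ)}
    {a : (Fin n → ℝ) → Fin 2 → ℝ} {Λ c e κ δ : ℝ} (hΛ : 0 ≤ Λ) (hc : 0 < c) (hc1 : c ≤ 1)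
    (he : 0 < e) (he1 : e ≤ 1) (hκ : 0 < κ) (hκ1 : κ ≤ 1) (hδ : 0 < δ) (hδ1 : δ ≤ 1)
    (hlip : ∀ ω ∈ E, ∀ ω' ∈ E, ∀ j, |a ω j - a ω' j| ≤ Λ * e ^ 2 * ‖ω - ω'‖)
    (hzero : ∀ ω ∈ E, ∀ k l, k ≠ l → c * e ^ 2 ≤ |eigenFreq (a ω) k - eigenFreq (a ω) l|)
    (hres : ∀ ω ∈ E, ∀ k l, ∀ m : Fin n → ℤ, m ≠ 0 →
      e * κ * Real.exp (-δ * intNorm m) ≤ |smallDivisor (a ω) ω k l m|) :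
    DivisorBounds E a δ ((1 + 2 * Λ) * (c⁻¹ * c⁻¹) * (κ⁻¹ * κ⁻¹) * δ⁻¹ * (e ^ 2)⁻¹) := by
  have hci : 1 ≤ c⁻¹ := (one_le_inv₀ hc).2 hc1
  have hκi : 1 ≤ κ⁻¹ := (one_le_inv₀ hκ).2 hκ1
  have hδi : 1 ≤ δ⁻¹ := (one_le_inv₀ hδ).2 hδ1
  have hei : 1 ≤ e⁻¹ := (one_le_inv₀ he).2 he1
  have he2 : e ^ 2 ≤ 1 := pow_le_one₀ he.le he1
  have hcc : 1 ≤ c⁻¹ * c⁻¹ := one_le_mul_of_one_le_of_one_le hci hci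
  have hκκ : 1 ≤ κ⁻¹ * κ⁻¹ := one_le_mul_of_one_le_of_one_le hκi hκi
  have hΛ1 : 1 ≤ 1 + 2 * Λ := by linarith
  have hzero' : ∀ ω ∈ E, ∀ k l, ∀ m ∉ resonantModes n k l, m = 0 →
      c * e ^ 2 ≤ |smallDivisor (a ω) ω k l m| := by
    intro ω hω k l m hm h0
    have hkl : k ≠ l := fun h => hm ⟨h0, h⟩
    have := hzero ω hω k l hkl
    simpa [smallDivisor, h0] using this
  refine ⟨fun ω hω k l m hm => ?_, fun ω hω k l m hm => ?_, fun ω hω ω' hω' k l m hm => ?_⟩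
  · by_cases h0 : m = 0
    · exact abs_pos.1 (lt_of_lt_of_le (by positivity) (hzero' ω hω k l m hm h0))
    · exact abs_pos.1 (lt_of_lt_of_le (by positivity) (hres ω hω k l m h0))
  · by_cases h0 : m = 0
    · refine (abs_inv_le_of_le (by positivity) (hzero' ω hω k l m hm h0)).trans ?_
      rw [h0, intNorm_zero, mul_zero, Real.exp_zero, mul_one, mul_inv]
      refine mul_le_mul_of_nonneg_right ?_ (by positivity)
      calc c⁻¹ = 1 * (1 * c⁻¹) * (1 * 1) * 1 := by ring
        _ ≤ _ := by gcongr
    · refine (abs_inv_le_of_le (by positivity) (hres ω hω k l m h0)).trans ?_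
      rw [mul_inv, mul_inv, ← Real.exp_neg]
      have h1 : Real.exp (-(-δ * intNorm m)) ≤ Real.exp (3 * δ * intNorm m) := by
        rw [Real.exp_le_exp]
        nlinarith [mul_nonneg hδ.le (intNorm_nonneg m)]
      have h2 : e⁻¹ ≤ (e ^ 2)⁻¹ := by
        rw [pow_two, mul_inv]; exact le_mul_of_one_le_left (by positivity) hei
      refine mul_le_mul ?_ h1 (Real.exp_pos _).le (by positivity)
      calc e⁻¹ * κ⁻¹ = 1 * (1 * 1) * (1 * κ⁻¹) * 1 * e⁻¹ := by ring
        _ ≤ _ := by gcongr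
  · have hdiff := abs_smallDivisor_sub_le (ω := ω) (ω' := ω') (fun j => hlip ω hω ω' hω' j) k l m
    by_cases h0 : m = 0
    · refine (abs_inv_sub_inv_le (by positivity) (hzero' ω hω k l m hm h0)
        (hzero' ω' hω' k l m hm h0) hdiff).trans ?_
      rw [h0, intNorm_zero, zero_mul, mul_zero, Real.exp_zero, mul_one, zero_add]
      have e1 : 2 * (Λ * e ^ 2 * ‖ω - ω'‖) * ((c * e ^ 2)⁻¹ * (c * e ^ 2)⁻¹)
          = (2 * Λ) * (c⁻¹ * c⁻¹) * (1 * 1) * 1 * (e ^ 2)⁻¹ * ‖ω - ω'‖ := by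
        field_simp
      rw [e1]
      gcongr
      linarith
    · refine (abs_inv_sub_inv_le (by positivity) (hres ω hω k l m h0)
        (hres ω' hω' k l m h0) hdiff).trans ?_
      have h1 := intNorm_le_exp hδ m
      have h2 : 1 ≤ δ⁻¹ * Real.exp (δ * intNorm m) :=
        one_le_mul_of_one_le_of_one_le hδi
          (Real.one_le_exp (mul_nonneg hδ.le (intNorm_nonneg m)))
      have h3 : intNorm m * ‖ω - ω'‖ + 2 * (Λ * e ^ 2 * ‖ω - ω'‖)
          ≤ (1 + 2 * Λ) * (δ⁻¹ * Real.exp (δ * intNorm m)) * ‖ω - ω'‖ := by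
        have h4 : Λ * e ^ 2 ≤ Λ * (δ⁻¹ * Real.exp (δ * intNorm m)) :=
          mul_le_mul_of_nonneg_left (he2.trans h2) hΛ
        have h5 : intNorm m + 2 * (Λ * e ^ 2)
            ≤ (1 + 2 * Λ) * (δ⁻¹ * Real.exp (δ * intNorm m)) := by linarith
        have := mul_le_mul_of_nonneg_right h5 (norm_nonneg (ω - ω'))
        linarith
      refine (mul_le_mul_of_nonneg_right h3 (by positivity)).trans ?_
      have e1 : Real.exp (3 * δ * intNorm m) = Real.exp (δ * intNorm m) *
          (Real.exp (-(-δ * intNorm m)) * Real.exp (-(-δ * intNorm m))) := by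
        rw [← Real.exp_add, ← Real.exp_add]; congr 1; ring
      rw [e1, mul_inv, mul_inv, ← Real.exp_neg]
      have e2 : (1 + 2 * Λ) * (δ⁻¹ * Real.exp (δ * intNorm m)) * ‖ω - ω'‖ *
          (e⁻¹ * κ⁻¹ * Real.exp (-(-δ * intNorm m)) * (e⁻¹ * κ⁻¹ * Real.exp (-(-δ * intNorm m))))
          = ((1 + 2 * Λ) * (1 * 1) * (κ⁻¹ * κ⁻¹) * δ⁻¹ * (e ^ 2)⁻¹) * ‖ω - ω'‖ *
            (Real.exp (δ * intNorm m) *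
          (Real.exp (-(-δ * intNorm m)) * Real.exp (-(-δ * intNorm m)))) := by
        rw [pow_two, mul_inv]; ring
      rw [e2]
      gcongr

theorem eigenFreq_gap {a : Fin 2 → ℝ} {c e : ℝ} (hc : 0 < c) (he1 : e ^ 2 ≤ 1)
    (h0 : c / 2 ≤ |a 0|) (h1 : c / 2 * e ^ 2 ≤ |a 1|) (h1' : |a 1| ≤ c / 4)
    {k l : Fin 2 ⊕ Fin 2} (hkl : k ≠ l) :
    c / 4 * e ^ 2 ≤ |eigenFreq a k - eigenFreq a l| := by
  have he0 : 0 ≤ e ^ 2 := sq_nonneg e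
  have b0 : c / 4 * e ^ 2 ≤ c / 4 := mul_le_of_le_one_right (by linarith) he1
  have p1 : c / 4 ≤ |a 0 - a 1| := by linarith [abs_sub_abs_le_abs_sub (a 0) (a 1)]
  have p2 : c / 4 ≤ |a 0 + a 1| := by
    have := abs_sub_abs_le_abs_sub (a 0) (-a 1)
    rw [abs_neg, sub_neg_eq_add] at this
    linarith
  have p3 : c / 4 * e ^ 2 ≤ |2 * a 0| := by
    rw [abs_mul, abs_two]; linarith
  have p4 : c / 4 * e ^ 2 ≤ |2 * a 1| := by
    rw [abs_mul, abs_two]; nlinarith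
  have q1 := b0.trans p1
  have q2 := b0.trans p2
  have tr : ∀ {x y : ℝ}, c / 4 * e ^ 2 ≤ |y| → x = y ∨ x = -y → c / 4 * e ^ 2 ≤ |x| := by
    rintro x y h (rfl | rfl)
    · exact h
    · rwa [abs_neg]
  rcases k with k | k <;> rcases l with l | l <;> fin_cases k <;> fin_cases l <;>
    first
    | exact absurd rfl hkl
    | (simp only [eigenFreq, Sum.elim_inl, Sum.elim_inr, Pi.neg_apply, Fin.zero_eta, Fin.mk_one,
        Fin.isValue]
       first
       | exact tr q1 (Or.inl (by ring1))
       | exact tr q1 (Or.inr (by ring1))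
       | exact tr q2 (Or.inl (by ring1))
       | exact tr q2 (Or.inr (by ring1))
       | exact tr p3 (Or.inl (by ring1))
       | exact tr p3 (Or.inr (by ring1))
       | exact tr p4 (Or.inl (by ring1))
       | exact tr p4 (Or.inr (by ring1)))

/-! ### Measure of the resonant frequencies -/

theorem norm_sub_le_of_update {n : ℕ} {m : Fin n → ℤ} {i : Fin n} (hi : m i ≠ 0)
    (hmax : ∀ j, |(m j : ℝ)| ≤ |(m i : ℝ)|) {x y : Fin n → ℝ} {u : ℝ} (hu : |u| ≤ 1 / 2 * ‖x‖)
    (hy : ∀ j, j ≠ i → y j = x j) (hyi : y i = ∑ j, (m j : ℝ) * x j + u) :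
    ‖x‖ ≤ 2 * n * ‖y‖ := by
  have hn : (1 : ℝ) ≤ n := by exact_mod_cast Nat.one_le_iff_ne_zero.2 (fun h => by
    subst h; exact i.elim0)
  have hmi : (1 : ℝ) ≤ |(m i : ℝ)| := by exact_mod_cast Int.one_le_abs hi
  have hyn : ∀ j, |y j| ≤ ‖y‖ := fun j => norm_le_pi_norm y j
  have hy0 : 0 ≤ ‖y‖ := norm_nonneg y
  have hx0 : 0 ≤ ‖x‖ := norm_nonneg x
  have hi' : |x i| ≤ n * ‖y‖ + 1 / 2 * ‖x‖ := by
    have e : (m i : ℝ) * x i = y i - ∑ j ∈ Finset.univ.erase i, (m j : ℝ) * x j - u := by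
      rw [hyi, ← Finset.add_sum_erase Finset.univ _ (Finset.mem_univ i)]; ring
    have h1 : |∑ j ∈ Finset.univ.erase i, (m j : ℝ) * x j| ≤ (n - 1) * (|(m i : ℝ)| * ‖y‖) := by
      refine (Finset.abs_sum_le_sum_abs _ _).trans ?_
      refine (Finset.sum_le_card_nsmul _ _ (|(m i : ℝ)| * ‖y‖) fun j hj => ?_).trans ?_
      · rw [abs_mul, ← hy j (Finset.ne_of_mem_erase hj)]
        exact mul_le_mul (hmax j) (hyn j) (abs_nonneg _) (abs_nonneg _)
      · rw [Finset.card_erase_of_mem (Finset.mem_univ i), Finset.card_univ, Fintype.card_fin,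
          nsmul_eq_mul, Nat.cast_sub (by exact_mod_cast hn), Nat.cast_one]
    have h2 : |(m i : ℝ)| * |x i| ≤ ‖y‖ + (n - 1) * (|(m i : ℝ)| * ‖y‖) + 1 / 2 * ‖x‖ := by
      rw [← abs_mul, e]
      have t1 := abs_sub (y i - ∑ j ∈ Finset.univ.erase i, (m j : ℝ) * x j) u
      have t2 := abs_sub (y i) (∑ j ∈ Finset.univ.erase i, (m j : ℝ) * x j)
      linarith [hyn i]
    have h3 : |(m i : ℝ)| * |x i| ≤ |(m i : ℝ)| * (n * ‖y‖ + 1 / 2 * ‖x‖) := by nlinarith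
    exact le_of_mul_le_mul_left h3 (by linarith)
  have hall : ‖x‖ ≤ n * ‖y‖ + 1 / 2 * ‖x‖ := by
    refine (pi_norm_le_iff_of_nonneg (by positivity)).2 fun j => ?_
    by_cases h : j = i
    · rw [h]; exact hi'
    · rw [← hy j h]
      have := hyn j
      rw [Real.norm_eq_abs]
      nlinarith
  linarith

theorem volume_resonant_le {n : ℕ} {S : Set (Fin n → ℝ)} (hS : S ⊆ freqCube n) {m : Fin n → ℤ}
    (hm : m ≠ 0) {h : (Fin n → ℝ) → ℝ}
    (hlip : ∀ ω ∈ S, ∀ ω' ∈ S, |h ω - h ω'| ≤ 1 / 2 * ‖ω - ω'‖) {r : ℝ}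
    (hsmall : ∀ ω ∈ S, |∑ i, (m i : ℝ) * ω i + h ω| < r) :
    volume S ≤ ENNReal.ofReal ((2 * n) ^ n * (2 * Real.pi) ^ n * 2 * r) := by
  obtain ⟨i₀, hi₀⟩ := Function.ne_iff.1 hm
  obtain ⟨i, -, hmax⟩ := Finset.exists_max_image Finset.univ (fun j => |(m j : ℝ)|)
    ⟨i₀, Finset.mem_univ _⟩
  have hi : m i ≠ 0 := by
    intro h0
    have := hmax i₀ (Finset.mem_univ _)
    rw [h0, Int.cast_zero, abs_zero] at this
    exact hi₀ (by exact_mod_cast abs_nonpos_iff.1 this)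
  set g : (Fin n → ℝ) → ℝ := fun ω => ∑ j, (m j : ℝ) * ω j + h ω with hg
  set F : (Fin n → ℝ) → (Fin n → ℝ) := fun ω => Function.update ω i (g ω) with hF
  have hanti : ∀ ω ∈ S, ∀ ω' ∈ S, ‖ω - ω'‖ ≤ 2 * n * ‖F ω - F ω'‖ := by
    intro ω hω ω' hω'
    refine norm_sub_le_of_update hi (fun j => hmax j (Finset.mem_univ _)) (hlip ω hω ω' hω')
      (fun j hj => ?_) ?_
    · simp [hF, hj]
    · simp only [hF, hg, Pi.sub_apply, Function.update_self, mul_sub, Finset.sum_sub_distrib]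
      ring
  have hinj : Set.InjOn F S := by
    intro ω hω ω' hω' e
    have := hanti ω hω ω' hω'
    rw [e, sub_self, norm_zero, mul_zero] at this
    exact sub_eq_zero.1 (norm_le_zero_iff.1 this)
  set I := Function.invFunOn F S
  have hI : ∀ ω ∈ S, I (F ω) = ω := fun ω hω => hinj.leftInvOn_invFunOn hω
  have hlipI : LipschitzOnWith (2 * n : NNReal) I (F '' S) := by
    refine LipschitzOnWith.of_dist_le_mul ?_
    rintro _ ⟨ω, hω, rfl⟩ _ ⟨ω', hω', rfl⟩
    rw [hI ω hω, hI ω' hω', dist_eq_norm, dist_eq_norm]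
    simpa using hanti ω hω ω' hω'
  have himg : I '' (F '' S) = S := by
    rw [Set.image_image]
    exact (Set.image_congr hI).trans (Set.image_id' S)
  have hbox : F '' S ⊆ Set.univ.pi
      (Function.update (fun _ => Set.Ioc 0 (2 * Real.pi)) i (Set.Ioo (-r) r)) := by
    rintro _ ⟨ω, hω, rfl⟩ j -
    by_cases hj : j = i
    · subst hj
      simp only [hF, Function.update_self]
      exact abs_lt.1 (hsmall ω hω)
    · simp only [hF, Function.update_of_ne hj]
      exact hS hω j (Set.mem_univ _)
  have h2π : 1 ≤ 2 * Real.pi := by linarith [Real.two_le_pi]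
  have hvol : volume (F '' S) ≤ ENNReal.ofReal ((2 * Real.pi) ^ n * (2 * r)) := by
    refine (measure_mono hbox).trans ?_
    rw [volume_pi_pi, ← Finset.mul_prod_erase Finset.univ _ (Finset.mem_univ i),
      Function.update_self, Real.volume_Ioo, mul_comm, ENNReal.ofReal_mul (by positivity)]
    refine mul_le_mul' ?_ (ENNReal.ofReal_le_ofReal (by linarith))
    rw [Finset.prod_congr rfl (g := fun _ => ENNReal.ofReal (2 * Real.pi))]
    · rw [Finset.prod_const, ← ENNReal.ofReal_pow (by positivity)]
      refine ENNReal.ofReal_le_ofReal (pow_le_pow_right₀ h2π ?_)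
      refine (Finset.card_le_univ _).trans ?_
      simp
    · intro j hj
      rw [Function.update_of_ne (Finset.ne_of_mem_erase hj), Real.volume_Ioc, sub_zero]
  have hH := hlipI.hausdorffMeasure_image_le (d := (Fintype.card (Fin n) : ℝ)) (by positivity)
  rw [himg, hausdorffMeasure_pi_real] at hH
  refine hH.trans ?_
  have e1 : ((2 * n : NNReal) : ENNReal) ^ (Fintype.card (Fin n) : ℝ)
      = ENNReal.ofReal ((2 * n) ^ n) := by
    rw [ENNReal.rpow_natCast, Fintype.card_fin, ENNReal.ofReal_pow (by positivity)]
    congr 1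
    rw [ENNReal.ofReal, Real.toNNReal_of_nonneg (by positivity)]
    congr 1
  rw [e1]
  refine (mul_le_mul_right hvol _).trans ?_
  rw [← ENNReal.ofReal_mul (by positivity)]
  refine ENNReal.ofReal_le_ofReal (le_of_eq ?_)
  ring

/-! ### The iteration -/

section

variable {n : ℕ}

/-- The frequencies and the perturbations produced by iterating the normal form step. -/
noncomputable def kamSeq (ν : (Fin n → ℝ) → Fin 2 → ℝ)
    (P : (Fin n → ℝ) → (Fin n → ℂ) → PhaseMatrix) :
    ℕ → ((Fin n → ℝ) → Fin 2 → ℝ) × ((Fin n → ℝ) → (Fin n → ℂ) → PhaseMatrix)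
  | 0 => (ν, P)
  | j + 1 => (stepFreq (kamSeq ν P j).1 (kamSeq ν P j).2, stepPert (kamSeq ν P j).1 (kamSeq ν P j).2)

/-- The generators of the successive changes of coordinates. -/
noncomputable def kamGen (ν : (Fin n → ℝ) → Fin 2 → ℝ)
    (P : (Fin n → ℝ) → (Fin n → ℂ) → PhaseMatrix) (j : ℕ) (ω : Fin n → ℝ) (θ : Fin n → ℂ) :
    PhaseMatrix :=
  homologicalMatrix ((kamSeq ν P j).1 ω) ω ((kamSeq ν P j).2 ω) θ

/-- The width lost at the `j`-th step. -/
noncomputable def kamWidth (δ : ℝ) (j : ℕ) : ℝ := δ * (1 / 2) ^ j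

/-- The lower bound imposed on the small divisor of index `m` at the `j`-th step. -/
noncomputable def kamThreshold (e δ : ℝ) (j : ℕ) (m : Fin n → ℤ) : ℝ :=
  e * (1 / 2) ^ ((n + 1) * j) * Real.exp (-kamWidth δ j * intNorm m)

/-- The frequencies that are nonresonant up to the `j`-th step. -/
def kamGoodSet (ν : (Fin n → ℝ) → Fin 2 → ℝ) (P : (Fin n → ℝ) → (Fin n → ℂ) → PhaseMatrix)
    (e δ : ℝ) (j : ℕ) : Set (Fin n → ℝ) :=
  {ω | ω ∈ freqCube n ∧ ∀ i < j, ∀ k l, ∀ m : Fin n → ℤ, m ≠ 0 →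
    kamThreshold e δ i m ≤ |smallDivisor ((kamSeq ν P i).1 ω) ω k l m|}

/-- The constant of the estimate of the generators. -/
noncomputable def kamConst (n : ℕ) (K c δ : ℝ) : ℝ :=
  4 * (1 + 2 * (K + 1)) * ((c / 4)⁻¹ * (c / 4)⁻¹) * (3 ^ n * (δ⁻¹) ^ (n + 1))

/-- The inverse of the rate of decay of the perturbations. -/
noncomputable def kamRate (n : ℕ) : ℝ := 2 * 8 ^ (n + 1)

/-- The hypotheses under which the iteration converges. -/
structure KamSetup (ν : (Fin n → ℝ) → Fin 2 → ℝ) (P : (Fin n → ℝ) → (Fin n → ℂ) → PhaseMatrix)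
    (s δ c K e p : ℝ) : Prop where
  s_pos : 0 < s
  δ_pos : 0 < δ
  δ_le : δ ≤ 1
  c_pos : 0 < c
  c_le : c ≤ 1
  K_nonneg : 0 ≤ K
  e_pos : 0 < e
  e_le : e ≤ 1
  first : ∀ ω ∈ freqCube n, c ≤ |ν ω 0|
  second : ∀ ω ∈ freqCube n, c * e ^ 2 ≤ |ν ω 1|
  second_le : ∀ ω ∈ freqCube n, |ν ω 1| ≤ K * e ^ 2
  lip : ∀ ω ∈ freqCube n, ∀ ω' ∈ freqCube n, ∀ j, |ν ω j - ν ω' j| ≤ K * e ^ 2 * ‖ω - ω'‖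
  pert : LipFamily (freqCube n) (s + 10 * δ) p P
  sp : ∀ ω ∈ freqCube n, ∀ θ : Fin n → ℝ, P ω (toComplexAngle θ) ∈ sp2
  small_freq : 4 * p ≤ c * e ^ 2
  small_param : (K + 1) * e ^ 2 ≤ c / 4
  small_pert : 160 * kamConst n K c δ * kamRate n * p ≤ e ^ 2

theorem kamGoodSet_zero (ν : (Fin n → ℝ) → Fin 2 → ℝ)
    (P : (Fin n → ℝ) → (Fin n → ℂ) → PhaseMatrix) (e δ : ℝ) :
    kamGoodSet ν P e δ 0 = freqCube n := by
  ext ω; simp [kamGoodSet]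

theorem kamGoodSet_anti (ν : (Fin n → ℝ) → Fin 2 → ℝ)
    (P : (Fin n → ℝ) → (Fin n → ℂ) → PhaseMatrix) (e δ : ℝ) {i j : ℕ} (h : i ≤ j) :
    kamGoodSet ν P e δ j ⊆ kamGoodSet ν P e δ i :=
  fun _ hω => ⟨hω.1, fun i' hi' => hω.2 i' (hi'.trans_le h)⟩

theorem one_le_kamRate (n : ℕ) : 16 ≤ kamRate n := by
  have : (8 : ℝ) ^ 1 ≤ 8 ^ (n + 1) := pow_le_pow_right₀ (by norm_num) (by omega)
  unfold kamRate; linarith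

theorem kamRate_inv_le (n : ℕ) : (kamRate n)⁻¹ ≤ 1 / 2 := by
  rw [one_div]
  exact inv_anti₀ (by norm_num) (by linarith [one_le_kamRate n])

variable {ν : (Fin n → ℝ) → Fin 2 → ℝ} {P : (Fin n → ℝ) → (Fin n → ℂ) → PhaseMatrix}
  {s δ c K e p : ℝ}

theorem KamSetup.kamConst_pos (H : KamSetup ν P s δ c K e p) : 0 < kamConst n K c δ := by
  have := H.c_pos; have := H.δ_pos; have := H.K_nonneg
  unfold kamConst; positivity

/-- The bound of the first generator. -/
noncomputable def kamGenBound (n : ℕ) (K c δ e p : ℝ) : ℝ := kamConst n K c δ * p / e ^ 2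

theorem KamSetup.genBound_nonneg (H : KamSetup ν P s δ c K e p) :
    0 ≤ kamGenBound n K c δ e p := by
  have := H.kamConst_pos; have := H.pert.nonneg; have := H.e_pos
  unfold kamGenBound; positivity

theorem KamSetup.genBound_le (H : KamSetup ν P s δ c K e p) :
    160 * kamGenBound n K c δ e p * kamRate n ≤ 1 := by
  have he : 0 < e ^ 2 := pow_pos H.e_pos 2
  have e1 : 160 * kamGenBound n K c δ e p * kamRate n
      = (160 * kamConst n K c δ * kamRate n * p) / e ^ 2 := by
    unfold kamGenBound; ring
  rw [e1, div_le_one he]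
  exact H.small_pert

theorem KamSetup.genBound_le' (H : KamSetup ν P s δ c K e p) :
    kamGenBound n K c δ e p ≤ 1 / 100 := by
  have h1 := H.genBound_le
  have h2 := one_le_kamRate n
  have h3 := H.genBound_nonneg
  nlinarith

/-- The properties of the `j`-th frequencies and perturbation. -/
structure KamInvariant (ν : (Fin n → ℝ) → Fin 2 → ℝ)
    (P : (Fin n → ℝ) → (Fin n → ℂ) → PhaseMatrix) (s δ K e p : ℝ) (j : ℕ) : Prop where
  pert : LipFamily (kamGoodSet ν P e δ j) (s + 10 * kamWidth δ j) (p * (kamRate n)⁻¹ ^ j)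
    (kamSeq ν P j).2
  sp : ∀ ω ∈ kamGoodSet ν P e δ j, ∀ θ : Fin n → ℝ, (kamSeq ν P j).2 ω (toComplexAngle θ) ∈ sp2
  near : ∀ ω ∈ kamGoodSet ν P e δ j, ∀ i,
    |(kamSeq ν P j).1 ω i - ν ω i| ≤ 2 * p * (1 - (1 / 2) ^ j)
  lip : ∀ ω ∈ kamGoodSet ν P e δ j, ∀ ω' ∈ kamGoodSet ν P e δ j, ∀ i,
    |(kamSeq ν P j).1 ω i - (kamSeq ν P j).1 ω' i|
      ≤ (K * e ^ 2 + 2 * p * (1 - (1 / 2) ^ j)) * ‖ω - ω'‖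

theorem KamInvariant.lip' {j : ℕ} (H : KamSetup ν P s δ c K e p)
    (hI : KamInvariant ν P s δ K e p j) : ∀ ω ∈ kamGoodSet ν P e δ j,
    ∀ ω' ∈ kamGoodSet ν P e δ j, ∀ i,
    |(kamSeq ν P j).1 ω i - (kamSeq ν P j).1 ω' i| ≤ (K + 1) * e ^ 2 * ‖ω - ω'‖ := by
  intro ω hω ω' hω' i
  refine (hI.lip ω hω ω' hω' i).trans (mul_le_mul_of_nonneg_right ?_ (norm_nonneg _))
  have h1 := H.small_freq
  have h2 : c * e ^ 2 ≤ 1 * e ^ 2 := mul_le_mul_of_nonneg_right H.c_le (sq_nonneg e)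
  have h3 := H.pert.nonneg
  have h4 : 0 ≤ p * (1 / 2 : ℝ) ^ j := by positivity
  linarith

theorem KamInvariant.near' {j : ℕ} (H : KamSetup ν P s δ c K e p)
    (hI : KamInvariant ν P s δ K e p j) {ω : Fin n → ℝ} (hω : ω ∈ kamGoodSet ν P e δ j)
    (i : Fin 2) : |(kamSeq ν P j).1 ω i - ν ω i| ≤ c / 2 * e ^ 2 := by
  refine (hI.near ω hω i).trans ?_
  have h1 := H.small_freq
  have h4 : 0 ≤ p * (1 / 2 : ℝ) ^ j := mul_nonneg H.pert.nonneg (by positivity)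
  linarith

theorem KamSetup.divisorBounds (H : KamSetup ν P s δ c K e p) {j : ℕ}
    (hI : KamInvariant ν P s δ K e p j) :
    DivisorBounds (kamGoodSet ν P e δ (j + 1)) (kamSeq ν P j).1 (kamWidth δ j)
      ((1 + 2 * (K + 1)) * ((c / 4)⁻¹ * (c / 4)⁻¹) *
        (((1 / 2 : ℝ) ^ ((n + 1) * j))⁻¹ * ((1 / 2 : ℝ) ^ ((n + 1) * j))⁻¹) * (kamWidth δ j)⁻¹ *
        (e ^ 2)⁻¹) := by
  have hsub := kamGoodSet_anti ν P e δ (Nat.le_succ j)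
  have hc := H.c_pos
  have he2 : e ^ 2 ≤ 1 := pow_le_one₀ H.e_pos.le H.e_le
  refine divisorBounds_of_nonresonant (by linarith [H.K_nonneg]) (by linarith)
    (by linarith [H.c_le]) H.e_pos H.e_le (by positivity) (pow_le_one₀ (by norm_num) (by norm_num))
    (mul_pos H.δ_pos (by positivity)) ?_ (fun ω hω ω' hω' i => hI.lip' H ω (hsub hω) ω' (hsub hω') i)
    (fun ω hω k l hkl => ?_) (fun ω hω k l m hm => hω.2 j (Nat.lt_succ_self j) k l m hm)
  · exact mul_le_one₀ H.δ_le (by positivity) (pow_le_one₀ (by norm_num) (by norm_num))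
  · have h0 := hI.near' H (hsub hω) 0
    have h1 := hI.near' H (hsub hω) 1
    have f0 := H.first ω hω.1
    have f1 := H.second ω hω.1
    have f2 := H.second_le ω hω.1
    have t0 := abs_sub_abs_le_abs_sub (ν ω 0) ((kamSeq ν P j).1 ω 0)
    have t1 := abs_sub_abs_le_abs_sub (ν ω 1) ((kamSeq ν P j).1 ω 1)
    have t2 := abs_sub_abs_le_abs_sub ((kamSeq ν P j).1 ω 1) (ν ω 1)
    rw [abs_sub_comm] at t0 t1
    have hce : c / 2 * e ^ 2 ≤ c / 2 := by nlinarith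
    have hce' : c / 2 * e ^ 2 ≤ 1 * e ^ 2 :=
      mul_le_mul_of_nonneg_right (by linarith [H.c_le]) (sq_nonneg e)
    have hs := H.small_param
    refine eigenFreq_gap hc he2 ?_ ?_ ?_ hkl <;> linarith

theorem kamWidth_pos (hδ : 0 < δ) (j : ℕ) : 0 < kamWidth δ j := mul_pos hδ (by positivity)

theorem KamSetup.width_lt (H : KamSetup ν P s δ c K e p) (j : ℕ) :
    5 * kamWidth δ j < s + 10 * kamWidth δ j := by
  linarith [H.s_pos, kamWidth_pos H.δ_pos j]

theorem width_succ (s δ : ℝ) (j : ℕ) :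
    s + 10 * kamWidth δ j - 5 * kamWidth δ j = s + 10 * kamWidth δ (j + 1) := by
  unfold kamWidth; rw [pow_succ]; ring

theorem KamSetup.lipFamily_kamGen (H : KamSetup ν P s δ c K e p) {j : ℕ}
    (hI : KamInvariant ν P s δ K e p j) :
    LipFamily (kamGoodSet ν P e δ (j + 1)) (s + 10 * kamWidth δ j - 5 * kamWidth δ j)
      (kamGenBound n K c δ e p * (1 / 2) ^ j) (kamGen ν P j) := by
  have hc := H.c_pos
  have hδ := H.δ_pos
  have hK := H.K_nonneg
  have hw := kamWidth_pos hδ j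
  have h := lipFamily_homologicalMatrix
    (hI.pert.mono (kamGoodSet_anti ν P e δ (Nat.le_succ j)) le_rfl le_rfl) (H.divisorBounds hI)
    hw (mul_le_one₀ H.δ_le (by positivity) (pow_le_one₀ (by norm_num) (by norm_num)))
    (H.width_lt j) (by positivity)
  refine h.mono subset_rfl le_rfl (le_of_eq ?_)
  have he : e ≠ 0 := H.e_pos.ne'
  have hx : (0 : ℝ) < (1 / 2) ^ j := by positivity
  have e1 : (1 / 2 : ℝ) ^ ((n + 1) * j) = ((1 / 2) ^ j) ^ (n + 1) := by rw [mul_comm, pow_mul]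
  have e2 : (kamRate n)⁻¹ ^ j = (1 / 2) ^ j * (((1 / 2) ^ j) ^ 3) ^ (n + 1) := by
    unfold kamRate
    rw [mul_inv, mul_pow, ← one_div, ← pow_mul (1 / 2 : ℝ) j 3, mul_comm j 3, pow_mul (1 / 2 : ℝ) 3 j,
      ← inv_pow, ← pow_mul, mul_comm (n + 1) j, pow_mul]
    norm_num
  unfold kamGenBound kamConst
  rw [e1, e2, kamWidth]
  generalize (1 / 2 : ℝ) ^ j = x at hx
  rw [div_pow, mul_pow, inv_pow δ]
  field_simp
  ring

theorem KamSetup.invariant (H : KamSetup ν P s δ c K e p) (j : ℕ) :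
    KamInvariant ν P s δ K e p j := by
  induction j with
  | zero =>
    refine ⟨?_, ?_, ?_, ?_⟩
    · rw [kamGoodSet_zero]
      simpa [kamSeq, kamWidth] using H.pert
    · rw [kamGoodSet_zero]; exact H.sp
    · intro ω _ i; simp [kamSeq]
    · rw [kamGoodSet_zero]
      simpa [kamSeq] using H.lip
  | succ j hI =>
    have hB := H.lipFamily_kamGen hI
    have hsub := kamGoodSet_anti ν P e δ (Nat.le_succ j)
    have hP := hI.pert.mono hsub le_rfl le_rfl
    have hw := kamWidth_pos H.δ_pos j
    have hp := H.pert.nonneg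
    have hspos : 0 < s + 10 * kamWidth δ j := by linarith [H.s_pos]
    have hb : kamGenBound n K c δ e p * (1 / 2) ^ j ≤ 1 / 4 := by
      have h1 : (1 / 2 : ℝ) ^ j ≤ 1 := pow_le_one₀ (by norm_num) (by norm_num)
      have h2 := H.genBound_le'
      have h3 := mul_le_mul_of_nonneg_left h1 H.genBound_nonneg
      linarith
    have hpj : p * (kamRate n)⁻¹ ^ j ≤ p * (1 / 2) ^ j := by
      refine mul_le_mul_of_nonneg_left (pow_le_pow_left₀ ?_ (kamRate_inv_le n) j) hp
      exact inv_nonneg.2 (by linarith [one_le_kamRate n])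
    refine ⟨?_, fun ω hω θ => ?_, fun ω hω i => ?_, fun ω hω ω' hω' i => ?_⟩
    · have h := lipFamily_stepPert hP hB hw (H.width_lt j) hb
      rw [width_succ] at h
      refine h.mono subset_rfl le_rfl ?_
      have hr : 0 < kamRate n := by linarith [one_le_kamRate n]
      have h1 : (160 * kamGenBound n K c δ e p * kamRate n) * ((1 / 2) ^ j * (kamRate n)⁻¹) ≤
          1 * (1 * (kamRate n)⁻¹) := by
        refine mul_le_mul H.genBound_le (mul_le_mul_of_nonneg_right
          (pow_le_one₀ (by norm_num) (by norm_num)) (inv_pos.2 hr).le) (by positivity) zero_le_one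
      have h2 : 160 * (kamGenBound n K c δ e p * (1 / 2) ^ j) ≤ (kamRate n)⁻¹ := by
        have : (160 * kamGenBound n K c δ e p * kamRate n) * ((1 / 2) ^ j * (kamRate n)⁻¹)
            = 160 * (kamGenBound n K c δ e p * (1 / 2) ^ j) := by field_simp
        linarith
      have h3 : 0 ≤ p * (kamRate n)⁻¹ ^ j := by positivity
      calc 160 * (kamGenBound n K c δ e p * (1 / 2) ^ j) * (p * (kamRate n)⁻¹ ^ j)
          ≤ (kamRate n)⁻¹ * (p * (kamRate n)⁻¹ ^ j) := mul_le_mul_of_nonneg_right h2 h3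
        _ = p * (kamRate n)⁻¹ ^ (j + 1) := by rw [pow_succ]; ring
    · exact stepPert_mem_sp2 (by linarith [H.s_pos, H.width_lt j]) (hB.holo ω hω) hb
        (hI.sp ω (hsub hω)) θ
    · have h1 := hI.near ω (hsub hω) i
      have h2 := (abs_meanFreq_le (hP.holo ω hω) hspos i).trans hpj
      have h3 : (kamSeq ν P (j + 1)).1 ω i - ν ω i
          = ((kamSeq ν P j).1 ω i - ν ω i) + meanFreq ((kamSeq ν P j).2 ω) i := by
        simp only [kamSeq, stepFreq, Pi.add_apply]; ring
      rw [h3, pow_succ (1 / 2 : ℝ) j]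
      refine (abs_add_le _ _).trans ?_
      linarith
    · have h1 := hI.lip ω (hsub hω) ω' (hsub hω') i
      have h2 := (hP.abs_meanFreq_sub_le hspos hω hω' i).trans
        (mul_le_mul_of_nonneg_right hpj (norm_nonneg _))
      have h3 : (kamSeq ν P (j + 1)).1 ω i - (kamSeq ν P (j + 1)).1 ω' i
          = ((kamSeq ν P j).1 ω i - (kamSeq ν P j).1 ω' i)
            + (meanFreq ((kamSeq ν P j).2 ω) i - meanFreq ((kamSeq ν P j).2 ω') i) := by
        simp only [kamSeq, stepFreq, Pi.add_apply]; ring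
      rw [h3, pow_succ (1 / 2 : ℝ) j]
      refine (abs_add_le _ _).trans ?_
      linarith

/-! ### Measure of the excluded frequencies -/

theorem KamSetup.volume_step_le (H : KamSetup ν P s δ c K e p) (j : ℕ) :
    volume (kamGoodSet ν P e δ j \ kamGoodSet ν P e δ (j + 1)) ≤ ENNReal.ofReal
      (16 * ((2 * n) ^ n * (2 * Real.pi) ^ n * 2) * (3 / δ) ^ n * e * (1 / 2) ^ j) := by
  have hI := H.invariant j
  set A : ℝ := (2 * n) ^ n * (2 * Real.pi) ^ n * 2 with hA
  have hA0 : 0 ≤ A := by positivity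
  set bad : Fin 2 ⊕ Fin 2 → Fin 2 ⊕ Fin 2 → (Fin n → ℤ) → Set (Fin n → ℝ) := fun k l m =>
    {ω | m ≠ 0 ∧ ω ∈ kamGoodSet ν P e δ j ∧
      |smallDivisor ((kamSeq ν P j).1 ω) ω k l m| < kamThreshold e δ j m} with hbad
  have hcover : kamGoodSet ν P e δ j \ kamGoodSet ν P e δ (j + 1) ⊆ ⋃ k, ⋃ l, ⋃ m, bad k l m := by
    rintro ω ⟨hω, hω'⟩
    by_contra hcon
    refine hω' ⟨hω.1, fun i hi k l m hm => ?_⟩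
    rcases Nat.lt_succ_iff_lt_or_eq.1 hi with h | rfl
    · exact hω.2 i h k l m hm
    · by_contra hlt
      refine hcon (Set.mem_iUnion.2 ⟨k, Set.mem_iUnion.2 ⟨l, Set.mem_iUnion.2 ⟨m, hm, hω, ?_⟩⟩⟩)
      exact not_le.1 hlt
  have hone : ∀ k l m, volume (bad k l m) ≤ ENNReal.ofReal (A * kamThreshold e δ j m) := by
    intro k l m
    by_cases hm : m = 0
    · have : bad k l m = ∅ := by ext ω; simp [hbad, hm]
      rw [this, measure_empty]; exact zero_le
    · refine volume_resonant_le (fun ω hω => hω.2.1.1) hm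
        (h := fun ω => eigenFreq ((kamSeq ν P j).1 ω) k - eigenFreq ((kamSeq ν P j).1 ω) l)
        (fun ω hω ω' hω' => ?_) (fun ω hω => hω.2.2)
      have hl := hI.lip' H ω hω.2.1 ω' hω'.2.1
      have h1 := abs_eigenFreq_le (a := (kamSeq ν P j).1 ω - (kamSeq ν P j).1 ω') hl k
      have h2 := abs_eigenFreq_le (a := (kamSeq ν P j).1 ω - (kamSeq ν P j).1 ω') hl l
      rw [eigenFreq_sub] at h1 h2
      have e1 : ∀ a b c d : ℝ, a - b - (c - d) = (a - c) - (b - d) := fun a b c d => by ring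
      rw [e1]
      refine (abs_sub _ _).trans ?_
      have h3 : (K + 1) * e ^ 2 * ‖ω - ω'‖ ≤ 1 / 4 * ‖ω - ω'‖ :=
        mul_le_mul_of_nonneg_right (by linarith [H.small_param, H.c_le]) (norm_nonneg _)
      linarith
  have hw := kamWidth_pos H.δ_pos j
  have hw1 : kamWidth δ j ≤ 1 :=
    mul_le_one₀ H.δ_le (by positivity) (pow_le_one₀ (by norm_num) (by norm_num))
  have htsum : ∀ k l, volume (⋃ m, bad k l m)
      ≤ ENNReal.ofReal (A * (3 / δ) ^ n * e * (1 / 2) ^ j) := by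
    intro k l
    refine (measure_iUnion_le _).trans ((ENNReal.tsum_le_tsum (hone k l)).trans ?_)
    have hS : Summable fun m : Fin n → ℤ => A * kamThreshold e δ j m :=
      ((summable_exp_neg_intNorm hw).mul_left _).mul_left _
    have hnn : ∀ m : Fin n → ℤ, 0 ≤ A * kamThreshold e δ j m := fun m => by
      have := H.e_pos
      unfold kamThreshold; positivity
    rw [← ENNReal.ofReal_tsum_of_nonneg hnn hS]
    refine ENNReal.ofReal_le_ofReal ?_
    unfold kamThreshold
    rw [tsum_mul_left, tsum_mul_left]
    have h1 := tsum_exp_neg_intNorm_le (n := n) hw hw1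
    have he := H.e_pos
    have h2 : A * (e * (1 / 2) ^ ((n + 1) * j) *
        ∑' m : Fin n → ℤ, Real.exp (-kamWidth δ j * intNorm m))
        ≤ A * (e * (1 / 2) ^ ((n + 1) * j) * (3 / kamWidth δ j) ^ n) := by gcongr
    refine h2.trans (le_of_eq ?_)
    have hδ := H.δ_pos.ne'
    have e3 : (3 / kamWidth δ j) ^ n = (3 / δ) ^ n * (2 ^ j) ^ n := by
      unfold kamWidth
      rw [← mul_pow, one_div, inv_pow]
      congr 1
      field_simp
    have e4 : (1 / 2 : ℝ) ^ ((n + 1) * j) * (2 ^ j) ^ n = (1 / 2) ^ j := by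
      rw [add_mul, one_mul, pow_add, mul_comm n j, pow_mul, mul_right_comm, ← mul_pow, ← mul_pow]
      norm_num
    rw [e3, ← e4]; ring
  refine (measure_mono hcover).trans ?_
  refine (measure_iUnion_le _).trans ?_
  refine (ENNReal.tsum_le_tsum fun k => (measure_iUnion_le _).trans
    (ENNReal.tsum_le_tsum fun l => htsum k l)).trans ?_
  rw [tsum_fintype, tsum_fintype]
  simp only [Finset.sum_const, Finset.card_univ, Fintype.card_sum, Fintype.card_fin, nsmul_eq_mul]
  rw [← mul_assoc, ← Nat.cast_mul, ← ENNReal.ofReal_natCast, ← ENNReal.ofReal_mul (by positivity)]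
  refine ENNReal.ofReal_le_ofReal (le_of_eq ?_)
  push_cast
  ring

theorem KamSetup.volume_excluded_le (H : KamSetup ν P s δ c K e p) :
    volume (freqCube n \ ⋂ j, kamGoodSet ν P e δ j) ≤ ENNReal.ofReal
      (2 * (16 * ((2 * n) ^ n * (2 * Real.pi) ^ n * 2) * (3 / δ) ^ n) * e) := by
  have hcover : freqCube n \ ⋂ j, kamGoodSet ν P e δ j
      ⊆ ⋃ j, (kamGoodSet ν P e δ j \ kamGoodSet ν P e δ (j + 1)) := by
    rintro ω ⟨hω, hω'⟩
    by_contra hcon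
    refine hω' (Set.mem_iInter.2 fun j => ?_)
    induction j with
    | zero => rw [kamGoodSet_zero]; exact hω
    | succ j ih =>
      by_contra h
      exact hcon (Set.mem_iUnion.2 ⟨j, ih, h⟩)
  have he := H.e_pos
  have hδ := H.δ_pos
  refine (measure_mono hcover).trans ((measure_iUnion_le _).trans
    ((ENNReal.tsum_le_tsum H.volume_step_le).trans ?_))
  rw [← ENNReal.ofReal_tsum_of_nonneg (fun j => by positivity)
    ((summable_geometric_of_lt_one (by norm_num) (by norm_num)).mul_left _), tsum_mul_left,
    tsum_geometric_two]
  refine ENNReal.ofReal_le_ofReal (le_of_eq ?_)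
  ring

end

/-! ### Convergence of the iteration -/

section

variable {n : ℕ}

theorem norm_fourierCoef_sub_le {f g : (Fin n → ℂ) → ℂ} {r : ℝ}
    (hfp : IsTorusPeriodic fun θ : Fin n → ℝ => f (toComplexAngle θ))
    (hfc : Continuous fun θ : Fin n → ℝ => f (toComplexAngle θ))
    (hgp : IsTorusPeriodic fun θ : Fin n → ℝ => g (toComplexAngle θ))
    (hgc : Continuous fun θ : Fin n → ℝ => g (toComplexAngle θ))
    (h : ∀ θ : Fin n → ℝ, ‖f (toComplexAngle θ) - g (toComplexAngle θ)‖ ≤ r) (m : Fin n → ℤ) :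
    ‖fourierCoef f m - fourierCoef g m‖ ≤ r := by
  have hint : ∀ {u : (Fin n → ℂ) → ℂ},
      (IsTorusPeriodic fun θ : Fin n → ℝ => u (toComplexAngle θ)) →
      (Continuous fun θ : Fin n → ℝ => u (toComplexAngle θ)) →
      Integrable (fun x => mode (-m) (toComplexAngle (torusRep x)) * u (toComplexAngle (torusRep x)))
        (torusMeasure n) := by
    intro u hp hc
    refine IsTorusPeriodic.integrable
      (f := fun θ => mode (-m) (toComplexAngle θ) * u (toComplexAngle θ)) (fun θ i => ?_)
      (((differentiable_mode _).continuous.comp (continuous_toComplexAngle n)).mul hc)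
    have h1 := isTorusPeriodic_mode (-m) θ i
    have h2 := hp θ i
    simp only at h1 h2 ⊢
    rw [h1, h2]
  have e : fourierCoef f m - fourierCoef g m = torusAvg fun θ : Fin n → ℝ =>
      mode (-m) (toComplexAngle θ) * (f (toComplexAngle θ) - g (toComplexAngle θ)) := by
    unfold fourierCoef torusAvg
    rw [← integral_sub (hint hfp hfc) (hint hgp hgc)]
    simp only [mul_sub]
  rw [e]
  refine norm_torusAvg_le fun θ => ?_
  rw [norm_mul, norm_mode_toComplexAngle, one_mul]
  exact h θ

theorem tendsto_const_mul_half_pow (r : ℝ) :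
    Tendsto (fun N : ℕ => r * (1 / 2 : ℝ) ^ N) atTop (𝓝 0) := by
  simpa using (tendsto_pow_atTop_nhds_zero_of_lt_one (r := (1 / 2 : ℝ)) (by norm_num)
    (by norm_num)).const_mul r

theorem tendstoUniformly_of_geometric {α X : Type*} [SeminormedAddCommGroup X] {f : ℕ → α → X}
    {g : α → X} {r : ℝ} (h : ∀ N x, ‖f N x - g x‖ ≤ r * (1 / 2) ^ N) :
    TendstoUniformly f g atTop := by
  rw [Metric.tendstoUniformly_iff]
  intro ε hε
  filter_upwards [(tendsto_const_mul_half_pow r).eventually_lt_const hε] with N hN x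
  rw [dist_comm, dist_eq_norm]
  exact (h N x).trans_lt hN

/-- A uniform limit on the real torus of functions that are holomorphic and equibounded in a
strip is real analytic. -/
theorem analyticOnNhd_of_torusHolo {s M r : ℝ} {f : ℕ → (Fin n → ℂ) → ℂ} {g : (Fin n → ℝ) → ℂ}
    (hs : 0 < s) (hf : ∀ N, TorusHolo s M (f N))
    (h : ∀ N θ, ‖f N (toComplexAngle θ) - g θ‖ ≤ r * (1 / 2) ^ N) :
    AnalyticOnNhd ℝ g Set.univ := by
  have hu := tendstoUniformly_of_geometric h
  have hgc : Continuous g := hu.continuous (Frequently.of_forall fun N => (hf N).continuous hs)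
  have hgp : IsTorusPeriodic g := fun θ i => by
    refine tendsto_nhds_unique (hu.tendsto_at _) ?_
    refine (hu.tendsto_at θ).congr fun N => ?_
    exact ((hf N).isTorusPeriodic hs θ i).symm
  set G : (Fin n → ℂ) → ℂ := fun z => g fun i => (z i).re
  have hG : ∀ θ : Fin n → ℝ, G (toComplexAngle θ) = g θ := fun θ => by
    simp only [G, toComplexAngle, Complex.ofReal_re]
  have hGp : IsTorusPeriodic fun θ : Fin n → ℝ => G (toComplexAngle θ) := by
    simpa only [hG] using hgp
  have hGc : Continuous fun θ : Fin n → ℝ => G (toComplexAngle θ) := by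
    simpa only [hG] using hgc
  have hcoef : ∀ m, Tendsto (fun N => fourierCoef (f N) m) atTop (𝓝 (fourierCoef G m)) := by
    intro m
    rw [tendsto_iff_norm_sub_tendsto_zero]
    refine squeeze_zero (fun N => norm_nonneg _) (fun N => ?_) (tendsto_const_mul_half_pow r)
    refine norm_fourierCoef_sub_le ((hf N).isTorusPeriodic hs) ((hf N).continuous hs) hGp hGc
      (fun θ => ?_) m
    rw [hG]; exact h N θ
  have hbound : ∀ m, ‖fourierCoef G m‖ ≤ M * Real.exp (-(s / 2) * intNorm m) := fun m =>
    le_of_tendsto (hcoef m).norm (Eventually.of_forall fun N =>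
      norm_fourierCoef_le (hf N) (half_pos hs).le (half_lt_self hs) m)
  have hsum : Summable (fourierCoef G) := Summable.of_norm_bounded
    ((summable_exp_neg_intNorm (half_pos hs)).mul_left M) hbound
  have hsum' : Summable fun m => ‖fourierCoef G m‖ * Real.exp (s / 4 * intNorm m) := by
    refine Summable.of_nonneg_of_le (fun m => by positivity) (fun m => ?_)
      ((summable_exp_neg_intNorm (n := n) (show 0 < s / 4 by linarith)).mul_left M)
    refine (mul_le_mul_of_nonneg_right (hbound m) (Real.exp_pos _).le).trans (le_of_eq ?_)
    rw [mul_assoc, ← Real.exp_add]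
    congr 2
    ring
  have hg : g = (fun θ => ∑' m, fourierCoef G m * mode m θ) ∘ toComplexAngle := by
    funext θ
    rw [← hG]
    exact (hasSum_fourierCoef hGp hGc hsum θ).tsum_eq.symm
  rw [hg]
  intro θ _
  have hL : toComplexAngle (n := n)
      = ContinuousLinearMap.pi fun i => Complex.ofRealCLM.comp (ContinuousLinearMap.proj i) := rfl
  refine AnalyticAt.comp ?_ ?_
  · exact (analyticOnNhd_fourierSeries hsum' _
      (toComplexAngle_mem_openStrip (by linarith) θ)).restrictScalars
  · rw [hL]; exact ContinuousLinearMap.analyticAt _ _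

variable {ν : (Fin n → ℝ) → Fin 2 → ℝ} {P : (Fin n → ℝ) → (Fin n → ℂ) → PhaseMatrix}
  {s δ c K e p : ℝ}

/-- The composition of the first changes of coordinates. -/
noncomputable def kamFlow (ν : (Fin n → ℝ) → Fin 2 → ℝ)
    (P : (Fin n → ℝ) → (Fin n → ℂ) → PhaseMatrix) : ℕ → (Fin n → ℝ) → (Fin n → ℂ) → PhaseMatrix
  | 0 => fun _ _ => 1
  | j + 1 => fun ω θ => cayley (kamGen ν P j ω θ) * kamFlow ν P j ω θ

theorem KamSetup.torusHolo_kamGen (H : KamSetup ν P s δ c K e p) (j : ℕ) {ω : Fin n → ℝ}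
    (hω : ω ∈ ⋂ j, kamGoodSet ν P e δ j) :
    TorusHolo s (kamGenBound n K c δ e p * (1 / 2) ^ j) (kamGen ν P j ω) := by
  refine ((H.lipFamily_kamGen (H.invariant j)).holo ω (Set.mem_iInter.1 hω _)).mono ?_ le_rfl
  rw [width_succ]
  linarith [kamWidth_pos H.δ_pos (j + 1)]

theorem KamSetup.genBound_mul_pow_le (H : KamSetup ν P s δ c K e p) (j : ℕ) :
    kamGenBound n K c δ e p * (1 / 2) ^ j ≤ 1 / 4 := by
  have h1 : (1 / 2 : ℝ) ^ j ≤ 1 := pow_le_one₀ (by norm_num) (by norm_num)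
  have h2 := H.genBound_le'
  have h3 := mul_le_mul_of_nonneg_left h1 H.genBound_nonneg
  linarith

theorem KamSetup.norm_kamGen_le (H : KamSetup ν P s δ c K e p) (j : ℕ) {ω : Fin n → ℝ}
    (hω : ω ∈ ⋂ j, kamGoodSet ν P e δ j) {θ : Fin n → ℂ} (hθ : θ ∈ openStrip n s) :
    ‖kamGen ν P j ω θ‖ ≤ 1 / 4 :=
  ((H.torusHolo_kamGen j hω).bound θ hθ).trans (H.genBound_mul_pow_le j)

theorem KamSetup.norm_kamFlow_sub_one_le (H : KamSetup ν P s δ c K e p) (j : ℕ) {ω : Fin n → ℝ}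
    (hω : ω ∈ ⋂ j, kamGoodSet ν P e δ j) {θ : Fin n → ℂ} (hθ : θ ∈ openStrip n s) :
    ‖kamFlow ν P j ω θ‖ ≤ 2 ∧
      ‖kamFlow ν P j ω θ - 1‖ ≤ 12 * kamGenBound n K c δ e p * (1 - (1 / 2) ^ j) := by
  have hb := H.genBound_le'
  have hb0 := H.genBound_nonneg
  set b := kamGenBound n K c δ e p with hbdef
  have main : ∀ j, ‖kamFlow ν P j ω θ - 1‖ ≤ 12 * b * (1 - (1 / 2) ^ j) →
      ‖kamFlow ν P j ω θ‖ ≤ 2 := by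
    intro j h
    have h1 := norm_le_norm_add_norm_sub' (kamFlow ν P j ω θ) 1
    rw [norm_one] at h1
    have h2 : 0 ≤ b * (1 / 2 : ℝ) ^ j := by positivity
    linarith
  have hstep : ∀ j, ‖kamFlow ν P j ω θ - 1‖ ≤ 12 * b * (1 - (1 / 2) ^ j) := by
    intro j
    induction j with
    | zero => simp [kamFlow]
    | succ j ih =>
      have h2 := main j ih
      have h3 := (norm_cayley_sub_one_le (H.norm_kamGen_le j hω hθ)).trans
        (mul_le_mul_of_nonneg_left ((H.torusHolo_kamGen j hω).bound θ hθ) (by norm_num))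
      have e1 : kamFlow ν P (j + 1) ω θ - 1
          = (cayley (kamGen ν P j ω θ) - 1) * kamFlow ν P j ω θ + (kamFlow ν P j ω θ - 1) := by
        simp only [kamFlow]; noncomm_ring
      rw [e1]
      refine (norm_add_le_of_le (norm_mul_le_of_le h3 h2) ih).trans (le_of_eq ?_)
      rw [pow_succ (1 / 2 : ℝ) j]
      ring
  exact ⟨main j (hstep j), hstep j⟩

theorem KamSetup.norm_kamFlow_succ_sub_le (H : KamSetup ν P s δ c K e p) (j : ℕ) {ω : Fin n → ℝ}
    (hω : ω ∈ ⋂ j, kamGoodSet ν P e δ j) {θ : Fin n → ℂ} (hθ : θ ∈ openStrip n s) :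
    ‖kamFlow ν P (j + 1) ω θ - kamFlow ν P j ω θ‖
      ≤ 6 * kamGenBound n K c δ e p * (1 / 2) ^ j := by
  have h2 := (H.norm_kamFlow_sub_one_le j hω hθ).1
  have h3 := (norm_cayley_sub_one_le (H.norm_kamGen_le j hω hθ)).trans
    (mul_le_mul_of_nonneg_left ((H.torusHolo_kamGen j hω).bound θ hθ) (by norm_num))
  have e1 : kamFlow ν P (j + 1) ω θ - kamFlow ν P j ω θ
      = (cayley (kamGen ν P j ω θ) - 1) * kamFlow ν P j ω θ := by
    simp only [kamFlow]; noncomm_ring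
  rw [e1]
  exact (norm_mul_le_of_le h3 h2).trans (le_of_eq (by ring))

theorem KamSetup.torusHolo_kamFlow (H : KamSetup ν P s δ c K e p) (j : ℕ) {ω : Fin n → ℝ}
    (hω : ω ∈ ⋂ j, kamGoodSet ν P e δ j) : TorusHolo s 2 (kamFlow ν P j ω) := by
  suffices h : DifferentiableOn ℂ (kamFlow ν P j ω) (openStrip n s) ∧
      ∀ θ ∈ openStrip n s, ∀ i, kamFlow ν P j ω (θ + Pi.single i ((2 * Real.pi : ℝ) : ℂ))
        = kamFlow ν P j ω θ from
    ⟨h.1, h.2, fun θ hθ => (H.norm_kamFlow_sub_one_le j hω hθ).1⟩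
  induction j with
  | zero => exact ⟨differentiableOn_const _, fun _ _ _ => rfl⟩
  | succ j ih =>
    have hg := H.torusHolo_kamGen j hω
    refine ⟨?_, fun θ hθ i => ?_⟩
    · have h1 : DifferentiableOn ℂ (fun θ => Ring.inverse (1 - kamGen ν P j ω θ))
          (openStrip n s) := by
        have := LipFamily.inverse_one_sub (E := {ω}) (s := s)
          (b := kamGen ν P j) (M := kamGenBound n K c δ e p * (1 / 2) ^ j)
          ⟨mul_nonneg H.genBound_nonneg (by positivity), fun ω' h => by rw [h]; exact hg,
            fun ω' h ω'' h' θ _ => by simp [Set.mem_singleton_iff.1 h, Set.mem_singleton_iff.1 h']⟩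
          (H.genBound_mul_pow_le j)
        exact (this.holo ω rfl).diff
      exact (h1.mul ((differentiableOn_const 1).add hg.diff)).mul ih.1
    · simp only [kamFlow]
      rw [hg.periodic θ hθ i, ih.2 θ hθ i]

theorem KamSetup.isRealSymplectic_kamFlow (H : KamSetup ν P s δ c K e p) (j : ℕ) {ω : Fin n → ℝ}
    (hω : ω ∈ ⋂ j, kamGoodSet ν P e δ j) (θ : Fin n → ℝ) :
    IsRealSymplectic (kamFlow ν P j ω (toComplexAngle θ)) := by
  induction j with
  | zero => exact IsRealSymplectic.one
  | succ j ih =>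
    have hB := H.norm_kamGen_le j hω (toComplexAngle_mem_openStrip H.s_pos θ)
    refine (isRealSymplectic_cayley ?_ (isUnit_one_sub_of_norm_le hB)
      (isUnit_one_add_of_norm_le hB)).mul ih
    exact homologicalMatrix_mem_sp2 _ _ ((H.invariant j).sp ω (Set.mem_iInter.1 hω j)) θ

theorem KamSetup.hasDerivAt_kamFlow (H : KamSetup ν P s δ c K e p) (j : ℕ) {ω : Fin n → ℝ}
    (hω : ω ∈ ⋂ j, kamGoodSet ν P e δ j) (t : ℝ) :
    HasDerivAt (fun t : ℝ => kamFlow ν P j ω (toComplexAngle (t • ω)))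
      ((normalMatrix ((kamSeq ν P j).1 ω) + (kamSeq ν P j).2 ω (toComplexAngle (t • ω)))
          * kamFlow ν P j ω (toComplexAngle (t • ω))
        - kamFlow ν P j ω (toComplexAngle (t • ω))
          * (normalMatrix (ν ω) + P ω (toComplexAngle (t • ω)))) t := by
  induction j with
  | zero =>
    simp only [kamFlow, kamSeq, one_mul, mul_one, sub_self]
    exact hasDerivAt_const _ _
  | succ j ih =>
    have hI := H.invariant j
    have hmem := Set.mem_iInter.1 hω
    have hc := H.c_pos
    have hw := kamWidth_pos H.δ_pos j
    have hK := H.K_nonneg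
    have h := hasDerivAt_stepCayley
      (hI.pert.mono (kamGoodSet_anti ν P e δ (Nat.le_succ j)) le_rfl le_rfl) (H.divisorBounds hI)
      (H.lipFamily_kamGen hI) hw (H.width_lt j) (by positivity) (H.genBound_mul_pow_le j)
      (hmem (j + 1)) (hI.sp ω (hmem j)) t
    refine (h.mul ih).congr_deriv ?_
    simp only [kamFlow, kamSeq, kamGen]
    noncomm_ring

theorem KamSetup.abs_kamSeq_succ_sub_le (H : KamSetup ν P s δ c K e p) (j : ℕ) {ω : Fin n → ℝ}
    (hω : ω ∈ ⋂ j, kamGoodSet ν P e δ j) (i : Fin 2) :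
    |(kamSeq ν P (j + 1)).1 ω i - (kamSeq ν P j).1 ω i| ≤ p * (1 / 2) ^ j := by
  have h3 : (kamSeq ν P (j + 1)).1 ω i - (kamSeq ν P j).1 ω i
      = meanFreq ((kamSeq ν P j).2 ω) i := by
    simp only [kamSeq, stepFreq, Pi.add_apply]; ring
  rw [h3]
  refine (abs_meanFreq_le ((H.invariant j).pert.holo ω (Set.mem_iInter.1 hω j))
    (by linarith [H.s_pos, kamWidth_pos H.δ_pos j]) i).trans ?_
  exact mul_le_mul_of_nonneg_left (pow_le_pow_left₀
    (inv_nonneg.2 (by linarith [one_le_kamRate n])) (kamRate_inv_le n) j) H.pert.nonneg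

theorem KamSetup.norm_kamSeq_le (H : KamSetup ν P s δ c K e p) (j : ℕ) {ω : Fin n → ℝ}
    (hω : ω ∈ ⋂ j, kamGoodSet ν P e δ j) (θ : Fin n → ℝ) :
    ‖(kamSeq ν P j).2 ω (toComplexAngle θ)‖ ≤ p * (1 / 2) ^ j := by
  refine (((H.invariant j).pert.holo ω (Set.mem_iInter.1 hω j)).bound _
    (toComplexAngle_mem_openStrip (by linarith [H.s_pos, kamWidth_pos H.δ_pos j]) θ)).trans ?_
  exact mul_le_mul_of_nonneg_left (pow_le_pow_left₀
    (inv_nonneg.2 (by linarith [one_le_kamRate n])) (kamRate_inv_le n) j) H.pert.nonneg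

theorem KamSetup.exists_conjugation (H : KamSetup ν P s δ c K e p) {ω : Fin n → ℝ}
    (hω : ω ∈ ⋂ j, kamGoodSet ν P e δ j) :
    ∃ (Φ : (Fin n → ℝ) → PhaseMatrix) (ν' : Fin 2 → ℝ), IsTorusPeriodic Φ ∧
      (∀ θ, IsRealSymplectic (Φ θ)) ∧ (∀ θ, ‖Φ θ - 1‖ ≤ 12 * kamGenBound n K c δ e p) ∧
      (∀ k l, AnalyticOnNhd ℝ (fun θ => Φ θ k l) Set.univ) ∧
      (∀ i, |ν' i - ν ω i| ≤ 2 * p) ∧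
      ∀ t : ℝ, HasDerivAt (fun t : ℝ => Φ (t • ω))
        (normalMatrix ν' * Φ (t • ω)
          - Φ (t • ω) * (normalMatrix (ν ω) + P ω (toComplexAngle (t • ω)))) t := by
  set b := kamGenBound n K c δ e p with hb
  have hstrip := toComplexAngle_mem_openStrip (n := n) H.s_pos
  have hd : ∀ (θ : Fin n → ℝ) (j : ℕ), dist (kamFlow ν P j ω (toComplexAngle θ))
      (kamFlow ν P (j + 1) ω (toComplexAngle θ)) ≤ 6 * b * (1 / 2) ^ j := by
    intro θ j
    rw [dist_comm, dist_eq_norm]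
    exact H.norm_kamFlow_succ_sub_le j hω (hstrip θ)
  have hd' : ∀ (i : Fin 2) (j : ℕ), dist ((kamSeq ν P j).1 ω i)
      ((kamSeq ν P (j + 1)).1 ω i) ≤ p * (1 / 2) ^ j := by
    intro i j
    rw [dist_comm, Real.dist_eq]
    exact H.abs_kamSeq_succ_sub_le j hω i
  choose Φ hΦ using fun θ => cauchySeq_tendsto_of_complete
    (cauchySeq_of_le_geometric (1 / 2) (6 * b) (by norm_num) (hd θ))
  choose ν' hν' using fun i => cauchySeq_tendsto_of_complete
    (cauchySeq_of_le_geometric (1 / 2) p (by norm_num) (hd' i))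
  have hΦd : ∀ (N : ℕ) (θ : Fin n → ℝ),
      ‖kamFlow ν P N ω (toComplexAngle θ) - Φ θ‖ ≤ 12 * b * (1 / 2) ^ N := by
    intro N θ
    have h := dist_le_of_le_geometric_of_tendsto (1 / 2) (6 * b) (by norm_num) (hd θ) (hΦ θ) N
    rw [dist_eq_norm] at h
    exact h.trans (le_of_eq (by ring))
  have hνd : ∀ (N : ℕ) (i : Fin 2), |(kamSeq ν P N).1 ω i - ν' i| ≤ 2 * p * (1 / 2) ^ N := by
    intro N i
    have h := dist_le_of_le_geometric_of_tendsto (1 / 2) p (by norm_num) (hd' i) (hν' i) N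
    rw [Real.dist_eq] at h
    exact h.trans (le_of_eq (by ring))
  refine ⟨Φ, ν', fun θ i => ?_, fun θ => ?_, fun θ => ?_, fun k l => ?_, fun i => ?_, fun t => ?_⟩
  · refine tendsto_nhds_unique (hΦ _) ((hΦ θ).congr fun N => ?_)
    exact ((H.torusHolo_kamFlow N hω).isTorusPeriodic H.s_pos θ i).symm
  · exact isRealSymplectic_of_tendsto (hΦ θ) fun j => H.isRealSymplectic_kamFlow j hω θ
  · have h := hΦd 0 θ
    simp only [kamFlow, pow_zero, mul_one] at h
    rwa [norm_sub_rev]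
  · refine analyticOnNhd_of_torusHolo (r := 12 * b) H.s_pos
      (fun N => (H.torusHolo_kamFlow N hω).entry k l) fun N θ => ?_
    exact (norm_entry_le (kamFlow ν P N ω (toComplexAngle θ) - Φ θ) k l).trans (hΦd N θ)
  · have h := hνd 0 i
    simp only [kamSeq, pow_zero, mul_one] at h
    rwa [abs_sub_comm]
  · have hp := H.pert.nonneg
    have hb0 := H.genBound_nonneg
    rw [← hb] at hb0
    refine hasDerivAt_of_tendstoUniformly (l := atTop)
      (f := fun N t => kamFlow ν P N ω (toComplexAngle (t • ω)))
      (g' := fun t : ℝ => normalMatrix ν' * Φ (t • ω)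
          - Φ (t • ω) * (normalMatrix (ν ω) + P ω (toComplexAngle (t • ω)))) ?_
      (Eventually.of_forall fun N t => H.hasDerivAt_kamFlow N hω t)
      (fun t => hΦ (t • ω)) t
    refine tendstoUniformly_of_geometric (r := 6 * p + ‖normalMatrix ν'‖ * (12 * b)
      + (12 * b) * (‖normalMatrix (ν ω)‖ + p)) fun N t => ?_
    set θ := t • ω
    set F := kamFlow ν P N ω (toComplexAngle θ) with hF
    set D := normalMatrix ((kamSeq ν P N).1 ω)
    set Q := (kamSeq ν P N).2 ω (toComplexAngle θ)
    set M₀ := normalMatrix (ν ω) + P ω (toComplexAngle θ)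
    have h1 : ‖F - Φ θ‖ ≤ 12 * b * (1 / 2) ^ N := hΦd N θ
    have h2 : ‖F‖ ≤ 2 := (H.norm_kamFlow_sub_one_le N hω (hstrip θ)).1
    have h3 : ‖(D - normalMatrix ν') + Q‖ ≤ 2 * p * (1 / 2) ^ N + p * (1 / 2) ^ N := by
      refine norm_add_le_of_le ?_ (H.norm_kamSeq_le N hω θ)
      rw [← normalMatrix_sub]
      exact norm_normalMatrix_le (hνd N)
    have h4 : ‖M₀‖ ≤ ‖normalMatrix (ν ω)‖ + p := by
      refine norm_add_le_of_le le_rfl ?_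
      simpa [kamSeq] using H.norm_kamSeq_le 0 hω θ
    have e1 : (D + Q) * F - F * M₀ - (normalMatrix ν' * Φ θ - Φ θ * M₀)
        = ((D - normalMatrix ν') + Q) * F + normalMatrix ν' * (F - Φ θ)
          - (F - Φ θ) * M₀ := by noncomm_ring
    rw [e1]
    refine (norm_sub_le_of_le (norm_add_le_of_le (norm_mul_le_of_le h3 h2)
      (norm_mul_le_of_le le_rfl h1)) (norm_mul_le_of_le h1 h4)).trans (le_of_eq ?_)
    ring

end

/-! ### Logarithms of real symplectic matrices near the identity -/

theorem hasSum_exp_phaseMatrix (x : PhaseMatrix) :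
    HasSum (fun k : ℕ => ((k.factorial : ℝ)⁻¹) • x ^ k) (NormedSpace.exp x) := by
  have h := NormedSpace.exp_series_hasSum_exp' (𝕂 := ℂ) x
  have e : (fun k : ℕ => ((k.factorial : ℝ)⁻¹) • x ^ k)
      = fun k : ℕ => ((k.factorial : ℂ)⁻¹) • x ^ k := by
    funext k
    rw [← Complex.coe_smul, Complex.ofReal_inv, Complex.ofReal_natCast]
  rw [e]
  exact h

theorem map_exp_of_map_pow (f : PhaseMatrix →ₗ[ℝ] PhaseMatrix) (hf : Continuous f)
    {x : PhaseMatrix} (h : ∀ k : ℕ, f (x ^ k) = f x ^ k) :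
    f (NormedSpace.exp x) = NormedSpace.exp (f x) := by
  have h1 := (hasSum_exp_phaseMatrix x).map f hf
  refine h1.unique ?_
  convert hasSum_exp_phaseMatrix (f x) using 2 with k
  rw [Function.comp_apply, map_smul, h]

theorem sympAdj_exp (x : PhaseMatrix) :
    sympAdj (NormedSpace.exp x) = NormedSpace.exp (sympAdj x) := by
  refine map_exp_of_map_pow _ continuous_sympAdj fun k => ?_
  induction k with
  | zero => rw [pow_zero, pow_zero, sympAdj_one]
  | succ k ih => rw [pow_succ, sympAdj_mul, ih, pow_succ']

theorem realConj_exp (x : PhaseMatrix) :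
    realConj (NormedSpace.exp x) = NormedSpace.exp (realConj x) := by
  refine map_exp_of_map_pow _ continuous_realConj fun k => ?_
  induction k with
  | zero => rw [pow_zero, pow_zero, realConj_one]
  | succ k ih => rw [pow_succ, realConj_mul, ih, pow_succ]

theorem exists_log_isRealSymplectic : ∃ r : ℝ, 0 < r ∧ ∃ lg : PhaseMatrix → PhaseMatrix,
    ∀ y : PhaseMatrix, ‖y - 1‖ < r → AnalyticAt ℂ lg y ∧ NormedSpace.exp (lg y) = y ∧
      ‖lg y‖ ≤ 2 * ‖y - 1‖ ∧ (IsRealSymplectic y → lg y ∈ sp2) := by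
  have hd : HasStrictFDerivAt (NormedSpace.exp : PhaseMatrix → PhaseMatrix)
      (ContinuousLinearEquiv.refl ℂ PhaseMatrix : PhaseMatrix →L[ℂ] PhaseMatrix) 0 :=
    hasStrictFDerivAt_exp_zero
  have hcd : ContDiffAt ℂ ⊤ (NormedSpace.exp : PhaseMatrix → PhaseMatrix) 0 :=
    (NormedSpace.exp_analytic (𝕂 := ℂ) (0 : PhaseMatrix)).contDiffAt
  have h0 : NormedSpace.exp (0 : PhaseMatrix) = 1 := NormedSpace.exp_zero
  set lg : PhaseMatrix → PhaseMatrix := hd.localInverse _ _ _ with hlg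
  have hlg1 : lg 1 = 0 := by rw [← h0]; exact hd.localInverse_apply_image
  have han : AnalyticAt ℂ lg 1 := by
    have h := hcd.to_localInverse hd.hasFDerivAt (by simp)
    rw [h0] at h
    exact h.analyticAt
  have hright : ∀ᶠ y in 𝓝 (1 : PhaseMatrix), NormedSpace.exp (lg y) = y := by
    rw [← h0]; exact hd.eventually_right_inverse
  have hleft : ∀ᶠ x in 𝓝 (0 : PhaseMatrix), lg (NormedSpace.exp x) = x :=
    hd.eventually_left_inverse
  have hder : HasFDerivAt lg (ContinuousLinearMap.id ℂ PhaseMatrix) 1 := by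
    have h := hd.to_localInverse
    rw [h0] at h
    exact h.hasFDerivAt
  have hnorm : ∀ᶠ y in 𝓝 (1 : PhaseMatrix), ‖lg y‖ ≤ 2 * ‖y - 1‖ := by
    filter_upwards [hder.isLittleO.def one_pos] with y hy
    rw [hlg1, sub_zero, one_mul] at hy
    replace hy : ‖lg y - (y - 1)‖ ≤ ‖y - 1‖ := hy
    have := norm_le_norm_add_norm_sub' (lg y) (y - 1)
    linarith
  have hcont : Tendsto lg (𝓝 1) (𝓝 0) := by
    have := han.continuousAt.tendsto
    rwa [hlg1] at this
  have hr : Tendsto (fun x => realConj x) (𝓝 (0 : PhaseMatrix)) (𝓝 0) := by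
    simpa using continuous_realConj.tendsto 0
  have hs : Tendsto (fun x => -sympAdj x) (𝓝 (0 : PhaseMatrix)) (𝓝 0) := by
    simpa using (continuous_sympAdj.tendsto 0).neg
  have hall := han.eventually_analyticAt.and (hright.and (hnorm.and
    ((hcont.eventually (hr.eventually hleft)).and (hcont.eventually (hs.eventually hleft)))))
  obtain ⟨r, hr0, hr⟩ := Metric.eventually_nhds_iff.1 hall
  refine ⟨r, hr0, lg, fun y hy => ?_⟩
  obtain ⟨h1, h2, h3, h4, h5⟩ := hr (by rwa [dist_eq_norm])
  refine ⟨h1, h2, h3, fun hy => (mem_sp2_iff _).2 ⟨?_, ?_⟩⟩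
  · have e : NormedSpace.exp (-sympAdj (lg y)) = y := by
      rw [Matrix.exp_neg, ← sympAdj_exp, h2]
      exact Matrix.inv_eq_right_inv hy.left_inv
    rw [e] at h5
    rw [← neg_eq_iff_eq_neg]; exact h5.symm
  · rw [← realConj_exp, h2, hy.real] at h4
    exact h4.symm

/-! ### Quadratic Hamiltonians and their matrices -/

open MvPolynomial in
theorem eq_sum_of_isHomogeneous_one {σ R : Type*} [Fintype σ] [CommSemiring R]
    {g : MvPolynomial σ R} (hg : g.IsHomogeneous 1) :
    g = ∑ l, C (coeff (Finsupp.single l 1) g) * X l := by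
  classical
  ext m
  simp only [coeff_sum, coeff_C_mul, coeff_X, mul_ite, mul_one, mul_zero]
  by_cases hm : m.degree = 1
  · obtain ⟨a, rfl⟩ := (Finsupp.sum_eq_one_iff m).1 hm
    have : ∀ l, Finsupp.single l 1 = Finsupp.single a 1 ↔ l = a := fun l =>
      ⟨fun h => Finsupp.single_left_injective one_ne_zero h, fun h => by rw [h]⟩
    simp [this]
  · rw [hg.coeff_eq_zero hm, Finset.sum_eq_zero]
    intro l _
    rw [if_neg]
    rintro rfl
    exact hm (by simp)

/-- The Hessian of a quadratic polynomial. -/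
noncomputable def quadHessian (f : PhasePoly) : PhaseMatrix :=
  Matrix.of fun k l =>
    MvPolynomial.coeff (Finsupp.single l 1) (MvPolynomial.pderiv k f)

/-- The matrix of the Hamiltonian vector field of a quadratic polynomial. -/
noncomputable def fieldMatrix (f : PhasePoly) : PhaseMatrix :=
  Matrix.of fun k l => -Complex.I * phaseSign k * quadHessian f k.swap l

theorem quadHessian_apply (f : PhasePoly) (k l : Fin 2 ⊕ Fin 2) :
    quadHessian f k l = MvPolynomial.coeff (Finsupp.single l 1 + Finsupp.single k 1) f
      * ((if l = k then 1 else 0) + 1) := by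
  classical
  rw [quadHessian, Matrix.of_apply, MvPolynomial.coeff_pderiv, Finsupp.single_apply]
  push_cast
  rfl

theorem quadHessian_symm (f : PhasePoly) (k l : Fin 2 ⊕ Fin 2) :
    quadHessian f k l = quadHessian f l k := by
  rw [quadHessian_apply, quadHessian_apply, add_comm (Finsupp.single l 1)]
  simp only [eq_comm]

theorem eval_pderiv {f : PhasePoly} (hf : f.IsHomogeneous 2) (z : PhaseSpace)
    (k : Fin 2 ⊕ Fin 2) :
    MvPolynomial.eval z (MvPolynomial.pderiv k f) = ∑ l, quadHessian f k l * z l := by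
  have h : (MvPolynomial.pderiv k f).IsHomogeneous 1 := hf.pderiv
  conv_lhs => rw [eq_sum_of_isHomogeneous_one h]
  simp [quadHessian]

theorem fieldMatrix_mulVec {f : PhasePoly} (hf : f.IsHomogeneous 2) (z : PhaseSpace)
    (k : Fin 2 ⊕ Fin 2) : (fieldMatrix f).mulVec z k
      = -Complex.I * phaseSign k * MvPolynomial.eval z (MvPolynomial.pderiv k.swap f) := by
  rw [eval_pderiv hf, Finset.mul_sum]
  simp [Matrix.mulVec, dotProduct, fieldMatrix, mul_assoc]

theorem solvesHamilton_iff {h : ℝ → PhasePoly} (hh : ∀ t, (h t).IsHomogeneous 2)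
    (z : ℝ → PhaseSpace) :
    SolvesHamilton h z ↔ ∀ t, HasDerivAt z ((fieldMatrix (h t)).mulVec (z t)) t := by
  refine forall_congr' fun t => ?_
  rw [hasDerivAt_pi]
  constructor
  · rintro hz (j | j)
    · rw [fieldMatrix_mulVec (hh t)]; simpa [phaseSign] using (hz j).1
    · rw [fieldMatrix_mulVec (hh t)]; simpa [phaseSign] using (hz j).2
  · intro hz j
    have h1 := hz (Sum.inl j)
    have h2 := hz (Sum.inr j)
    rw [fieldMatrix_mulVec (hh t)] at h1 h2
    exact ⟨by simpa [phaseSign] using h1, by simpa [phaseSign] using h2⟩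

theorem fieldMatrix_add (f g : PhasePoly) : fieldMatrix (f + g) = fieldMatrix f + fieldMatrix g := by
  ext k l; simp [fieldMatrix, quadHessian, mul_add]

theorem fieldMatrix_C_mul (a : ℂ) (f : PhasePoly) :
    fieldMatrix (MvPolynomial.C a * f) = a • fieldMatrix f := by
  ext k l
  simp [fieldMatrix, quadHessian]
  ring

theorem isHomogeneous_normalForm (a : Fin 2 → ℝ) : (normalForm a).IsHomogeneous 2 := by
  refine MvPolynomial.IsHomogeneous.sum _ _ _ fun j _ => MvPolynomial.IsHomogeneous.C_mul ?_ _
  exact (MvPolynomial.isHomogeneous_X ℂ _).mul (MvPolynomial.isHomogeneous_X ℂ _)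

theorem fieldMatrix_normalForm (a : Fin 2 → ℝ) : fieldMatrix (normalForm a) = normalMatrix a := by
  classical
  have hX : ∀ k l : Fin 2 ⊕ Fin 2, MvPolynomial.coeff (Finsupp.single k 1)
      (MvPolynomial.X l : PhasePoly) = if k = l then 1 else 0 := by
    intro k l
    rw [MvPolynomial.coeff_X]
    congr 1
    exact propext ⟨fun h => (Finsupp.single_left_injective one_ne_zero h).symm, fun h => by rw [h]⟩
  ext k l
  rcases k with k | k <;> rcases l with l | l <;> fin_cases k <;> fin_cases l <;>
    simp [fieldMatrix, quadHessian, normalForm, normalMatrix, phaseSign, eigenFreq, hX,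
      MvPolynomial.pderiv_X, Pi.single_apply]

/-- The symmetries of the Hessian of a quadratic form that is real on the real states. -/
theorem conj_quadHessian {f : PhasePoly} (hf : f.IsHomogeneous 2)
    (hr : ∀ z, IsRealState z → (MvPolynomial.eval z f).im = 0) (k l : Fin 2 ⊕ Fin 2) :
    quadHessian f k.swap l.swap = starRingEnd ℂ (quadHessian f k l) := by
  set B : PhaseSpace → PhaseSpace → ℂ := fun z w => ∑ k, z k * ∑ l, quadHessian f k l * w l with hB
  have hBz : ∀ z, B z z = 2 * MvPolynomial.eval z f := by
    intro z
    have h := congrArg (MvPolynomial.eval z) hf.sum_X_mul_pderiv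
    simpa [hB, eval_pderiv hf] using h
  have hsymm : ∀ z w, B z w = B w z := by
    intro z w
    simp only [hB, Finset.mul_sum]
    rw [Finset.sum_comm]
    refine Finset.sum_congr rfl fun k _ => Finset.sum_congr rfl fun l _ => ?_
    rw [quadHessian_symm]; ring
  have hadd : ∀ z w, B (z + w) (z + w) = B z z + B w w + 2 * B z w := by
    intro z w
    have e : B (z + w) (z + w) = B z z + B w w + B z w + B w z := by
      simp only [hB, Pi.add_apply, mul_add, add_mul, Finset.sum_add_distrib]
      ring
    rw [e, hsymm w z]; ring
  have him : ∀ z w, IsRealState z → IsRealState w → (B z w).im = 0 := by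
    intro z w hz hw
    have h1 := congrArg Complex.im (hadd z w)
    have hzw : IsRealState (z + w) := fun j => by simp [hz j, hw j]
    rw [hBz, hBz, hBz] at h1
    simp [hr _ hz, hr _ hw, hr _ hzw] at h1
    exact h1
  set u : Fin 2 → ℂ → PhaseSpace := fun j α =>
    Sum.elim (Pi.single j α) (Pi.single j (starRingEnd ℂ α)) with hu
  have hreal : ∀ j α, IsRealState (u j α) := by
    intro j α i
    by_cases h : i = j
    · subst h; simp [hu]
    · simp [hu, h]
  have hexp : ∀ i j α β, B (u i α) (u j β)
      = α * (quadHessian f (Sum.inl i) (Sum.inl j) * β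
          + quadHessian f (Sum.inl i) (Sum.inr j) * starRingEnd ℂ β)
        + starRingEnd ℂ α * (quadHessian f (Sum.inr i) (Sum.inl j) * β
          + quadHessian f (Sum.inr i) (Sum.inr j) * starRingEnd ℂ β) := by
    intro i j α β
    fin_cases i <;> fin_cases j <;> simp [hB, hu, Fintype.sum_sum_type]
  have key : ∀ i j, quadHessian f (Sum.inr i) (Sum.inr j)
        = starRingEnd ℂ (quadHessian f (Sum.inl i) (Sum.inl j)) ∧
      quadHessian f (Sum.inr i) (Sum.inl j)
        = starRingEnd ℂ (quadHessian f (Sum.inl i) (Sum.inr j)) := by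
    intro i j
    have h11 := him _ _ (hreal i 1) (hreal j 1)
    have h1I := him _ _ (hreal i 1) (hreal j Complex.I)
    have hI1 := him _ _ (hreal i Complex.I) (hreal j 1)
    have hII := him _ _ (hreal i Complex.I) (hreal j Complex.I)
    rw [hexp] at h11 h1I hI1 hII
    simp at h11 h1I hI1 hII
    constructor <;> apply Complex.ext <;> simp <;> linarith
  rcases k with i | i <;> rcases l with j | j
  · exact (key i j).1
  · exact (key i j).2
  · rw [Sum.swap_inr, Sum.swap_inl, (key i j).2, Complex.conj_conj]
  · rw [Sum.swap_inr, Sum.swap_inr, (key i j).1, Complex.conj_conj]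

theorem fieldMatrix_mem_sp2 {f : PhasePoly} (hf : f.IsHomogeneous 2)
    (hr : ∀ z, IsRealState z → (MvPolynomial.eval z f).im = 0) : fieldMatrix f ∈ sp2 := by
  rw [mem_sp2_iff]
  constructor
  · ext k l
    have h : (phaseSign l : ℂ) * phaseSign l = 1 := by exact_mod_cast phaseSign_mul_self l
    rw [sympAdj_apply, Matrix.neg_apply]
    simp only [fieldMatrix, Matrix.of_apply, Sum.swap_swap, phaseSign_swap]
    rw [quadHessian_symm f l]
    push_cast
    linear_combination (Complex.I * phaseSign k * quadHessian f k.swap l) * h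
  · ext k l
    have e := conj_quadHessian hf hr k l.swap
    rw [Sum.swap_swap] at e
    rw [realConj_apply]
    simp only [fieldMatrix, Matrix.of_apply, map_mul, phaseSign_swap, Complex.conj_ofReal, map_neg,
      Complex.conj_I, Sum.swap_swap, e]
    push_cast
    ring

/-- A function on the closed strip that is continuous and periodic is bounded. -/
theorem exists_bound_on_complexStrip {n : ℕ} {σ : ℝ} {f : (Fin n → ℂ) → ℂ}
    (hc : ContinuousOn f (complexStrip n σ))
    (hp : ∀ θ ∈ complexStrip n σ, ∀ i, f (θ + Pi.single i ((2 * Real.pi : ℝ) : ℂ)) = f θ) :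
    ∃ r : ℝ, 0 ≤ r ∧ ∀ θ ∈ complexStrip n σ, ‖f θ‖ ≤ r := by
  set S : Set (Fin n → ℂ) :=
    Set.univ.pi fun _ => Set.Icc 0 (2 * Real.pi) ×ℂ Set.Icc (-σ) σ with hS
  have hcomp : IsCompact S := isCompact_univ_pi fun _ => isCompact_Icc.reProdIm isCompact_Icc
  have hsub : S ⊆ complexStrip n σ := fun θ hθ i => by
    have := (Complex.mem_reProdIm.1 (hθ i trivial)).2
    exact abs_le.2 this
  obtain ⟨r, hr⟩ := hcomp.exists_bound_of_continuousOn (hc.mono hsub)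
  refine ⟨max r 0, le_max_right _ _, fun θ hθ => ?_⟩
  set w : Fin n → ℂ := fun i => Complex.I * ((θ i).im : ℂ) with hw
  have hmem : ∀ η : Fin n → ℝ, toComplexAngle η + w ∈ complexStrip n σ := fun η i => by
    simpa [toComplexAngle, hw] using hθ i
  have hper : IsTorusPeriodic fun η : Fin n → ℝ => f (toComplexAngle η + w) := fun η i => by
    simp only
    rw [toComplexAngle_add_single, add_right_comm]
    exact hp _ (hmem η) i
  have e : θ = toComplexAngle (fun i => (θ i).re) + w := by
    funext i
    simp only [toComplexAngle, hw, Pi.add_apply]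
    rw [mul_comm]; exact (Complex.re_add_im _).symm
  have h1 := hper.comp_torusRep_torusMk fun i => (θ i).re
  rw [← e] at h1
  rw [← h1]
  refine (hr _ fun i _ => ?_).trans (le_max_left _ _)
  refine Complex.mem_reProdIm.2 ⟨?_, abs_le.1 (hmem _ i)⟩
  have h2 := ((AddCircle.equivIco (1 : ℝ) 0) (torusMk (fun i => (θ i).re) i)).2
  have hpi := Real.pi_pos
  simp only [toComplexAngle, hw, Pi.add_apply, torusRep, Complex.add_re, Complex.ofReal_re,
    Complex.mul_re, Complex.I_re, Complex.I_im, Complex.ofReal_im]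
  rw [Set.mem_Ico] at h2
  rw [Set.mem_Icc]
  constructor <;> nlinarith [h2.1, h2.2]

theorem IsQuadraticPerturbation.exists_torusHolo {n : ℕ} {σ : ℝ} {q : (Fin n → ℂ) → PhasePoly}
    (hq : IsQuadraticPerturbation n σ q) :
    ∃ r : ℝ, 0 < r ∧ TorusHolo σ r fun θ => fieldMatrix (q θ) := by
  have hsub : openStrip n σ ⊆ complexStrip n σ := fun θ hθ i => (hθ i).le
  have han : ∀ k l, AnalyticOnNhd ℂ (fun θ => fieldMatrix (q θ) k l) (complexStrip n σ) := by
    intro k l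
    simp only [fieldMatrix, Matrix.of_apply, quadHessian_apply]
    exact analyticOnNhd_const.mul ((hq.analytic _).mul analyticOnNhd_const)
  choose r hr0 hr using fun k l => exists_bound_on_complexStrip (han k l).continuousOn
    fun θ hθ i => by rw [hq.periodic θ hθ i]
  set R := ∑ k, ∑ l, r k l with hR
  have hle : ∀ k l, r k l ≤ R := fun k l =>
    (Finset.single_le_sum (fun l _ => hr0 k l) (Finset.mem_univ l)).trans
      (Finset.single_le_sum (f := fun k => ∑ l, r k l)
        (fun k _ => Finset.sum_nonneg fun l _ => hr0 k l) (Finset.mem_univ k))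
  have hR0 : 0 ≤ R := (hr0 default default).trans (hle default default)
  refine ⟨4 * R + 1, by linarith, (torusHolo_of_entries hR0 fun k l => ?_).mono le_rfl (by linarith)⟩
  exact ⟨((han k l).mono hsub).differentiableOn, fun θ hθ i => by
    rw [hq.periodic θ (hsub hθ) i], fun θ hθ => (hr k l θ (hsub hθ)).trans (hle k l)⟩

/-! ### Conjugation of linear systems -/

theorem HasDerivAt.matrix_mulVec {Φ : ℝ → PhaseMatrix} {Φ' : PhaseMatrix} {z : ℝ → PhaseSpace}
    {z' : PhaseSpace} {t : ℝ} (hΦ : HasDerivAt Φ Φ' t) (hz : HasDerivAt z z' t) :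
    HasDerivAt (fun t => (Φ t).mulVec (z t)) (Φ'.mulVec (z t) + (Φ t).mulVec z') t := by
  rw [hasDerivAt_pi] at hz ⊢
  intro k
  have h : ∀ l, HasDerivAt (fun t => Φ t k l) (Φ' k l) t := fun l =>
    ((entryCLM k l).restrictScalars ℝ).hasFDerivAt.comp_hasDerivAt t hΦ
  have h2 := HasDerivAt.fun_sum (u := Finset.univ) fun l _ => (h l).mul (hz l)
  refine h2.congr_deriv ?_
  simp only [Matrix.mulVec, dotProduct, Pi.add_apply, Finset.sum_add_distrib]

theorem hasDerivAt_sympAdj {Φ : ℝ → PhaseMatrix} {Φ' : PhaseMatrix} {t : ℝ}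
    (hΦ : HasDerivAt Φ Φ' t) : HasDerivAt (fun t => sympAdj (Φ t)) (sympAdj Φ') t :=
  (LinearMap.toContinuousLinearMap sympAdj).hasFDerivAt.comp_hasDerivAt t hΦ

theorem solves_iff_of_conjugation {Φ M : ℝ → PhaseMatrix} {D : PhaseMatrix}
    (hΦ : ∀ t, IsRealSymplectic (Φ t)) (hM : ∀ t, M t ∈ sp2) (hD : D ∈ sp2)
    (hd : ∀ t, HasDerivAt Φ (D * Φ t - Φ t * M t) t) (z : ℝ → PhaseSpace) :
    (∀ t, HasDerivAt z ((M t).mulVec (z t)) t) ↔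
      ∀ t, HasDerivAt (fun t => (Φ t).mulVec (z t)) (D.mulVec ((Φ t).mulVec (z t))) t := by
  constructor
  · intro h t
    refine ((hd t).matrix_mulVec (h t)).congr_deriv ?_
    simp only [Matrix.sub_mulVec, Matrix.mulVec_mulVec]
    abel
  · intro h t
    have e : z = fun t => (sympAdj (Φ t)).mulVec ((Φ t).mulVec (z t)) := by
      funext t
      rw [Matrix.mulVec_mulVec, (hΦ t).left_inv, Matrix.one_mulVec]
    have h1 := (hasDerivAt_sympAdj (hd t)).matrix_mulVec (h t)
    rw [← e] at h1
    refine h1.congr_deriv ?_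
    rw [map_sub, sympAdj_mul, sympAdj_mul, ((mem_sp2_iff _).1 hD).1,
      ((mem_sp2_iff _).1 (hM t)).1]
    simp only [Matrix.mulVec_mulVec, ← Matrix.add_mulVec]
    have e2 : (sympAdj (Φ t) * -D - -M t * sympAdj (Φ t)) * Φ t + sympAdj (Φ t) * (D * Φ t)
        = M t * (sympAdj (Φ t) * Φ t) := by noncomm_ring
    rw [e2, (hΦ t).left_inv, mul_one]

theorem analyticAt_of_entries {n : ℕ} {f : (Fin n → ℝ) → PhaseMatrix} {θ : Fin n → ℝ}
    (h : ∀ k l, AnalyticAt ℝ (fun θ => f θ k l) θ) : AnalyticAt ℝ f θ := by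
  have e : f = fun θ => ∑ k, ∑ l, f θ k l • Matrix.single k l (1 : ℂ) := by
    funext θ
    exact phaseMatrix_eq_sum _
  rw [e]
  exact Finset.analyticAt_fun_sum _ fun k _ => Finset.analyticAt_fun_sum _ fun l _ =>
    (h k l).smul analyticAt_const

/-! ### The frequencies and the perturbation of the theorem -/

theorem FrequencyBounds.abs_sub_le {n : ℕ} {c K ε : ℝ} {ν : Fin 2 → (Fin n → ℝ) → ℝ}
    (h : FrequencyBounds n c K ε ν) {ω ω' : Fin n → ℝ} (hω : ω ∈ freqCube n)
    (hω' : ω' ∈ freqCube n) (j : Fin 2) : |ν j ω - ν j ω'| ≤ K * ε ^ 2 * ‖ω - ω'‖ := by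
  have hconv : Convex ℝ (freqCube n) := convex_pi fun i _ => convex_Ioc _ _
  exact hconv.norm_image_sub_le_of_norm_fderivWithin_le
    ((h.contDiff j).differentiableOn (by simp)) (h.deriv j) hω' hω

theorem fieldMatrix_quasiPeriodicHam {n : ℕ} (a : Fin 2 → ℝ) (ε : ℝ)
    (q : (Fin n → ℂ) → PhasePoly) (ω : Fin n → ℝ) (t : ℝ) :
    fieldMatrix (quasiPeriodicHam a ε q ω t)
      = normalMatrix a + ((ε ^ 3 : ℝ) : ℂ) • fieldMatrix (q (toComplexAngle (t • ω))) := by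
  rw [quasiPeriodicHam, fieldMatrix_add, fieldMatrix_C_mul, fieldMatrix_normalForm]

theorem toComplexAngle_mem_complexStrip {n : ℕ} {σ : ℝ} (hσ : 0 ≤ σ) (θ : Fin n → ℝ) :
    toComplexAngle θ ∈ complexStrip n σ := fun i => by simpa [toComplexAngle] using hσ

theorem IsQuadraticPerturbation.fieldMatrix_mem_sp2 {n : ℕ} {σ : ℝ}
    {q : (Fin n → ℂ) → PhasePoly} (hq : IsQuadraticPerturbation n σ q) (hσ : 0 ≤ σ)
    (θ : Fin n → ℝ) (a : ℝ) : (a : ℂ) • fieldMatrix (q (toComplexAngle θ)) ∈ sp2 := by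
  rw [Complex.coe_smul]
  exact smul_mem_sp2 a (_root_.fieldMatrix_mem_sp2
    (hq.homogeneous _ (toComplexAngle_mem_complexStrip hσ θ)) (hq.real θ))

theorem IsQuadraticPerturbation.isHomogeneous_quasiPeriodicHam {n : ℕ} {σ : ℝ}
    {q : (Fin n → ℂ) → PhasePoly} (hq : IsQuadraticPerturbation n σ q) (hσ : 0 ≤ σ)
    (a : Fin 2 → ℝ) (ε : ℝ) (ω : Fin n → ℝ) (t : ℝ) :
    (quasiPeriodicHam a ε q ω t).IsHomogeneous 2 :=
  (isHomogeneous_normalForm a).add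
    ((hq.homogeneous _ (toComplexAngle_mem_complexStrip hσ _)).C_mul _)

theorem kamSetup_of_small {n : ℕ} {σ c K ε r : ℝ} {q : (Fin n → ℂ) → PhasePoly}
    {ν : Fin 2 → (Fin n → ℝ) → ℝ} (hσ : 0 < σ) (hc : 0 < c) (hK : 0 < K) (hr : 0 < r)
    (hq : IsQuadraticPerturbation n σ q) (hQ : TorusHolo σ r fun θ => fieldMatrix (q θ))
    (hν : FrequencyBounds n c K ε ν) (hε : ε ≠ 0) (h1 : |ε| ≤ 1)
    (hf : 4 * r * |ε| ≤ min c 1) (hp : (K + 1) * |ε| ≤ min c 1 / 4)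
    (hs : 160 * kamConst n K (min c 1) (min σ 1 / 20) * kamRate n * r * |ε| ≤ 1) :
    KamSetup (fun ω j => ν j ω) (fun _ θ => ((ε ^ 3 : ℝ) : ℂ) • fieldMatrix (q θ))
      (min σ 1 / 2) (min σ 1 / 20) (min c 1) K |ε| (r * |ε| ^ 3) := by
  have hσ1 : 0 < min σ 1 := lt_min hσ one_pos
  have he : 0 < |ε| := abs_pos.2 hε
  have he2 : |ε| ^ 2 = ε ^ 2 := sq_abs ε
  have hcc : min c 1 ≤ c := min_le_left _ _
  refine ⟨by linarith, by linarith, by linarith [min_le_right σ 1], lt_min hc one_pos,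
    min_le_right _ _, hK.le, he, h1, fun ω hω => hcc.trans (hν.first ω hω).1,
    fun ω hω => ?_, fun ω hω => ?_, fun ω hω ω' hω' j => ?_, ?_,
    fun ω _ θ => hq.fieldMatrix_mem_sp2 hσ.le θ _, ?_, ?_, ?_⟩
  · rw [he2]
    exact (mul_le_mul_of_nonneg_right hcc (sq_nonneg ε)).trans (hν.second ω hω).1
  · rw [he2]; exact (hν.second ω hω).2
  · rw [he2]; exact hν.abs_sub_le hω hω' j
  · have hQ1 := hQ.mono (t := min σ 1 / 2 + 10 * (min σ 1 / 20))
      (by linarith [min_le_left σ 1]) le_rfl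
    refine ⟨by positivity, fun ω _ => ⟨hQ1.diff.fun_const_smul _, fun θ hθ i => ?_, fun θ hθ => ?_⟩,
      fun ω _ ω' _ θ _ => ?_⟩
    · rw [hQ1.periodic θ hθ i]
    · rw [norm_smul, Complex.norm_real, Real.norm_eq_abs, abs_pow, mul_comm]
      exact mul_le_mul_of_nonneg_right (hQ1.bound θ hθ) (by positivity)
    · rw [sub_self, norm_zero]; positivity
  · have := mul_le_mul_of_nonneg_right hf (sq_nonneg |ε|)
    linarith
  · have := mul_le_mul_of_nonneg_left h1 (mul_nonneg (by linarith : 0 ≤ K + 1) he.le)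
    linarith
  · have := mul_le_mul_of_nonneg_right hs (sq_nonneg |ε|)
    linarith

theorem conjugatesHamilton_zero {n : ℕ} (a : Fin 2 → ℝ) (q : (Fin n → ℂ) → PhasePoly)
    (ω : Fin n → ℝ) :
    ConjugatesHamilton (fun _ => 0) (quasiPeriodicHam a 0 q ω) (fun _ => normalForm a) := by
  intro z
  have : quasiPeriodicHam a 0 q ω = fun _ => normalForm a := by
    funext t; simp [quasiPeriodicHam]
  simp [this, NormedSpace.exp_zero]

theorem exists_conjugation_of_kamSetup {n : ℕ} {σ s δ c K e p ε r C : ℝ}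
    {q : (Fin n → ℂ) → PhasePoly} {ν : Fin 2 → (Fin n → ℝ) → ℝ} {lg : PhaseMatrix → PhaseMatrix}
    (hσ : 0 < σ) (hq : IsQuadraticPerturbation n σ q)
    (H : KamSetup (fun ω j => ν j ω) (fun _ θ => ((ε ^ 3 : ℝ) : ℂ) • fieldMatrix (q θ)) s δ c K e p)
    (hlg : ∀ y : PhaseMatrix, ‖y - 1‖ < r → AnalyticAt ℂ lg y ∧ NormedSpace.exp (lg y) = y ∧
      ‖lg y‖ ≤ 2 * ‖y - 1‖ ∧ (IsRealSymplectic y → lg y ∈ sp2))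
    (hr : 12 * kamGenBound n K c δ e p < r) (hb : 24 * kamGenBound n K c δ e p ≤ C * |ε|)
    (hp : 2 * p ≤ C * |ε| ^ 3) {ω : Fin n → ℝ}
    (hω : ω ∈ ⋂ j, kamGoodSet (fun ω j => ν j ω)
      (fun _ θ => ((ε ^ 3 : ℝ) : ℂ) • fieldMatrix (q θ)) e δ j) :
    ∃ A : (Fin n → ℝ) → PhaseMatrix,
      (∀ (θ : Fin n → ℝ) (i : Fin n), A (θ + Pi.single i (2 * Real.pi)) = A θ) ∧
      (∀ k l, AnalyticOnNhd ℝ (fun θ => A θ k l) Set.univ) ∧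
      (∀ θ, A θ ∈ sp2) ∧
      (∀ θ k l, ‖A θ k l‖ ≤ C * |ε|) ∧
      ∃ ν' : Fin 2 → ℝ,
        (∀ j, |ν' j - ν j ω| ≤ C * |ε| ^ 3) ∧
        ConjugatesHamilton (fun t => A (t • ω))
          (quasiPeriodicHam (fun j => ν j ω) ε q ω) (fun _ => normalForm ν') := by
  obtain ⟨Φ, ν', hper, hsymp, hnear, han, hν', hder⟩ := H.exists_conjugation hω
  have hΦ : ∀ θ, ‖Φ θ - 1‖ < r := fun θ => (hnear θ).trans_lt hr
  refine ⟨fun θ => lg (Φ θ), fun θ i => congrArg lg (hper θ i), fun k l θ _ => ?_,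
    fun θ => (hlg _ (hΦ θ)).2.2.2 (hsymp θ), fun θ k l => ?_, ν', fun j => (hν' j).trans hp,
    fun z => ?_⟩
  · have h1 : AnalyticAt ℝ lg (Φ θ) := (hlg _ (hΦ θ)).1.restrictScalars
    have h2 : AnalyticAt ℝ Φ θ := analyticAt_of_entries fun k l => han k l θ trivial
    exact (((entryCLM k l).restrictScalars ℝ).analyticAt _).comp (h1.comp h2)
  · refine (norm_entry_le _ k l).trans ((hlg _ (hΦ θ)).2.2.1.trans ?_)
    linarith [hnear θ]
  · rw [solvesHamilton_iff (hq.isHomogeneous_quasiPeriodicHam hσ.le _ ε ω),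
      solvesHamilton_iff fun _ => isHomogeneous_normalForm ν']
    simp only [fieldMatrix_quasiPeriodicHam, fieldMatrix_normalForm]
    have hexp : ∀ t : ℝ, NormedSpace.exp (lg (Φ (t • ω))) = Φ (t • ω) := fun t =>
      (hlg _ (hΦ _)).2.1
    simp only [hexp]
    exact solves_iff_of_conjugation (fun t => hsymp _)
      (fun t => add_mem_sp2 (normalMatrix_mem_sp2 _) (hq.fieldMatrix_mem_sp2 hσ.le _ _))
      (normalMatrix_mem_sp2 _) hder z

theorem mainTheorem4 (n : ℕ) (σ : ℝ) (hσ : 0 < σ)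
    (q : (Fin n → ℂ) → PhasePoly) (hq : IsQuadraticPerturbation n σ q)
    (c K ε₀ : ℝ) (hc : 0 < c) (hK : 0 < K) (hε₀ : 0 < ε₀)
    (ν : ℝ → Fin 2 → (Fin n → ℝ) → ℝ)
    (hν : ∀ ε : ℝ, |ε| < ε₀ → FrequencyBounds n c K ε (ν ε)) :
    ∃ εs : ℝ, 0 < εs ∧ ∃ C : ℝ, 0 < C ∧ ∀ ε : ℝ, |ε| < εs →
      ∃ E : Set (Fin n → ℝ), MeasurableSet E ∧ E ⊆ freqCube n ∧
        MeasureTheory.volume (freqCube n \ E) ≤ ENNReal.ofReal (C * |ε| ^ (1 / 9 : ℝ)) ∧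
        ∀ ω ∈ E, ∃ A : (Fin n → ℝ) → Matrix (Fin 2 ⊕ Fin 2) (Fin 2 ⊕ Fin 2) ℂ,
          (∀ (θ : Fin n → ℝ) (i : Fin n), A (θ + Pi.single i (2 * Real.pi)) = A θ) ∧
          (∀ k l, AnalyticOnNhd ℝ (fun θ => A θ k l) Set.univ) ∧
          (∀ θ, A θ ∈ sp2) ∧
          (∀ θ k l, ‖A θ k l‖ ≤ C * |ε|) ∧
          ∃ ν' : Fin 2 → ℝ,
            (∀ j, |ν' j - ν ε j ω| ≤ C * |ε| ^ 3) ∧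
            ConjugatesHamilton (fun t => A (t • ω))
              (quasiPeriodicHam (fun j => ν ε j ω) ε q ω)
              (fun _ => normalForm ν') := by
  obtain ⟨r, hr, hQ⟩ := hq.exists_torusHolo
  obtain ⟨ρ, hρ, lg, hlg⟩ := exists_log_isRealSymplectic
  have hc1 : 0 < min c 1 := lt_min hc one_pos
  have hδ : 0 < min σ 1 / 20 := div_pos (lt_min hσ one_pos) (by norm_num)
  set c₁ := min c 1
  set δ := min σ 1 / 20
  have hkc : 0 < kamConst n K c₁ δ := by unfold kamConst; positivity
  have hkr : 0 < kamRate n := by linarith [one_le_kamRate n]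
  set G := kamConst n K c₁ δ
  set T := 1 + 1 / ε₀ + 4 * r / c₁ + 4 * (K + 1) / c₁ + 160 * G * kamRate n * r + 24 * G * r / ρ
    with hT
  set V := 2 * (16 * ((2 * n) ^ n * (2 * Real.pi) ^ n * 2) * (3 / δ) ^ n) with hV
  have hV0 : 0 ≤ V := by positivity
  have t1 : 0 ≤ 1 / ε₀ := by positivity
  have t2 : 0 ≤ 4 * r / c₁ := by positivity
  have t3 : 0 ≤ 4 * (K + 1) / c₁ := by positivity
  have t4 : 0 ≤ 160 * G * kamRate n * r := by positivity
  have t5 : 0 ≤ 24 * G * r / ρ := by positivity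
  have hT0 : 0 < T := by linarith
  set C := V + 2 * r + 24 * G * r with hC
  have g0 : 0 < G * r := mul_pos hkc hr
  have hC0 : 0 < C := by linarith
  refine ⟨1 / T, by positivity, C, hC0, fun ε hε => ?_⟩
  rw [lt_div_iff₀ hT0] at hε
  have small : ∀ x ≤ T, x * |ε| < 1 := fun x hx => by
    have := mul_le_mul_of_nonneg_left hx (abs_nonneg ε)
    linarith
  rcases eq_or_ne ε 0 with rfl | hε0
  · refine ⟨freqCube n, MeasurableSet.univ_pi fun _ => measurableSet_Ioc, subset_rfl, by simp,
      fun ω _ => ⟨fun _ => 0, fun _ _ => rfl, fun _ _ => analyticOnNhd_const,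
        fun _ => zero_mem_sp2, fun _ _ _ => by simp, fun j => ν 0 j ω, fun j => by simp,
        conjugatesHamilton_zero _ q ω⟩⟩
  have he : 0 < |ε| := abs_pos.2 hε0
  have he1 : |ε| ≤ 1 := by simpa using (small 1 (by linarith)).le
  have s0 : |ε| < ε₀ := by
    have := small (1 / ε₀) (by linarith)
    rwa [one_div, inv_mul_eq_div, div_lt_one hε₀] at this
  have s1 : 4 * r * |ε| ≤ c₁ := by
    have := (small (4 * r / c₁) (by linarith)).le
    rwa [div_mul_eq_mul_div, div_le_one hc1] at this
  have s2 : (K + 1) * |ε| ≤ c₁ / 4 := by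
    have := (small (4 * (K + 1) / c₁) (by linarith)).le
    rw [div_mul_eq_mul_div, div_le_one hc1] at this
    linarith
  have s3 := (small (160 * G * kamRate n * r) (by linarith)).le
  have s4 : 24 * G * r * |ε| < ρ := by
    have := small (24 * G * r / ρ) (by linarith)
    rwa [div_mul_eq_mul_div, div_lt_one hρ] at this
  have H := kamSetup_of_small hσ hc hK hr hq hQ (hν ε s0) hε0 he1 s1 s2 s3
  have hb : kamGenBound n K c₁ δ |ε| (r * |ε| ^ 3) = G * r * |ε| := by
    unfold kamGenBound
    field_simp
    rfl
  set S := ⋂ j, kamGoodSet (fun ω j => ν ε j ω)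
    (fun _ θ => ((ε ^ 3 : ℝ) : ℂ) • fieldMatrix (q θ)) |ε| δ j with hS
  have hsub : freqCube n \ toMeasurable volume (freqCube n \ S) ⊆ S := by
    rintro ω ⟨hω, hω'⟩
    by_contra h
    exact hω' (subset_toMeasurable _ _ ⟨hω, h⟩)
  refine ⟨freqCube n \ toMeasurable volume (freqCube n \ S),
    (MeasurableSet.univ_pi fun _ => measurableSet_Ioc).diff (measurableSet_toMeasurable _ _),
    Set.sdiff_subset, ?_, fun ω hω => exists_conjugation_of_kamSetup hσ hq H hlg ?_ ?_ ?_ (hsub hω)⟩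
  · have h1 : freqCube n \ (freqCube n \ toMeasurable volume (freqCube n \ S))
        ⊆ toMeasurable volume (freqCube n \ S) := by
      rintro ω ⟨hω, hω'⟩
      by_contra h
      exact hω' ⟨hω, h⟩
    refine (measure_mono h1).trans ?_
    rw [measure_toMeasurable]
    refine H.volume_excluded_le.trans (ENNReal.ofReal_le_ofReal ?_)
    have h2 : |ε| ≤ |ε| ^ (1 / 9 : ℝ) := by
      have := Real.rpow_le_rpow_of_exponent_ge he he1 (show (1 / 9 : ℝ) ≤ 1 by norm_num)
      rwa [Real.rpow_one] at this
    exact mul_le_mul (show V ≤ C by linarith) h2 he.le hC0.le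
  · rw [hb]; linarith [mul_nonneg g0.le he.le]
  · rw [hb]
    have := mul_le_mul_of_nonneg_right (show 24 * G * r ≤ C by linarith) he.le
    linarith
  · have := mul_le_mul_of_nonneg_right (show 2 * r ≤ C by linarith) (pow_pos he 3).le
    linarith
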